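/- Let $n\ge 1$, let $\omega\subset\mathbb R^{2n}$ be open, with points written $A=(z,t)$, $z=(z_1,\dots,z_{2n-1})$, $t\in\mathbb R$, and let $\phi:\omega\to\mathbb R$ be continuous. Consider the vector fields $$\nabla^\phi_j=\partial_{z_j}-\tfrac{z_{j+n}}2\partial_t\ (1\le j<n),\qquad \nabla^\phi_n=\partial_{z_n}+\phi\,\partial_t,\qquad \nabla^\phi_j=\partial_{z_j}+\tfrac{z_{j-n}}2\partial_t\ (n<j\le 2n-1).$$ A characteristic of $\nabla^\phi_j$ is a curve $\Gamma:(a,b)\to\omega$ with $\dot\Gamma(s)=\nabla^\phi_j(\Gamma(s))$ for all $s\in(a,b)$. (For $n=1$ there is only $\nabla^\phi_1=\partial_z+\phi\,\partial_t$, and its characteristics are, up to a translation of the parameter, the curves $s\mapsto(s,\gamma(s))$ with $\dot\gamma(s)=\phi(s,\gamma(s))$.) (1) Let $1\le j\le 2n-1$ and suppose that $\phi$ is uniformly Lipschitz along the characteristics of $\nabla^\phi_j$: there is $L$ such that $s\mapsto\phi(\Gamma(s))$ is $L$-Lipschitz for every characteristic $\Gamma$ of $\nabla^\phi_j$. Then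 there is a single Borel (in particular universally measurable) function $\hat w:\omega\to\mathbb R$ such that for every characteristic $\Gamma:(a,b)\to\omega$ of $\nabla^\phi_j$ $$\frac{d}{ds}\phi(\Gamma(s))=\hat w(\Gamma(s))\qquad\text{for a.e. } s\in(a,b),$$ and moreover the equality holds at all but countably many of the points $s$ at which $s\mapsto\phi(\Gamma(s))$ is differentiable. (2) Let $w=(w_1,\dots,w_{2n-1})\in L^\infty(\omega;\mathbb R^{2n-1})$. If $\phi$ is a distributional solution of $\nabla^\phi\phi=w$, that is, for all $\psi\in C^\infty_c(\omega)$, $$\int_\omega\phi\,\nabla^\phi_j\psi=-\int_\omega w_j\psi\ \ (j\ne n),\qquad \int_\omega\Big(\phi\,\partial_{z_n}\psi+\tfrac12\phi^2\,\partial_t\psi\Big)=-\int_\omega w_n\psi,$$ then $\phi$ is a broad solution of $\nabla^\phi\phi=w$: there is a bounded universally measurable $\hat w=(\hat w_1,\dots,\hat w_{2n-1}):\omega\to\mathbb R^{2n-1}$ such that - $\hat w=w$ a.e. in $\omega$; - for every $j$, every $\delta>0$ and every characteristic $\Gamma:(-\delta,\delta)\to\omega$ of $\nabla^\phi_j$,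 the function $s\mapsto\phi(\Gamma(s))$ is absolutely continuous and $\frac{d}{ds}\phi(\Gamma(s))=\hat w_j(\Gamma(s))$ for a.e. $s\in(-\delta,\delta)$; - $\hat w_j(A)=\alpha$ whenever $\phi$ admits the $\nabla^\phi_j$-derivative $\alpha$ at $A\in\omega$, i.e. whenever $\frac{d}{ds}\phi(\Gamma(s))\big|_{s=0}$ exists and equals $\alpha$ for every $\delta>0$ and every characteristic $\Gamma:(-\delta,\delta)\to\omega$ of $\nabla^\phi_j$ with $\Gamma(0)=A$. -/

import Mathlib

open MeasureTheory Set Filter Topology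
open scoped NNReal ENNReal ContDiff

/-- The vertical hyperplane `𝕎 ≡ ℝ²ⁿ` of the Heisenberg group `ℍⁿ`, with points `A = (z, t)`,
`z = (z₁, …, z₂ₙ₋₁)` and `t ∈ ℝ`. Indices are zero-based: `A.1 j` is the coordinate usually written
`z_{j+1}`. The measure `volume` is Lebesgue measure on `ℝ²ⁿ`. -/
abbrev HPlane (n : ℕ) : Type := (Fin (2 * n - 1) → ℝ) × ℝ

/-- The `t`-component of the field `∇^φ_j = ∂_{z_j} + c_j ∂_t` on `𝕎`. In one-based indices,
`c_j = - z_{j+n} / 2` for `j < n`, `c_n = φ`, and `c_j = z_{j-n} / 2` for `j > n`. -/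
noncomputable def vertComponent {n : ℕ} (φ : HPlane n → ℝ) (j : Fin (2 * n - 1)) (A : HPlane n) :
    ℝ :=
  if h : j.val + 1 < n then -(A.1 ⟨j.val + n, by omega⟩) / 2
  else if j.val + 1 = n then φ A
  else A.1 ⟨j.val - n, by omega⟩ / 2

/-- The vector field `∇^φ_j` on `𝕎`. For `j = n` (one-based) it is the nonlinear field
`W^φ = ∂_{z_n} + φ ∂_t`; the others are the linear fields `X_{j+1}`. -/
noncomputable def gradField {n : ℕ} (φ : HPlane n → ℝ) (j : Fin (2 * n - 1)) (A : HPlane n) :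
    HPlane n :=
  (Pi.single j 1, vertComponent φ j A)

/-- `Γ`, restricted to the open interval `(a, b)`, is a characteristic (integral curve) of `∇^φ_j`
contained in `Ω`. For `φ` continuous on `Ω` it is then automatically of class `C¹` on `(a, b)`. -/
def IsCharacteristic {n : ℕ} (φ : HPlane n → ℝ) (Ω : Set (HPlane n)) (j : Fin (2 * n - 1))
    (Γ : ℝ → HPlane n) (a b : ℝ) : Prop :=
  ∀ s ∈ Ioo a b, Γ s ∈ Ω ∧ HasDerivAt Γ (gradField φ j (Γ s)) s

/-- `φ` is uniformly Lipschitz along the characteristics of `∇^φ_j` in `Ω`: one constant `L`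
serves all of them. -/
def UniformlyLipschitzAlong {n : ℕ} (φ : HPlane n → ℝ) (Ω : Set (HPlane n))
    (j : Fin (2 * n - 1)) : Prop :=
  ∃ L : ℝ≥0, ∀ (Γ : ℝ → HPlane n) (a b : ℝ), IsCharacteristic φ Ω j Γ a b →
    LipschitzOnWith L (fun s => φ (Γ s)) (Ioo a b)

/-- `φ` admits the `∇^φ_j`-derivative `α` at `A`: along every characteristic of `∇^φ_j` in `Ω`
that passes through `A` at time `0`, the function `φ` has derivative `α` at time `0`. -/
def HasGradDerivAt {n : ℕ} (φ : HPlane n → ℝ) (Ω : Set (HPlane n)) (j : Fin (2 * n - 1))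
    (α : ℝ) (A : HPlane n) : Prop :=
  ∀ δ > (0 : ℝ), ∀ Γ : ℝ → HPlane n, IsCharacteristic φ Ω j Γ (-δ) δ → Γ 0 = A →
    HasDerivAt (fun s => φ (Γ s)) α 0

/-- `f` is universally measurable: measurable for the completion of every finite (equivalently,
every σ-finite) Borel measure. -/
def UniversallyMeasurable {X Y : Type*} [MeasurableSpace X] [MeasurableSpace Y] (f : X → Y) :
    Prop :=
  ∀ μ : Measure X, IsFiniteMeasure μ → NullMeasurable f μ

/-- `g` is absolutely continuous on the open interval `(a, b)`: it is there the restriction of a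
function which is absolutely continuous on the closed interval. -/
def AbsContOnOpenInterval (g : ℝ → ℝ) (a b : ℝ) : Prop :=
  ∃ G : ℝ → ℝ, AbsolutelyContinuousOnInterval G a b ∧ EqOn g G (Ioo a b)

/-- Continuous distributional solutions in `Ω` of the system `∇^φ φ = w`, that is of
`X_{j+1} φ = w_j` for `j ≠ n` and `∂_{z_n} φ + ∂_t (φ² / 2) = w_n` (one-based indices). -/
def IsDistributionalSolution {n : ℕ} (φ : HPlane n → ℝ) (Ω : Set (HPlane n))
    (w : HPlane n → Fin (2 * n - 1) → ℝ) : Prop :=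
  ContinuousOn φ Ω ∧
  ∀ ψ : HPlane n → ℝ, ContDiff ℝ ∞ ψ → HasCompactSupport ψ → tsupport ψ ⊆ Ω →
    ∀ j : Fin (2 * n - 1),
      (j.val + 1 ≠ n →
        ∫ A in Ω, φ A * fderiv ℝ ψ A (gradField φ j A) = -∫ A in Ω, w A j * ψ A) ∧
      (j.val + 1 = n →
        ∫ A in Ω, (φ A * fderiv ℝ ψ A (Pi.single j 1, 0)
            + (1 / 2) * φ A ^ 2 * fderiv ℝ ψ A (0, 1)) = -∫ A in Ω, w A j * ψ A)

/-- Continuous broad solutions in `Ω` of `∇^φ φ = w`: there is a bounded universally measurable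
representative `what` of `w` such that `φ` is absolutely continuous along every characteristic of
every `∇^φ_j`, with derivative `what_j` almost everywhere, and such that `what_j` is the
`∇^φ_j`-derivative of `φ` wherever `φ` admits one. -/
def IsBroadSolution {n : ℕ} (φ : HPlane n → ℝ) (Ω : Set (HPlane n))
    (w : HPlane n → Fin (2 * n - 1) → ℝ) : Prop :=
  ContinuousOn φ Ω ∧
  ∃ what : HPlane n → Fin (2 * n - 1) → ℝ,
    UniversallyMeasurable what ∧
    (∃ C : ℝ, ∀ A ∈ Ω, ∀ j, |what A j| ≤ C) ∧
    (∀ᵐ A ∂(volume.restrict Ω), what A = w A) ∧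
    (∀ (j : Fin (2 * n - 1)) (δ : ℝ) (Γ : ℝ → HPlane n), 0 < δ →
      IsCharacteristic φ Ω j Γ (-δ) δ →
        AbsContOnOpenInterval (fun s => φ (Γ s)) (-δ) δ ∧
        ∀ᵐ s ∂(volume.restrict (Ioo (-δ) δ)),
          HasDerivAt (fun r => φ (Γ r)) (what (Γ s) j) s) ∧
    (∀ (j : Fin (2 * n - 1)) (A : HPlane n) (α : ℝ), A ∈ Ω → HasGradDerivAt φ Ω j α A →
      what A j = α)

/-! ### The fields `∇^φ_j` and their characteristics -/

section Basics

variable {n : ℕ} {φ φ' : HPlane n → ℝ} {Ω : Set (HPlane n)} {j : Fin (2 * n - 1)}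
  {Γ Γ' : ℝ → HPlane n} {a b : ℝ}

theorem vertComponent_of_eq (hj : j.val + 1 = n) (A : HPlane n) :
    vertComponent φ j A = φ A := by
  unfold vertComponent
  rw [dif_neg (by omega), if_pos hj]

/-- The linear fields do not depend on `φ`, nor on the coordinates `z_j` and `t`. -/
theorem vertComponent_congr (hj : j.val + 1 ≠ n) {A B : HPlane n}
    (hAB : ∀ i, i ≠ j → A.1 i = B.1 i) : vertComponent φ j A = vertComponent φ' j B := by
  have hj2 := j.isLt
  unfold vertComponent
  split_ifs with h
  · rw [hAB _ (by intro h'; have := congrArg Fin.val h'; simp at this; omega)]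
  · rw [hAB _ (by intro h'; have := congrArg Fin.val h'; simp at this; omega)]

theorem vertComponent_congr_of_eq {A : HPlane n} (h : φ A = φ' A) :
    vertComponent φ j A = vertComponent φ' j A := by
  unfold vertComponent
  split_ifs <;> simp [h]

theorem continuousOn_vertComponent (hφ : ContinuousOn φ Ω) (j : Fin (2 * n - 1)) :
    ContinuousOn (vertComponent φ j) Ω := by
  unfold vertComponent
  split_ifs <;> fun_prop

theorem continuousOn_gradField (hφ : ContinuousOn φ Ω) (j : Fin (2 * n - 1)) :
    ContinuousOn (gradField φ j) Ω :=
  continuousOn_const.prodMk (continuousOn_vertComponent hφ j)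

theorem IsCharacteristic.mono {a' b' : ℝ} (hΓ : IsCharacteristic φ Ω j Γ a b) (ha : a ≤ a')
    (hb : b' ≤ b) : IsCharacteristic φ Ω j Γ a' b' := fun s hs =>
  hΓ s ⟨ha.trans_lt hs.1, hs.2.trans_le hb⟩

theorem IsCharacteristic.comp_add_const (hΓ : IsCharacteristic φ Ω j Γ a b) (c : ℝ) :
    IsCharacteristic φ Ω j (fun s => Γ (s + c)) (a - c) (b - c) := fun s hs => by
  have h := hΓ (s + c) ⟨by linarith [hs.1], by linarith [hs.2]⟩
  exact ⟨h.1, h.2.comp_add_const s c⟩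

theorem IsCharacteristic.mono_set {Ω' : Set (HPlane n)} (hΓ : IsCharacteristic φ Ω j Γ a b)
    (h : ∀ s ∈ Ioo a b, Γ s ∈ Ω') : IsCharacteristic φ Ω' j Γ a b := fun s hs =>
  ⟨h s hs, (hΓ s hs).2⟩

theorem IsCharacteristic.hasDerivAt_snd (hΓ : IsCharacteristic φ Ω j Γ a b) {s : ℝ}
    (hs : s ∈ Ioo a b) : HasDerivAt (fun r => (Γ r).2) (vertComponent φ j (Γ s)) s :=
  ((hΓ s hs).2.hasFDerivAt.snd).hasDerivAt.congr_deriv (by simp [gradField])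

theorem IsCharacteristic.hasDerivAt_fst (hΓ : IsCharacteristic φ Ω j Γ a b) {s : ℝ}
    (hs : s ∈ Ioo a b) : HasDerivAt (fun r => (Γ r).1) (Pi.single j 1) s :=
  ((hΓ s hs).2.hasFDerivAt.fst).hasDerivAt.congr_deriv (by simp [gradField])

theorem IsCharacteristic.fst_eq (hΓ : IsCharacteristic φ Ω j Γ a b) {s r : ℝ}
    (hs : s ∈ Ioo a b) (hr : r ∈ Ioo a b) :
    (Γ r).1 = (Γ s).1 + (r - s) • Pi.single j 1 := by
  have hd : ∀ x ∈ Ioo a b, HasDerivWithinAt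
      (fun x => (Γ x).1 - x • (Pi.single j 1 : Fin (2 * n - 1) → ℝ)) 0 (Ioo a b) x := by
    intro x hx
    have h2 := (hΓ.hasDerivAt_fst hx).sub
      ((hasDerivAt_id x).smul_const (Pi.single j 1 : Fin (2 * n - 1) → ℝ))
    simp only [one_smul, sub_self] at h2
    exact h2.hasDerivWithinAt
  have h := (convex_Ioo a b).norm_image_sub_le_of_norm_hasDerivWithin_le hd (C := 0)
    (by simp) hs hr
  simp only [zero_mul, norm_le_zero_iff] at h
  have h' := sub_eq_zero.1 h
  rw [sub_smul]
  have h3 := eq_add_of_sub_eq h'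
  rw [h3]; abel

theorem IsCharacteristic.fst_eq_zero {δ : ℝ} (hΓ : IsCharacteristic φ Ω j Γ (-δ) δ) {r : ℝ}
    (hr : r ∈ Ioo (-δ) δ) : (Γ r).1 = (Γ 0).1 + r • Pi.single j 1 := by
  have h := hΓ.fst_eq (s := 0) (r := r) ⟨by linarith [hr.1, hr.2], by linarith [hr.1, hr.2]⟩ hr
  rwa [sub_zero] at h

theorem IsCharacteristic.continuousOn (hΓ : IsCharacteristic φ Ω j Γ a b) :
    ContinuousOn Γ (Ioo a b) := fun s hs =>
  (hΓ s hs).2.continuousAt.continuousWithinAt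

/-- Characteristics of a linear field are determined by one of their points. -/
theorem IsCharacteristic.eqOn_of_ne (hj : j.val + 1 ≠ n) (hΓ : IsCharacteristic φ Ω j Γ a b)
    (hΓ' : IsCharacteristic φ' Ω j Γ' a b) {s : ℝ} (hs : s ∈ Ioo a b) (h : Γ s = Γ' s) :
    EqOn Γ Γ' (Ioo a b) := by
  intro r hr
  have hd : ∀ x ∈ Ioo a b, HasDerivWithinAt (fun x => (Γ x).2 - (Γ' x).2) 0 (Ioo a b) x := by
    intro x hx
    have h2 := (hΓ.hasDerivAt_snd hx).sub (hΓ'.hasDerivAt_snd hx)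
    rw [vertComponent_congr (φ' := φ') hj (B := Γ' x) (fun i _ => by
      rw [hΓ.fst_eq hs hx, hΓ'.fst_eq hs hx, h]), sub_self] at h2
    exact h2.hasDerivWithinAt
  have h2 := (convex_Ioo a b).norm_image_sub_le_of_norm_hasDerivWithin_le hd (C := 0)
    (by simp) hs hr
  simp only [zero_mul, norm_le_zero_iff, h, sub_self, sub_zero] at h2
  refine Prod.ext ?_ (sub_eq_zero.1 h2)
  rw [hΓ.fst_eq hs hr, hΓ'.fst_eq hs hr, h]

end Basics

/-- A pointwise limit of curves whose derivatives are equicontinuous and converge pointwise is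
differentiable, with the expected derivative. -/
theorem hasDerivAt_of_tendsto_of_equicontinuous {ι E : Type*} [NormedAddCommGroup E]
    [NormedSpace ℝ E] {l : Filter ι} [l.NeBot] {γ y : ι → ℝ → E} {γ₀ y₀ : ℝ → E} {a b s : ℝ}
    (hs : s ∈ Ioo a b) (hd : ∀ᶠ i in l, ∀ r ∈ Ioo a b, HasDerivAt (γ i) (y i r) r)
    (hequi : ∀ ε > 0, ∃ η > 0, ∀ᶠ i in l, ∀ r ∈ Ioo a b, ∀ r' ∈ Ioo a b, |r - r'| < η →
      ‖y i r - y i r'‖ ≤ ε)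
    (hγ : ∀ r ∈ Ioo a b, Tendsto (fun i => γ i r) l (𝓝 (γ₀ r)))
    (hy : Tendsto (fun i => y i s) l (𝓝 (y₀ s))) :
    HasDerivAt γ₀ (y₀ s) s := by
  rw [hasDerivAt_iff_isLittleO, Asymptotics.isLittleO_iff]
  intro ε hε
  obtain ⟨η, hη, hequi⟩ := hequi ε hε
  have h1 : ∀ᶠ r in 𝓝 s, r ∈ Ioo a b := isOpen_Ioo.mem_nhds hs
  have h2 : ∀ᶠ r in 𝓝 s, r ∈ Ioo (s - η) (s + η) :=
    isOpen_Ioo.mem_nhds ⟨by linarith, by linarith⟩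
  filter_upwards [h1, h2] with r hr hr2
  have hlim : Tendsto (fun i => ‖γ i r - γ i s - (r - s) • y i s‖) l
      (𝓝 ‖γ₀ r - γ₀ s - (r - s) • y₀ s‖) :=
    (((hγ r hr).sub (hγ s hs)).sub (hy.const_smul _)).norm
  refine le_of_tendsto hlim ?_
  filter_upwards [hd, hequi] with i hdi hei
  have hdi' : ∀ x ∈ Ioo a b ∩ Ioo (s - η) (s + η), HasDerivWithinAt
      (fun x => γ i x - x • y i s) (y i x - y i s) (Ioo a b ∩ Ioo (s - η) (s + η)) x := by
    intro x hx
    have := (hdi x hx.1).sub ((hasDerivAt_id x).smul_const (y i s))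
    simp only [one_smul] at this
    exact this.hasDerivWithinAt
  have h := ((convex_Ioo a b).inter (convex_Ioo (s - η) (s + η)))
    |>.norm_image_sub_le_of_norm_hasDerivWithin_le hdi' (C := ε) (fun x hx => hei x hx.1 s hs
      (abs_lt.2 ⟨by linarith [hx.2.1], by linarith [hx.2.2]⟩))
      ⟨hs, by constructor <;> linarith⟩ ⟨hr, hr2⟩
  have e : γ i r - γ i s - (r - s) • y i s = γ i r - r • y i s - (γ i s - s • y i s) := by
    rw [sub_smul]; abel
  rw [e]
  exact h

/-! ### Points through which `φ` has a given rate of growth along some characteristic -/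

section Slope

variable {n : ℕ} {φ : HPlane n → ℝ} {Ω : Set (HPlane n)} {j : Fin (2 * n - 1)}

/-- The points `A` of `Ω` such that, along some characteristic of `∇^φ_j` through `A` which stays
in `K` for `|s| < δ`, the function `φ` lies above the line of slope `q` for positive times and below
it for negative times. -/
def slopeSet (φ : HPlane n → ℝ) (Ω : Set (HPlane n)) (j : Fin (2 * n - 1)) (K : Set (HPlane n))
    (q δ : ℝ) : Set (HPlane n) :=
  {A | ∃ Γ : ℝ → HPlane n, IsCharacteristic φ Ω j Γ (-δ) δ ∧ Γ 0 = A ∧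
    (∀ s ∈ Ioo (-δ) δ, Γ s ∈ K) ∧ (∀ s ∈ Ioo 0 δ, φ A + q * s ≤ φ (Γ s)) ∧
    ∀ s ∈ Ioo (-δ) 0, φ (Γ s) ≤ φ A + q * s}

theorem exists_bound_equicontinuous {K : Set (HPlane n)} (hφ : ContinuousOn φ K)
    (hK : IsCompact K) (j : Fin (2 * n - 1)) :
    ∀ ε > 0, ∃ η > 0, ∀ (Γ : ℝ → HPlane n) (a b : ℝ), IsCharacteristic φ K j Γ a b →
      ∀ r ∈ Ioo a b, ∀ r' ∈ Ioo a b, |r - r'| < η →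
        ‖gradField φ j (Γ r) - gradField φ j (Γ r')‖ ≤ ε := by
  intro ε hε
  have hV := continuousOn_gradField hφ j
  obtain ⟨M, hM⟩ := hK.exists_bound_of_continuousOn hV
  have hM' : 0 < max M 1 := by positivity
  obtain ⟨ρ, hρ, hu⟩ := Metric.uniformContinuousOn_iff.1
    (hK.uniformContinuousOn_of_continuous hV) ε hε
  refine ⟨ρ / max M 1, by positivity, fun Γ a b hΓ r hr r' hr' hrr => ?_⟩
  have hlip := (convex_Ioo a b).norm_image_sub_le_of_norm_hasDerivWithin_le
    (fun x hx => (hΓ x hx).2.hasDerivWithinAt) (C := max M 1)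
    (fun x hx => (hM _ (hΓ x hx).1).trans (le_max_left _ _)) hr' hr
  rw [← dist_eq_norm]
  refine (hu _ (hΓ r hr).1 _ (hΓ r' hr').1 ?_).le
  rw [dist_eq_norm]
  refine hlip.trans_lt ?_
  rw [Real.norm_eq_abs]
  rwa [lt_div_iff₀ hM', mul_comm] at hrr

theorem isClosed_slopeSet (hφ : ContinuousOn φ Ω) {K : Set (HPlane n)} (hK : IsCompact K)
    (hKΩ : K ⊆ Ω) (q : ℝ) {δ : ℝ} (hδ : 0 < δ) : IsClosed (slopeSet φ Ω j K q δ) := by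
  rw [isClosed_iff_ultrafilter]
  intro A u hu hmem
  have h0 : (0 : ℝ) ∈ Ioo (-δ) δ := ⟨by linarith, hδ⟩
  have hex : ∀ B, ∃ Γ : ℝ → HPlane n, B ∈ slopeSet φ Ω j K q δ →
      (IsCharacteristic φ Ω j Γ (-δ) δ ∧ Γ 0 = B ∧
      (∀ s ∈ Ioo (-δ) δ, Γ s ∈ K) ∧ (∀ s ∈ Ioo 0 δ, φ B + q * s ≤ φ (Γ s)) ∧
      ∀ s ∈ Ioo (-δ) 0, φ (Γ s) ≤ φ B + q * s) := by
    intro B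
    by_cases hB : B ∈ slopeSet φ Ω j K q δ
    · obtain ⟨Γ, h⟩ := hB
      exact ⟨Γ, fun _ => h⟩
    · exact ⟨fun _ => B, fun h => absurd h hB⟩
  choose Γ hΓ using hex
  have hev : ∀ᶠ B in (u : Filter (HPlane n)), B ∈ slopeSet φ Ω j K q δ := hmem
  have hlim : ∀ s, ∃ x, s ∈ Ioo (-δ) δ → x ∈ K ∧ Tendsto (fun B => Γ B s) u (𝓝 x) := by
    intro s
    by_cases hs : s ∈ Ioo (-δ) δ
    · obtain ⟨x, hx, hux⟩ := hK.ultrafilter_le_nhds (u.map fun B => Γ B s) (by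
        rw [le_principal_iff]
        exact hev.mono fun B hB => (hΓ B hB).2.2.1 s hs)
      exact ⟨x, fun _ => ⟨hx, hux⟩⟩
    · exact ⟨A, fun h => absurd h hs⟩
  choose G hG using hlim
  have hG0 : G 0 = A := by
    refine tendsto_nhds_unique (hG 0 h0).2 ?_
    refine Tendsto.congr' ?_ (show Tendsto (fun B => B) (u : Filter _) (𝓝 A) from hu)
    exact hev.mono fun B hB => ((hΓ B hB).2.1).symm
  have hAK : A ∈ K := hG0 ▸ (hG 0 h0).1
  have htend : ∀ {f : HPlane n → HPlane n}, ContinuousOn f K → ∀ s ∈ Ioo (-δ) δ,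
      Tendsto (fun B => f (Γ B s)) u (𝓝 (f (G s))) := by
    intro f hf s hs
    refine (hf _ (hG s hs).1).tendsto.comp
      (tendsto_nhdsWithin_iff.2 ⟨(hG s hs).2, hev.mono fun B hB => (hΓ B hB).2.2.1 s hs⟩)
  have htendφ : ∀ s ∈ Ioo (-δ) δ, Tendsto (fun B => φ (Γ B s)) u (𝓝 (φ (G s))) := by
    intro s hs
    refine ((hφ.mono hKΩ) _ (hG s hs).1).tendsto.comp
      (tendsto_nhdsWithin_iff.2 ⟨(hG s hs).2, hev.mono fun B hB => (hΓ B hB).2.2.1 s hs⟩)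
  have htend0 : Tendsto (fun B => φ B) u (𝓝 (φ A)) := by
    have := htendφ 0 h0
    rw [hG0] at this
    exact this.congr' (hev.mono fun B hB => by simp only [(hΓ B hB).2.1])
  refine ⟨G, fun s hs => ⟨hKΩ (hG s hs).1, ?_⟩, hG0, fun s hs => (hG s hs).1, fun s hs => ?_,
    fun s hs => ?_⟩
  · refine hasDerivAt_of_tendsto_of_equicontinuous (l := (u : Filter (HPlane n))) (γ := Γ)
      (y := fun B r => gradField φ j (Γ B r)) (y₀ := fun r => gradField φ j (G r)) hs
      (hev.mono fun B hB r hr => ((hΓ B hB).1 r hr).2) ?_ (fun r hr => (hG r hr).2)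
      (htend (continuousOn_gradField (hφ.mono hKΩ) j) s hs)
    intro ε hε
    obtain ⟨η, hη, h⟩ := exists_bound_equicontinuous (hφ.mono hKΩ) hK j ε hε
    exact ⟨η, hη, hev.mono fun B hB => h (Γ B) (-δ) δ
      ((hΓ B hB).1.mono_set (hΓ B hB).2.2.1)⟩
  · exact le_of_tendsto_of_tendsto (htend0.add_const _) (htendφ s ⟨by linarith [hs.1], hs.2⟩)
      (hev.mono fun B hB => (hΓ B hB).2.2.2.1 s hs)
  · exact le_of_tendsto_of_tendsto (htendφ s ⟨hs.1, by linarith [hs.2]⟩) (htend0.add_const _)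
      (hev.mono fun B hB => (hΓ B hB).2.2.2.2 s hs)

/-- An open set of a locally compact, second countable space is exhausted by compact sets. -/
theorem IsOpen.exists_compact_exhaustion {X : Type*} [TopologicalSpace X] [LocallyCompactSpace X]
    [SecondCountableTopology X] {U : Set X} (hU : IsOpen U) :
    ∃ K : ℕ → Set X, (∀ m, IsCompact (K m)) ∧ (∀ m, K m ⊆ U) ∧
      ∀ C ⊆ U, IsCompact C → ∃ m, C ⊆ K m := by
  have : LocallyCompactSpace U := hU.locallyCompactSpace
  let E : CompactExhaustion U := default
  refine ⟨fun m => Subtype.val '' (E m), fun m => (E.isCompact m).image continuous_subtype_val,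
    fun m => by rintro _ ⟨x, -, rfl⟩; exact x.2, fun C hC hCc => ?_⟩
  obtain ⟨m, hm⟩ := E.exists_superset_of_isCompact (s := Subtype.val ⁻¹' C)
    (Topology.IsInducing.subtypeVal.isCompact_preimage' hCc (by simpa using hC))
  exact ⟨m, fun x hx => ⟨⟨x, hC hx⟩, hm hx, rfl⟩⟩

theorem measurableSet_iUnion_slopeSet (hΩ : IsOpen Ω) (hφ : ContinuousOn φ Ω) (q : ℝ) :
    MeasurableSet {A | ∃ δ > 0, A ∈ slopeSet φ Ω j Ω q δ} := by
  obtain ⟨K, hK, hKΩ, hC⟩ := hΩ.exists_compact_exhaustion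
  have : {A | ∃ δ > 0, A ∈ slopeSet φ Ω j Ω q δ} =
      ⋃ (k : ℕ) (m : ℕ), slopeSet φ Ω j (K m) q (1 / ((k : ℝ) + 1)) := by
    ext A
    simp only [mem_ofPred_eq, mem_iUnion]
    constructor
    · rintro ⟨δ, hδ, Γ, hΓ, h0, -, h1, h2⟩
      obtain ⟨k, hk⟩ := exists_nat_one_div_lt hδ
      have hk0 : (0 : ℝ) < 1 / ((k : ℝ) + 1) := by positivity
      set d := 1 / ((k : ℝ) + 1)
      have hsub : Icc (-d) d ⊆ Ioo (-δ) δ := fun s hs =>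
        ⟨by linarith [hs.1], by linarith [hs.2]⟩
      obtain ⟨m, hm⟩ := hC (Γ '' Icc (-d) d) (by
        rintro _ ⟨s, hs, rfl⟩
        exact (hΓ s (hsub hs)).1) (isCompact_Icc.image_of_continuousOn
          (hΓ.continuousOn.mono hsub))
      exact ⟨k, m, Γ, hΓ.mono (by linarith) hk.le, h0,
        fun s hs => hm ⟨s, Ioo_subset_Icc_self hs, rfl⟩, fun s hs => h1 s ⟨hs.1, hs.2.trans hk⟩,
        fun s hs => h2 s ⟨by linarith [hs.1], hs.2⟩⟩
    · rintro ⟨k, m, Γ, hΓ, h0, hKm, h1, h2⟩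
      exact ⟨_, by positivity, Γ, hΓ, h0, fun s hs => hKΩ m (hKm s hs), h1, h2⟩
  rw [this]
  exact MeasurableSet.iUnion fun k => MeasurableSet.iUnion fun m =>
    (isClosed_slopeSet hφ (hK m) (hKΩ m) q (by positivity)).measurableSet

/-- The supremum of the rates of growth of `φ` along the characteristics through a point. -/
noncomputable def upperSlope (φ : HPlane n → ℝ) (Ω : Set (HPlane n)) (j : Fin (2 * n - 1))
    (A : HPlane n) : EReal :=
  ⨆ (q : ℚ) (_ : ∃ δ > 0, A ∈ slopeSet φ Ω j Ω q δ), ((q : ℝ) : EReal)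

theorem measurable_upperSlope (hΩ : IsOpen Ω) (hφ : ContinuousOn φ Ω) :
    Measurable (upperSlope φ Ω j) := by
  classical
  refine Measurable.iSup fun q => ?_
  have : (fun A => ⨆ (_ : ∃ δ > 0, A ∈ slopeSet φ Ω j Ω q δ), ((q : ℝ) : EReal)) =
      fun A => if A ∈ {A | ∃ δ > 0, A ∈ slopeSet φ Ω j Ω q δ} then ((q : ℝ) : EReal) else ⊥ := by
    ext A
    rw [iSup_eq_if]
    rfl
  rw [this]
  exact Measurable.ite (measurableSet_iUnion_slopeSet hΩ hφ q) measurable_const measurable_const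

/-- A differentiable function lies locally above any line of smaller slope for positive times,
and below it for negative times. -/
theorem HasDerivAt.eventually_slope {f : ℝ → ℝ} {d q s : ℝ} (hf : HasDerivAt f d s) (hq : q < d) :
    ∃ δ > 0, (∀ r ∈ Ioo s (s + δ), f s + q * (r - s) < f r) ∧
      ∀ r ∈ Ioo (s - δ) s, f r < f s + q * (r - s) := by
  have h := (hasDerivAt_iff_tendsto_slope.1 hf).eventually (lt_mem_nhds hq)
  rw [eventually_nhdsWithin_iff, Metric.eventually_nhds_iff] at h
  obtain ⟨δ, hδ, h⟩ := h
  refine ⟨δ, hδ, fun r hr => ?_, fun r hr => ?_⟩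
  · have h1 := h (y := r) (by rw [Real.dist_eq, abs_lt]; constructor <;> linarith [hr.1, hr.2])
      (by simpa using hr.1.ne')
    rw [slope_def_field, lt_div_iff₀ (by linarith [hr.1])] at h1
    linarith
  · have h1 := h (y := r) (by rw [Real.dist_eq, abs_lt]; constructor <;> linarith [hr.1, hr.2])
      (by simpa using hr.2.ne)
    rw [slope_def_field, lt_div_iff_of_neg (by linarith [hr.2])] at h1
    linarith

theorem mem_slopeSet_of_hasDerivAt {Γ : ℝ → HPlane n} {δ d q : ℝ} (hδ : 0 < δ)
    (hΓ : IsCharacteristic φ Ω j Γ (-δ) δ) (hd : HasDerivAt (fun s => φ (Γ s)) d 0)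
    (hq : q < d) : ∃ δ' > 0, Γ 0 ∈ slopeSet φ Ω j Ω q δ' := by
  obtain ⟨η, hη, h1, h2⟩ := hd.eventually_slope hq
  simp only [zero_add, zero_sub, sub_zero] at h1 h2
  refine ⟨min δ η, lt_min hδ hη, Γ, hΓ.mono (by simp) (min_le_left _ _), rfl,
    fun s hs => (hΓ s ⟨?_, hs.2.trans_le (min_le_left _ _)⟩).1,
    fun s hs => (h1 s ⟨hs.1, hs.2.trans_le (min_le_right _ _)⟩).le,
    fun s hs => (h2 s ⟨?_, hs.2⟩).le⟩
  · have := min_le_left δ η; linarith [hs.1]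
  · have := min_le_right δ η; linarith [hs.1]

theorem le_upperSlope {Γ : ℝ → HPlane n} {δ d : ℝ} (hδ : 0 < δ)
    (hΓ : IsCharacteristic φ Ω j Γ (-δ) δ) (hd : HasDerivAt (fun s => φ (Γ s)) d 0) :
    (d : EReal) ≤ upperSlope φ Ω j (Γ 0) := by
  refine le_of_forall_lt fun c hc => ?_
  obtain ⟨q, hq1, hq2⟩ := EReal.lt_iff_exists_rat_btwn.1 hc
  have hq : ((q : ℝ) : EReal) < d := hq2
  have hq' : (q : ℝ) < d := EReal.coe_lt_coe_iff.1 hq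
  refine lt_of_lt_of_le hq1 ?_
  exact le_iSup₂ (f := fun (q : ℚ) (_ : ∃ δ > 0, Γ 0 ∈ slopeSet φ Ω j Ω q δ) =>
    ((q : ℝ) : EReal)) q (mem_slopeSet_of_hasDerivAt hδ hΓ hd hq')

theorem exists_rat_of_lt_upperSlope {A : HPlane n} {d : ℝ}
    (h : (d : EReal) < upperSlope φ Ω j A) :
    ∃ q : ℚ, d < q ∧ ∃ δ > 0, A ∈ slopeSet φ Ω j Ω q δ := by
  unfold upperSlope at h
  simp only [lt_iSup_iff] at h
  obtain ⟨q, hq, h⟩ := h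
  exact ⟨q, EReal.coe_lt_coe_iff.1 h, hq⟩

/-- The intrinsic derivative, where it exists and where there is a characteristic, is the upper
slope. -/
theorem HasGradDerivAt.upperSlope_eq {A : HPlane n} {α : ℝ} (h : HasGradDerivAt φ Ω j α A)
    (hex : ∃ δ > 0, ∃ Γ : ℝ → HPlane n, IsCharacteristic φ Ω j Γ (-δ) δ ∧ Γ 0 = A) :
    upperSlope φ Ω j A = α := by
  obtain ⟨δ, hδ, Γ, hΓ, h0⟩ := hex
  refine le_antisymm ?_ (h0 ▸ le_upperSlope hδ hΓ (h δ hδ Γ hΓ h0))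
  by_contra! hlt
  obtain ⟨q, hq, δ', hδ', Γ', hΓ', h0', -, h1, -⟩ := exists_rat_of_lt_upperSlope hlt
  obtain ⟨η, hη, h3, -⟩ := (h δ' hδ' Γ' hΓ' h0').neg.eventually_slope (neg_lt_neg hq)
  have hm : 0 < min δ' η := lt_min hδ' hη
  have h4 := h1 (min δ' η / 2) ⟨by positivity, by linarith [min_le_left δ' η]⟩
  have h5 := h3 (min δ' η / 2) ⟨by positivity, by linarith [min_le_right δ' η]⟩
  simp only [Pi.neg_apply, h0', sub_zero] at h5
  linarith

end Slope

section Countability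

variable {n : ℕ} {φ : HPlane n → ℝ} {Ω : Set (HPlane n)} {j : Fin (2 * n - 1)}

/-- A set of reals whose points are uniformly separated is countable. -/
theorem Set.countable_of_separated {S : Set ℝ} {δ : ℝ} (hδ : 0 < δ)
    (h : ∀ s ∈ S, ∀ s' ∈ S, s < s' → δ ≤ s' - s) : S.Countable := by
  refine Set.countable_of_injective_of_countable_image (f := fun s : ℝ => ⌊s / δ⌋) ?_
    (Set.to_countable _)
  have key : ∀ s ∈ S, ∀ s' ∈ S, s < s' → ⌊s / δ⌋ ≠ ⌊s' / δ⌋ := by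
    intro s hs s' hs' hlt heq
    have h1 := h s hs s' hs' hlt
    have h2 := Int.abs_sub_lt_one_of_floor_eq_floor heq
    rw [← sub_div, abs_lt, lt_div_iff₀ hδ] at h2
    linarith [h2.1]
  intro s hs s' hs' heq
  rcases lt_trichotomy s s' with h1 | h1 | h1
  · exact absurd heq (key s hs s' hs' h1)
  · exact h1
  · exact absurd heq.symm (key s' hs' s hs h1)

/-- `Γ'` is a characteristic crossing `Γ` at time `s`, along which `φ` grows strictly faster
than along `Γ`, within the time `δ`. -/
def CrossesFaster (φ : HPlane n → ℝ) (Ω : Set (HPlane n)) (j : Fin (2 * n - 1))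
    (Γ Γ' : ℝ → HPlane n) (δ s : ℝ) : Prop :=
  IsCharacteristic φ Ω j Γ' (s - δ) (s + δ) ∧ Γ' s = Γ s ∧
    (∀ r ∈ Ioo s (s + δ), φ (Γ r) < φ (Γ' r)) ∧ ∀ r ∈ Ioo (s - δ) s, φ (Γ' r) < φ (Γ r)

theorem CrossesFaster.ordered {Γ Γ' : ℝ → HPlane n} {a b δ s : ℝ} (hj : j.val + 1 = n)
    (hΓ : IsCharacteristic φ Ω j Γ a b) (h : CrossesFaster φ Ω j Γ Γ' δ s)
    (hs : s ∈ Ioo a b) :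
    (∀ r ∈ Ioo s (s + δ) ∩ Ioo a b, (Γ r).2 < (Γ' r).2) ∧
      ∀ r ∈ Ioo (s - δ) s ∩ Ioo a b, (Γ r).2 < (Γ' r).2 := by
  obtain ⟨hΓ', hs', h1, h2⟩ := h
  have hd : ∀ x ∈ Ioo (s - δ) (s + δ) ∩ Ioo a b,
      HasDerivAt (fun x => (Γ' x).2 - (Γ x).2) (φ (Γ' x) - φ (Γ x)) x := by
    intro x hx
    have := (hΓ'.hasDerivAt_snd hx.1).sub (hΓ.hasDerivAt_snd hx.2)
    rwa [vertComponent_of_eq hj, vertComponent_of_eq hj] at this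
  have hcont : ContinuousOn (fun x => (Γ' x).2 - (Γ x).2) (Ioo (s - δ) (s + δ) ∩ Ioo a b) :=
    fun x hx => (hd x hx).continuousAt.continuousWithinAt
  constructor
  · rintro r ⟨hr, hr'⟩
    have hsub : Icc s r ⊆ Ioo (s - δ) (s + δ) ∩ Ioo a b := fun x hx =>
      ⟨⟨by linarith [hx.1, hr.1, hr.2], by linarith [hx.2, hr.2]⟩,
        by linarith [hx.1, hs.1], by linarith [hx.2, hr'.2]⟩
    have := strictMonoOn_of_deriv_pos (convex_Icc s r) (hcont.mono hsub) (fun x hx => by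
      rw [interior_Icc] at hx
      rw [(hd x (hsub (Ioo_subset_Icc_self hx))).deriv]
      linarith [h1 x ⟨hx.1, hx.2.trans hr.2⟩]) (left_mem_Icc.2 hr.1.le)
      (right_mem_Icc.2 hr.1.le) hr.1
    simp only [hs', sub_self] at this
    linarith
  · rintro r ⟨hr, hr'⟩
    have hsub : Icc r s ⊆ Ioo (s - δ) (s + δ) ∩ Ioo a b := fun x hx =>
      ⟨⟨by linarith [hx.1, hr.1, hr.2], by linarith [hx.2, hr.1, hr.2]⟩,
        by linarith [hx.1, hr'.1], by linarith [hx.2, hs.2]⟩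
    have := strictAntiOn_of_deriv_neg (convex_Icc r s) (hcont.mono hsub) (fun x hx => by
      rw [interior_Icc] at hx
      rw [(hd x (hsub (Ioo_subset_Icc_self hx))).deriv]
      linarith [h2 x ⟨hr.1.trans hx.1, hx.2⟩]) (left_mem_Icc.2 hr.2.le)
      (right_mem_Icc.2 hr.2.le) hr.2
    simp only [hs', sub_self] at this
    linarith

/-- Two faster crossings cannot occur within a short time: the two crossing characteristics
would meet in between, at a point where `φ` would take two values. -/
theorem CrossesFaster.separated {Γ Γ₁ Γ₂ : ℝ → HPlane n} {a b δ s₁ s₂ : ℝ} (hj : j.val + 1 = n)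
    (hΓ : IsCharacteristic φ Ω j Γ a b) (h₁ : CrossesFaster φ Ω j Γ Γ₁ δ s₁)
    (h₂ : CrossesFaster φ Ω j Γ Γ₂ δ s₂) (hs₁ : s₁ ∈ Ioo a b) (hs₂ : s₂ ∈ Ioo a b)
    (hlt : s₁ < s₂) : δ ≤ s₂ - s₁ := by
  by_contra! hδ
  have ho₁ := (h₁.ordered hj hΓ hs₁).1
  have ho₂ := (h₂.ordered hj hΓ hs₂).2
  obtain ⟨hΓ₁, he₁, hf₁, -⟩ := h₁
  obtain ⟨hΓ₂, he₂, -, hf₂⟩ := h₂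
  have hsub₁ : Icc s₁ s₂ ⊆ Ioo (s₁ - δ) (s₁ + δ) := fun x hx =>
    ⟨by linarith [hx.1, hx.2], by linarith [hx.2]⟩
  have hsub₂ : Icc s₁ s₂ ⊆ Ioo (s₂ - δ) (s₂ + δ) := fun x hx =>
    ⟨by linarith [hx.1, hx.2], by linarith [hx.2]⟩
  have hsub : Icc s₁ s₂ ⊆ Ioo a b := fun x hx =>
    ⟨by linarith [hx.1, hs₁.1], by linarith [hx.2, hs₂.2]⟩
  have hl := left_mem_Icc.2 hlt.le
  have hr := right_mem_Icc.2 hlt.le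
  have hcont : ContinuousOn (fun x => (Γ₁ x).2 - (Γ₂ x).2) (Icc s₁ s₂) :=
    (continuous_snd.comp_continuousOn (hΓ₁.continuousOn.mono hsub₁)).sub
      (continuous_snd.comp_continuousOn (hΓ₂.continuousOn.mono hsub₂))
  have hneg : (Γ₁ s₁).2 - (Γ₂ s₁).2 < 0 := by
    have := ho₂ s₁ ⟨⟨(hsub₂ hl).1, hlt⟩, hs₁⟩
    rw [he₁]; linarith
  have hpos : 0 < (Γ₁ s₂).2 - (Γ₂ s₂).2 := by
    have := ho₁ s₂ ⟨⟨hlt, (hsub₁ hr).2⟩, hs₂⟩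
    rw [he₂]; linarith
  obtain ⟨r, hr', hr0⟩ := intermediate_value_Ioo hlt.le hcont ⟨hneg, hpos⟩
  have hrI := Ioo_subset_Icc_self hr'
  have heq : Γ₁ r = Γ₂ r := by
    refine Prod.ext ?_ (sub_eq_zero.1 hr0)
    rw [hΓ₁.fst_eq (hsub₁ hl) (hsub₁ hrI), hΓ₂.fst_eq (hsub₂ hr) (hsub₂ hrI), he₁, he₂,
      ← hΓ.fst_eq (hsub hl) (hsub hrI), ← hΓ.fst_eq (hsub hr) (hsub hrI)]
  have h1 := hf₁ r ⟨hr'.1, (hsub₁ hrI).2⟩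
  have h2 := hf₂ r ⟨(hsub₂ hrI).1, hr'.2⟩
  rw [heq] at h1
  linarith

theorem countable_crossesFaster {Γ : ℝ → HPlane n} {a b : ℝ}
    (hΓ : IsCharacteristic φ Ω j Γ a b) :
    {s ∈ Ioo a b | ∃ δ > 0, ∃ Γ', CrossesFaster φ Ω j Γ Γ' δ s}.Countable := by
  by_cases hj : j.val + 1 = n
  · have : {s ∈ Ioo a b | ∃ δ > 0, ∃ Γ', CrossesFaster φ Ω j Γ Γ' δ s} ⊆
        ⋃ k : ℕ, {s ∈ Ioo a b | ∃ Γ', CrossesFaster φ Ω j Γ Γ' (1 / ((k : ℝ) + 1)) s} := by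
      rintro s ⟨hs, δ, hδ, Γ', hΓ', he, h1, h2⟩
      obtain ⟨k, hk⟩ := exists_nat_one_div_lt hδ
      exact mem_iUnion.2 ⟨k, hs, Γ', hΓ'.mono (by linarith) (by linarith), he,
        fun r hr => h1 r ⟨hr.1, by linarith [hr.2]⟩, fun r hr => h2 r ⟨by linarith [hr.1], hr.2⟩⟩
    refine (countable_iUnion fun k => ?_).mono this
    refine Set.countable_of_separated (δ := 1 / ((k : ℝ) + 1)) (by positivity) ?_
    rintro s₁ ⟨hs₁, Γ₁, h₁⟩ s₂ ⟨hs₂, Γ₂, h₂⟩ hlt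
    exact h₁.separated hj hΓ h₂ hs₁ hs₂ hlt
  · convert Set.countable_empty
    rw [Set.eq_empty_iff_forall_notMem]
    rintro s ⟨hs, δ, hδ, Γ', hΓ', he, h1, -⟩
    set r := min (s + δ) b with hr
    have hsr : s < r := lt_min (by linarith) hs.2
    have hle1 : r ≤ s + δ := min_le_left _ _
    have hle2 : r ≤ b := min_le_right _ _
    have h3 := (hΓ.mono (a' := max a (s - δ)) (b' := r) (le_max_left _ _) hle2).eqOn_of_ne hj
      (hΓ'.mono (a' := max a (s - δ)) (b' := r) (le_max_right _ _) hle1) (s := s)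
      ⟨max_lt hs.1 (by linarith), hsr⟩ he.symm (x := (s + r) / 2)
      ⟨(max_lt hs.1 (by linarith)).trans (by linarith), by linarith⟩
    have h4 := h1 ((s + r) / 2) ⟨by linarith, by linarith⟩
    rw [h3] at h4
    exact lt_irrefl _ h4

/-- Along a characteristic, the derivative of `φ` is the upper slope at all but countably many of
the times at which it exists. -/
theorem countable_hasDerivAt_ne_upperSlope {Γ : ℝ → HPlane n} {a b : ℝ}
    (hΓ : IsCharacteristic φ Ω j Γ a b) :
    {s ∈ Ioo a b | ∃ d : ℝ, HasDerivAt (fun r => φ (Γ r)) d s ∧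
      upperSlope φ Ω j (Γ s) ≠ d}.Countable := by
  refine (countable_crossesFaster hΓ).mono ?_
  rintro s ⟨hs, d, hd, hne⟩
  refine ⟨hs, ?_⟩
  obtain ⟨ρ, hρ, hsub⟩ := Metric.isOpen_iff.1 isOpen_Ioo s hs
  rw [Real.ball_eq_Ioo] at hsub
  have hΓs : IsCharacteristic φ Ω j (fun r => Γ (r + s)) (-ρ) ρ := by
    intro r hr
    have h := hΓ (r + s) (hsub ⟨by linarith [hr.1], by linarith [hr.2]⟩)
    exact ⟨h.1, h.2.comp_add_const r s⟩
  have hds : HasDerivAt (fun r => φ (Γ (r + s))) d 0 := by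
    have : HasDerivAt (fun r => φ (Γ r)) d (0 + s) := by rwa [zero_add]
    exact this.comp_add_const 0 s
  have hle := le_upperSlope hρ hΓs hds
  simp only [zero_add] at hle
  obtain ⟨q, hq, δ, hδ, Γ', hΓ', h0, -, h1, h2⟩ :=
    exists_rat_of_lt_upperSlope (lt_of_le_of_ne hle hne.symm)
  obtain ⟨η, hη, h3, h4⟩ := hd.neg.eventually_slope (neg_lt_neg hq)
  simp only [Pi.neg_apply] at h3 h4
  have hle1 := min_le_left δ η
  have hle2 := min_le_right δ η
  refine ⟨min δ η, lt_min hδ hη, fun r => Γ' (r - s), fun r hr => ?_, by simpa using h0,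
    fun r hr => ?_, fun r hr => ?_⟩
  · have h := hΓ' (r - s) ⟨by linarith [hr.1], by linarith [hr.2]⟩
    exact ⟨h.1, h.2.comp_sub_const r s⟩
  · have h5 := h1 (r - s) ⟨by linarith [hr.1], by linarith [hr.2]⟩
    have h6 := h3 r ⟨hr.1, by linarith [hr.2]⟩
    linarith
  · have h5 := h2 (r - s) ⟨by linarith [hr.1], by linarith [hr.2]⟩
    have h6 := h4 r ⟨by linarith [hr.1], hr.2⟩
    linarith

/-- The upper slope as a real number, truncated at height `L`. -/
noncomputable def truncatedSlope (φ : HPlane n → ℝ) (Ω : Set (HPlane n)) (j : Fin (2 * n - 1))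
    (L : ℝ) (A : HPlane n) : ℝ :=
  max (-L) (min L (upperSlope φ Ω j A).toReal)

theorem measurable_truncatedSlope (hΩ : IsOpen Ω) (hφ : ContinuousOn φ Ω) (L : ℝ) :
    Measurable (truncatedSlope φ Ω j L) :=
  measurable_const.max (measurable_const.min (measurable_upperSlope hΩ hφ).ereal_toReal)

theorem abs_truncatedSlope_le {L : ℝ} (hL : 0 ≤ L) (A : HPlane n) :
    |truncatedSlope φ Ω j L A| ≤ L :=
  abs_le.2 ⟨le_max_left _ _, max_le (by linarith) (min_le_left _ _)⟩

theorem truncatedSlope_eq {L d : ℝ} {A : HPlane n} (hd : |d| ≤ L)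
    (h : upperSlope φ Ω j A = d) : truncatedSlope φ Ω j L A = d := by
  rw [abs_le] at hd
  rw [truncatedSlope, h, EReal.toReal_coe, min_eq_right hd.2, max_eq_right hd.1]

theorem abs_le_of_hasDerivAt_of_lipschitzOnWith {f : ℝ → ℝ} {L : ℝ≥0} {a b d s : ℝ}
    (hf : LipschitzOnWith L f (Ioo a b)) (hs : s ∈ Ioo a b) (hd : HasDerivAt f d s) :
    |d| ≤ L := by
  have h := norm_deriv_le_of_lipschitzOn (isOpen_Ioo.mem_nhds hs) hf
  rwa [hd.deriv] at h

/-- The truncated upper slope is the derivative of `φ` along every characteristic, at all but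
countably many of the points where that derivative exists. -/
theorem truncatedSlope_spec {L : ℝ≥0} {Γ : ℝ → HPlane n} {a b : ℝ}
    (hΓ : IsCharacteristic φ Ω j Γ a b)
    (hL : LipschitzOnWith L (fun s => φ (Γ s)) (Ioo a b)) :
    (∀ᵐ s ∂(volume.restrict (Ioo a b)),
      HasDerivAt (fun r => φ (Γ r)) (truncatedSlope φ Ω j L (Γ s)) s) ∧
    {s ∈ Ioo a b | ∃ d : ℝ, HasDerivAt (fun r => φ (Γ r)) d s ∧
      d ≠ truncatedSlope φ Ω j L (Γ s)}.Countable := by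
  have hc : {s ∈ Ioo a b | ∃ d : ℝ, HasDerivAt (fun r => φ (Γ r)) d s ∧
      d ≠ truncatedSlope φ Ω j L (Γ s)}.Countable := by
    refine (countable_hasDerivAt_ne_upperSlope hΓ).mono ?_
    rintro s ⟨hs, d, hd, hne⟩
    exact ⟨hs, d, hd, fun h => hne (truncatedSlope_eq
      (abs_le_of_hasDerivAt_of_lipschitzOnWith hL hs hd) h).symm⟩
  refine ⟨?_, hc⟩
  rw [ae_restrict_iff' measurableSet_Ioo]
  have h1 := hc.ae_notMem (volume : Measure ℝ)
  filter_upwards [h1, hL.ae_differentiableWithinAt_of_mem (μ := volume)] with s hs1 hs2 hs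
  have hd := ((hs2 hs).differentiableAt (isOpen_Ioo.mem_nhds hs)).hasDerivAt
  by_contra hcon
  exact hs1 ⟨hs, _, hd, fun he => hcon (he ▸ hd)⟩

end Countability

/-! ### Peano's existence theorem -/

section Peano

/-- Average of `v s` over `[t, t + h]`. -/
noncomputable def forwardAverage (v : ℝ → ℝ → ℝ) (h s t : ℝ) : ℝ :=
  ∫ τ in (0 : ℝ)..1, v s (t + h * τ)

variable {v : ℝ → ℝ → ℝ} {M : ℝ}

theorem intervalIntegrable_average (hv : Continuous (Function.uncurry v)) (h s t : ℝ) :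
    IntervalIntegrable (fun τ => v s (t + h * τ)) volume 0 1 :=
  Continuous.intervalIntegrable (hv.comp₂ continuous_const (by fun_prop)) _ _

theorem continuous_forwardAverage (hv : Continuous (Function.uncurry v)) (h : ℝ) :
    Continuous (Function.uncurry (forwardAverage v h)) := by
  refine intervalIntegral.continuous_parametric_intervalIntegral_of_continuous'
    (f := fun (p : ℝ × ℝ) τ => v p.1 (p.2 + h * τ)) ?_ 0 1
  exact Continuous.comp₂ (g := Function.uncurry v) hv
    (e := fun q : (ℝ × ℝ) × ℝ => q.1.1) (f := fun q => q.1.2 + h * q.2)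
    (by fun_prop) (by fun_prop)

theorem abs_forwardAverage_le (hM : ∀ s t, |v s t| ≤ M) (h s t : ℝ) :
    |forwardAverage v h s t| ≤ M := by
  have := intervalIntegral.norm_integral_le_of_norm_le_const (a := (0 : ℝ)) (b := 1) (C := M)
    (f := fun τ => v s (t + h * τ)) (fun x _ => hM _ _)
  simpa [forwardAverage] using this

theorem abs_forwardAverage_sub_le (hv : Continuous (Function.uncurry v)) {ε h s t s' t' : ℝ}
    (hε : ∀ τ ∈ Icc (0 : ℝ) 1, |v s (t + h * τ) - v s' (t' + h * τ)| ≤ ε) :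
    |forwardAverage v h s t - forwardAverage v h s' t'| ≤ ε := by
  rw [forwardAverage, forwardAverage, ← intervalIntegral.integral_sub
    (intervalIntegrable_average hv h s t) (intervalIntegrable_average hv h s' t')]
  have := intervalIntegral.norm_integral_le_of_norm_le_const (a := (0 : ℝ)) (b := 1) (C := ε)
    (f := fun τ => v s (t + h * τ) - v s' (t' + h * τ)) (fun x hx => by
      rw [uIoc_of_le zero_le_one] at hx
      exact hε x ⟨hx.1.le, hx.2⟩)
  simpa using this

theorem abs_forwardAverage_sub_self_le (hv : Continuous (Function.uncurry v)) {ε h s t : ℝ}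
    (hε : ∀ τ ∈ Icc (0 : ℝ) 1, |v s (t + h * τ) - v s t| ≤ ε) :
    |forwardAverage v h s t - v s t| ≤ ε := by
  have : v s t = ∫ τ in (0 : ℝ)..1, v s t := by simp
  rw [forwardAverage, this, ← intervalIntegral.integral_sub
    (intervalIntegrable_average hv h s t) (by simp)]
  have := intervalIntegral.norm_integral_le_of_norm_le_const (a := (0 : ℝ)) (b := 1) (C := ε)
    (f := fun τ => v s (t + h * τ) - v s t) (fun x hx => by
      rw [uIoc_of_le zero_le_one] at hx
      exact hε x ⟨hx.1.le, hx.2⟩)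
  simpa using this

theorem abs_forwardAverage_sub_le_mul (hv : Continuous (Function.uncurry v))
    (hM : ∀ s t, |v s t| ≤ M) {h : ℝ} (hh : 0 < h) (s t t' : ℝ) :
    |forwardAverage v h s t - forwardAverage v h s t'| ≤ 2 * M / h * |t - t'| := by
  have hi : ∀ a b, IntervalIntegrable (v s) volume a b := fun a b =>
    Continuous.intervalIntegrable (hv.comp₂ continuous_const continuous_id) _ _
  have hb : ∀ a b, |∫ x in a..b, v s x| ≤ M * |b - a| := fun a b =>
    intervalIntegral.norm_integral_le_of_norm_le_const (f := v s) fun x _ => hM s x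
  rw [forwardAverage, forwardAverage, intervalIntegral.integral_comp_add_mul _ hh.ne',
    intervalIntegral.integral_comp_add_mul _ hh.ne', ← smul_sub,
    intervalIntegral.integral_interval_sub_interval_comm (hi _ _) (hi _ _) (hi _ _),
    smul_eq_mul, abs_mul, abs_of_pos (inv_pos.2 hh)]
  have h1 := hb (t + h * 0) (t' + h * 0)
  have h2 := hb (t + h * 1) (t' + h * 1)
  have e1 : t' + h * 0 - (t + h * 0) = -(t - t') := by ring
  have e2 : t' + h * 1 - (t + h * 1) = -(t - t') := by ring
  rw [e1, abs_neg] at h1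
  rw [e2, abs_neg] at h2
  have h3 := abs_sub (∫ x in t + h * 0..t' + h * 0, v s x) (∫ x in t + h * 1..t' + h * 1, v s x)
  calc h⁻¹ * _ ≤ h⁻¹ * (M * |t - t'| + M * |t - t'|) := by gcongr; linarith
    _ = _ := by field_simp; ring

/-- The regularized equation is solvable by the Picard-Lindelöf theorem. -/
theorem exists_solution_forwardAverage (hv : Continuous (Function.uncurry v))
    (hM0 : 0 ≤ M) (hM : ∀ s t, |v s t| ≤ M) {h r : ℝ} (hh : 0 < h) (hr : 0 < r) (t₀ : ℝ) :
    ∃ γ : ℝ → ℝ, γ 0 = t₀ ∧ ∀ s ∈ Ioo (-r) r, HasDerivAt γ (forwardAverage v h s (γ s)) s := by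
  have h0 : (0 : ℝ) ∈ Icc (-r) r := ⟨by linarith, hr.le⟩
  have hP : IsPicardLindelof (forwardAverage v h) (tmin := -r) (tmax := r) ⟨0, h0⟩ t₀
      ⟨M * r, by positivity⟩ 0 ⟨M, hM0⟩ ⟨2 * M / h, by positivity⟩ := by
    refine ⟨fun s _ => ?_, fun x _ => ?_, fun s _ x _ => ?_, ?_⟩
    · refine LipschitzOnWith.of_dist_le_mul fun t _ t' _ => ?_
      exact abs_forwardAverage_sub_le_mul hv hM hh s t t'
    · exact ((continuous_forwardAverage hv h).comp₂ continuous_id continuous_const).continuousOn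
    · exact abs_forwardAverage_le hM h s x
    · simp only [sub_zero, zero_sub, neg_neg, max_self, NNReal.coe_zero]
      exact le_rfl
  obtain ⟨γ, hγ0, hγ⟩ := hP.exists_eq_forall_mem_Icc_hasDerivWithinAt
    (x := t₀) (by simp)
  exact ⟨γ, hγ0, fun s hs => (hγ s (Ioo_subset_Icc_self hs)).hasDerivAt
    (Icc_mem_nhds hs.1 hs.2)⟩

/-- **Peano's theorem** for a bounded, uniformly continuous right-hand side. -/
theorem exists_solution_of_uniformContinuous (hv : UniformContinuous (Function.uncurry v))
    (hM0 : 0 ≤ M) (hM : ∀ s t, |v s t| ≤ M) {r : ℝ} (hr : 0 < r) (t₀ : ℝ) :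
    ∃ γ : ℝ → ℝ, γ 0 = t₀ ∧ ∀ s ∈ Ioo (-r) r, HasDerivAt γ (v s (γ s)) s := by
  have hvc := hv.continuous
  have hmod : ∀ ε > 0, ∃ η > 0, ∀ s t s' t', |s - s'| < η → |t - t'| < η →
      |v s t - v s' t'| ≤ ε := by
    intro ε hε
    obtain ⟨η, hη, h⟩ := Metric.uniformContinuous_iff.1 hv ε hε
    refine ⟨η, hη, fun s t s' t' h1 h2 => ?_⟩
    exact (h (a := (s, t)) (b := (s', t')) (max_lt h1 h2)).le
  choose γ hγ0 hγ using fun k : ℕ =>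
    exists_solution_forwardAverage hvc hM0 hM (h := 1 / ((k : ℝ) + 1)) (by positivity) hr t₀
  have h0 : (0 : ℝ) ∈ Ioo (-r) r := ⟨by linarith, hr⟩
  have hlip : ∀ k : ℕ, ∀ s ∈ Ioo (-r) r, ∀ s' ∈ Ioo (-r) r, |γ k s - γ k s'| ≤ M * |s - s'| := by
    intro k s hs s' hs'
    exact (convex_Ioo (-r) r).norm_image_sub_le_of_norm_hasDerivWithin_le
      (fun x hx => (hγ k x hx).hasDerivWithinAt) (C := M)
      (fun x _ => abs_forwardAverage_le hM _ _ _) hs' hs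
  let u : Ultrafilter ℕ := hyperfilter ℕ
  have hu : (u : Filter ℕ) ≤ atTop := Nat.hyperfilter_le_atTop
  have hlim : ∀ s, ∃ x, s ∈ Ioo (-r) r → Tendsto (fun k => γ k s) u (𝓝 x) := by
    intro s
    by_cases hs : s ∈ Ioo (-r) r
    · obtain ⟨x, -, hx⟩ := (isCompact_closedBall t₀ (M * |s|)).ultrafilter_le_nhds
        (u.map fun k => γ k s) (by
          rw [le_principal_iff]
          change ∀ᶠ k : ℕ in (u : Filter ℕ), γ k s ∈ Metric.closedBall t₀ (M * |s|)
          refine Eventually.of_forall fun k => ?_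
          have := hlip k s hs 0 h0
          rw [hγ0, sub_zero] at this
          exact this)
      exact ⟨x, fun _ => hx⟩
    · exact ⟨0, fun h => absurd h hs⟩
  choose G hG using hlim
  refine ⟨G, ?_, fun s hs => ?_⟩
  · refine tendsto_nhds_unique (hG 0 h0) ?_
    simp only [hγ0, tendsto_const_nhds]
  · refine hasDerivAt_of_tendsto_of_equicontinuous (l := (u : Filter ℕ)) (γ := γ)
      (y := fun k x => forwardAverage v (1 / ((k : ℝ) + 1)) x (γ k x))
      (y₀ := fun x => v x (G x)) hs (Eventually.of_forall hγ) ?_ hG ?_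
    · intro ε hε
      obtain ⟨η, hη, h⟩ := hmod ε hε
      have hM1 : 0 < M + 1 := by positivity
      refine ⟨η / (M + 1), by positivity, Eventually.of_forall fun k x hx x' hx' hxx => ?_⟩
      rw [lt_div_iff₀ hM1] at hxx
      have hnn := abs_nonneg (x - x')
      have hl := hlip k x hx x' hx'
      refine abs_forwardAverage_sub_le hvc fun τ _ => h _ _ _ _ (by nlinarith) ?_
      rw [add_sub_add_right_eq_sub]
      nlinarith
    · have h1 : Tendsto (fun k => v s (γ k s)) u (𝓝 (v s (G s))) :=
        ((hvc.comp₂ continuous_const continuous_id).tendsto (G s)).comp (hG s hs)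
      have h2 : Tendsto (fun k : ℕ => forwardAverage v (1 / ((k : ℝ) + 1)) s (γ k s) -
          v s (γ k s)) u (𝓝 0) := by
        rw [Metric.tendsto_nhds]
        intro ε hε
        obtain ⟨η, hη, h⟩ := hmod (ε / 2) (by positivity)
        have h3 : ∀ᶠ k : ℕ in (u : Filter ℕ), 1 / ((k : ℝ) + 1) < η :=
          hu (tendsto_one_div_add_atTop_nhds_zero_nat.eventually (gt_mem_nhds hη))
        filter_upwards [h3] with k hk
        rw [dist_zero_right]
        refine lt_of_le_of_lt (abs_forwardAverage_sub_self_le hvc fun τ hτ => h _ _ _ _ ?_ ?_)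
          (half_lt_self hε)
        · simpa using hη
        · have hk0 : (0 : ℝ) < 1 / ((k : ℝ) + 1) := by positivity
          rw [add_sub_cancel_left, abs_of_nonneg (mul_nonneg hk0.le hτ.1)]
          nlinarith [hτ.2]
      simpa using h2.add h1

variable {n : ℕ} {φ : HPlane n → ℝ} {Ω : Set (HPlane n)}

theorem norm_smul_single_le {n : ℕ} (j : Fin (2 * n - 1)) (s : ℝ) :
    ‖s • (Pi.single j 1 : Fin (2 * n - 1) → ℝ)‖ ≤ |s| := by
  rw [norm_smul, Real.norm_eq_abs, Pi.norm_single]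
  simp

/-- Characteristics through the points of a compact set exist on a common time interval. -/
theorem exists_isCharacteristic (hΩ : IsOpen Ω) (hφ : ContinuousOn φ Ω) {K : Set (HPlane n)}
    (hK : IsCompact K) (hKΩ : K ⊆ Ω) (j : Fin (2 * n - 1)) :
    ∃ δ > 0, ∀ A ∈ K, ∃ Γ : ℝ → HPlane n, IsCharacteristic φ Ω j Γ (-δ) δ ∧ Γ 0 = A := by
  obtain ⟨ρ, hρ, hsub⟩ := hK.exists_cthickening_subset_open hΩ hKΩ
  have hVc := continuousOn_vertComponent hφ j
  obtain ⟨M, hM⟩ := hK.cthickening (r := ρ) |>.exists_bound_of_continuousOn (hVc.mono hsub)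
  set N := max M 1 with hN
  have hN0 : 0 < N := by positivity
  refine ⟨min ρ (ρ / N), lt_min hρ (by positivity), fun A hA => ?_⟩
  set δ := min ρ (ρ / N) with hδ
  have hδ0 : 0 < δ := lt_min hρ (by positivity)
  have hball : Metric.closedBall A ρ ⊆ Metric.cthickening ρ K :=
    Metric.closedBall_subset_cthickening hA ρ
  have hc1 : -δ ≤ δ := by linarith
  have hc2 : A.2 - ρ ≤ A.2 + ρ := by linarith
  let P : ℝ → ℝ → HPlane n := fun s t =>
    (A.1 + (projIcc (-δ) δ hc1 s : ℝ) • Pi.single j 1, projIcc (A.2 - ρ) (A.2 + ρ) hc2 t)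
  have hP : ∀ s t, P s t ∈ Metric.closedBall A ρ := by
    intro s t
    rw [Metric.mem_closedBall, dist_eq_norm]
    have h1 := (projIcc (-δ) δ hc1 s).2
    have h2 := (projIcc (A.2 - ρ) (A.2 + ρ) hc2 t).2
    refine max_le ?_ ?_
    · simp only [P, Prod.fst_sub, add_sub_cancel_left]
      refine (norm_smul_single_le j _).trans ?_
      exact (abs_le.2 h1).trans (min_le_left _ _)
    · simp only [P, Prod.snd_sub, Real.norm_eq_abs]
      exact abs_le.2 ⟨by linarith [h2.1], by linarith [h2.2]⟩
  let v : ℝ → ℝ → ℝ := fun s t => vertComponent φ j (P s t)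
  have hPu : UniformContinuous (Function.uncurry P) := by
    have h1 : UniformContinuous fun p : ℝ × ℝ => ((projIcc (-δ) δ hc1 p.1 : Icc (-δ) δ) : ℝ) :=
      uniformContinuous_subtype_val.comp
        ((LipschitzWith.projIcc hc1).uniformContinuous.comp uniformContinuous_fst)
    have h2 : UniformContinuous fun p : ℝ × ℝ =>
        ((projIcc (A.2 - ρ) (A.2 + ρ) hc2 p.2 : Icc (A.2 - ρ) (A.2 + ρ)) : ℝ) :=
      uniformContinuous_subtype_val.comp
        ((LipschitzWith.projIcc hc2).uniformContinuous.comp uniformContinuous_snd)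
    have h3 : UniformContinuous fun s : ℝ => s • (Pi.single j 1 : Fin (2 * n - 1) → ℝ) :=
      (ContinuousLinearMap.toSpanSingleton ℝ
        (Pi.single j 1 : Fin (2 * n - 1) → ℝ)).uniformContinuous
    exact (uniformContinuous_const.add (h3.comp h1)).prodMk h2
  have hv : UniformContinuous (Function.uncurry v) := by
    have h1 := (hK.cthickening (r := ρ)).uniformContinuousOn_of_continuous (hVc.mono hsub)
    rw [Metric.uniformContinuousOn_iff] at h1
    rw [Metric.uniformContinuous_iff] at hPu ⊢
    intro ε hε
    obtain ⟨η, hη, h1⟩ := h1 ε hε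
    obtain ⟨η', hη', h2⟩ := hPu η hη
    exact ⟨η', hη', fun p q hpq => h1 _ (hball (hP p.1 p.2)) _ (hball (hP q.1 q.2)) (h2 hpq)⟩
  have hvM : ∀ s t, |v s t| ≤ N := fun s t => (hM _ (hball (hP s t))).trans (le_max_left _ _)
  obtain ⟨γ, hγ0, hγ⟩ := exists_solution_of_uniformContinuous hv hN0.le hvM hδ0 A.2
  have hγρ : ∀ s ∈ Ioo (-δ) δ, γ s ∈ Icc (A.2 - ρ) (A.2 + ρ) := by
    intro s hs
    have h := (convex_Ioo (-δ) δ).norm_image_sub_le_of_norm_hasDerivWithin_le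
      (fun x hx => (hγ x hx).hasDerivWithinAt) (C := N) (fun x _ => hvM _ _)
      (show (0 : ℝ) ∈ Ioo (-δ) δ from ⟨by linarith, hδ0⟩) hs
    rw [hγ0, sub_zero, Real.norm_eq_abs, Real.norm_eq_abs] at h
    have h2 : |s| ≤ ρ / N := (abs_lt.2 hs).le.trans (min_le_right _ _)
    rw [le_div_iff₀ hN0] at h2
    have h3 := abs_le.1 (h.trans (by linarith : N * |s| ≤ ρ))
    exact ⟨by linarith [h3.1], by linarith [h3.2]⟩
  have hPγ : ∀ s ∈ Ioo (-δ) δ, P s (γ s) = (A.1 + s • Pi.single j 1, γ s) := by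
    intro s hs
    simp only [P]
    rw [projIcc_of_mem hc1 (Ioo_subset_Icc_self hs), projIcc_of_mem hc2 (hγρ s hs)]
  refine ⟨fun s => (A.1 + s • Pi.single j 1, γ s), fun s hs => ⟨?_, ?_⟩, by simp [hγ0]⟩
  · change (A.1 + s • Pi.single j 1, γ s) ∈ Ω
    rw [← hPγ s hs]
    exact hsub (hball (hP _ _))
  · have h1 := hγ s hs
    simp only [v, hPγ s hs] at h1
    have h2 : HasDerivAt (fun s : ℝ => A.1 + s • (Pi.single j 1 : Fin (2 * n - 1) → ℝ))
        (Pi.single j 1) s := by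
      have := ((hasDerivAt_id s).smul_const (Pi.single j 1 : Fin (2 * n - 1) → ℝ)).const_add A.1
      simpa only [one_smul, id] using this
    exact h2.prodMk h1

end Peano

/-! ### Balance of a convex conservation law along a characteristic strip -/

section Strip

/-- Integral of `w s` over `[t, t + η]`. -/
noncomputable def vertIntegral (w : ℝ → ℝ → ℝ) (η s t : ℝ) : ℝ :=
  ∫ τ in (0 : ℝ)..η, w s (t + τ)

variable {u F V w : ℝ → ℝ → ℝ} {L η : ℝ}

theorem vertIntegral_eq (w : ℝ → ℝ → ℝ) (η s t : ℝ) :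
    vertIntegral w η s t = ∫ x in t..t + η, w s x := by
  rw [vertIntegral, intervalIntegral.integral_comp_add_left, add_zero]

theorem intervalIntegrable_of_measurable_of_bound {f : ℝ → ℝ} (hf : Measurable f)
    (hL : ∀ x, |f x| ≤ L) (a b : ℝ) : IntervalIntegrable f volume a b :=
  (intervalIntegrable_const (c := L)).mono_fun hf.aestronglyMeasurable
    (Eventually.of_forall fun x => (hL x).trans (le_abs_self L))

theorem abs_vertIntegral_le (hL : ∀ s t, |w s t| ≤ L) (hη : 0 ≤ η) (s t : ℝ) :
    |vertIntegral w η s t| ≤ L * η := by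
  have := intervalIntegral.norm_integral_le_of_norm_le_const (a := (0 : ℝ)) (b := η) (C := L)
    (f := fun τ => w s (t + τ)) (fun x _ => hL _ _)
  rwa [sub_zero, abs_of_nonneg hη] at this

theorem abs_vertIntegral_sub_le (hw : Measurable (Function.uncurry w))
    (hL : ∀ s t, |w s t| ≤ L) (η s t t' : ℝ) :
    |vertIntegral w η s t - vertIntegral w η s t'| ≤ 2 * L * |t - t'| := by
  have hws : Measurable (w s) := hw.comp measurable_prodMk_left
  have hi := fun a b => intervalIntegrable_of_measurable_of_bound hws (hL s) a b
  have hb : ∀ a b, |∫ x in a..b, w s x| ≤ L * |b - a| := fun a b =>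
    intervalIntegral.norm_integral_le_of_norm_le_const (f := w s) fun x _ => hL s x
  rw [vertIntegral_eq, vertIntegral_eq,
    intervalIntegral.integral_interval_sub_interval_comm (hi _ _) (hi _ _) (hi _ _)]
  have h1 := hb t t'
  have h2 := hb (t + η) (t' + η)
  rw [add_sub_add_right_eq_sub] at h2
  rw [abs_sub_comm t t']
  have h3 := abs_sub (∫ x in t..t', w s x) (∫ x in t + η..t' + η, w s x)
  linarith

theorem measurable_vertIntegral (hw : Measurable (Function.uncurry w)) (hη : 0 ≤ η)
    {c : ℝ → ℝ} (hc : Measurable c) : Measurable fun s => vertIntegral w η s (c s) := by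
  simp only [vertIntegral, intervalIntegral.integral_of_le hη]
  have : Measurable fun p : ℝ × ℝ => w p.1 (c p.1 + p.2) :=
    hw.comp (measurable_fst.prodMk ((hc.comp measurable_fst).add measurable_snd))
  exact (this.stronglyMeasurable.integral_prod_right' (ν := volume.restrict (Ioc 0 η))).measurable

theorem intervalIntegrable_vertIntegral (hw : Measurable (Function.uncurry w))
    (hL : ∀ s t, |w s t| ≤ L) (hη : 0 ≤ η) {c : ℝ → ℝ} (hc : Measurable c) (a b : ℝ) :
    IntervalIntegrable (fun s => vertIntegral w η s (c s)) volume a b :=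
  intervalIntegrable_of_measurable_of_bound (measurable_vertIntegral hw hη hc)
    (fun s => abs_vertIntegral_le hL hη s (c s)) a b

theorem continuous_vertIntegral (hu : Continuous (Function.uncurry u)) (η : ℝ) :
    Continuous (Function.uncurry (vertIntegral u η)) := by
  refine intervalIntegral.continuous_parametric_intervalIntegral_of_continuous'
    (f := fun (p : ℝ × ℝ) τ => u p.1 (p.2 + τ)) ?_ 0 η
  exact Continuous.comp₂ (g := Function.uncurry u) hu (e := fun q : (ℝ × ℝ) × ℝ => q.1.1)
    (f := fun q => q.1.2 + q.2) (by fun_prop) (by fun_prop)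

theorem hasDerivAt_vertIntegral (hu : Continuous (Function.uncurry u)) (η s t : ℝ) :
    HasDerivAt (vertIntegral u η s) (u s (t + η) - u s t) t := by
  have hus : Continuous (u s) := hu.comp₂ continuous_const continuous_id
  have h1 : ∀ x, HasDerivAt (fun x => ∫ y in (0 : ℝ)..x, u s y) (u s x) x := fun x =>
    intervalIntegral.integral_hasDerivAt_right (hus.intervalIntegrable _ _)
      hus.aestronglyMeasurable.stronglyMeasurableAtFilter hus.continuousAt
  have h2 := ((h1 (t + η)).comp_add_const t η).sub (h1 t)
  refine h2.congr_of_eventuallyEq (Eventually.of_forall fun x => ?_)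
  simp only [Pi.sub_apply, vertIntegral_eq]
  rw [intervalIntegral.integral_interval_sub_left (hus.intervalIntegrable _ _)
    (hus.intervalIntegrable _ _)]

/-- `u` satisfies the one-sided balance `∂_s u + ∂_t F ≤ w`, integrated over the rectangles of
height `η` contained in `O`, from time `a` on. -/
def RectangleBalance (u F w : ℝ → ℝ → ℝ) (O : Set (ℝ × ℝ)) (η a : ℝ) : Prop :=
  ∀ s₁ s₂ t, a ≤ s₁ → s₁ ≤ s₂ → Icc s₁ s₂ ×ˢ Icc t (t + η) ⊆ O →
    vertIntegral u η s₂ t - vertIntegral u η s₁ t ≤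
      ∫ σ in s₁..s₂, (vertIntegral w η σ t - (F σ (t + η) - F σ t))

/-- Dafermos' computation: the flux through the sides of a strip lying above a characteristic has
a sign, since the flux function is convex. -/
theorem RectangleBalance.strip_le {O : Set (ℝ × ℝ)} {γ : ℝ → ℝ} {a b : ℝ}
    (hR : RectangleBalance u F w O η a) (hu : Continuous (Function.uncurry u))
    (hF : Continuous (Function.uncurry F))
    (hconv : ∀ s t t', V s t * (u s t' - u s t) ≤ F s t' - F s t)
    (hw : Measurable (Function.uncurry w)) (hL : ∀ s t, |w s t| ≤ L) (hL0 : 0 ≤ L)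
    (hO : IsOpen O) (hη : 0 ≤ η) (hab : a ≤ b) (hγc : Continuous γ)
    (hγ : ∀ s ∈ Ico a b, HasDerivWithinAt γ (V s (γ s)) (Ici s) s)
    (hstrip : ∀ s ∈ Icc a b, ∀ x ∈ Icc (γ s) (γ s + η), (s, x) ∈ O) :
    vertIntegral u η b (γ b) - vertIntegral u η a (γ a) ≤
      ∫ s in a..b, vertIntegral w η s (γ s) := by
  have hgi : ∀ c : ℝ → ℝ, Measurable c → ∀ x y,
      IntervalIntegrable (fun s => vertIntegral w η s (c s)) volume x y := fun c hc x y =>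
    intervalIntegrable_vertIntegral hw hL hη hc x y
  have hUc := continuous_vertIntegral hu η
  set f : ℝ → ℝ := fun s => vertIntegral u η s (γ s) - ∫ σ in a..s, vertIntegral w η σ (γ σ)
    with hf
  have hfc : ContinuousOn f (Icc a b) :=
    ((hUc.comp₂ continuous_id hγc).sub (intervalIntegral.continuous_primitive
      (fun x y => hgi γ hγc.measurable x y) a)).continuousOn
  have key : ∀ x ∈ Ico a b, ∀ r, (0 : ℝ) < r → ∃ᶠ z in 𝓝[>] x, slope f x z < r := by
    intro x hx r hr
    refine Eventually.frequently ?_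
    have hcomp : HasDerivWithinAt (fun z => vertIntegral u η x (γ z))
        ((u x (γ x + η) - u x (γ x)) * V x (γ x)) (Ioi x) x :=
      ((hasDerivAt_vertIntegral hu η x (γ x)).comp_hasDerivWithinAt x (hγ x hx)).mono
        Ioi_subset_Ici_self
    rw [hasDerivWithinAt_iff_tendsto_slope' (by simp)] at hcomp
    have ev1 := hcomp.eventually
      (gt_mem_nhds (lt_add_of_pos_right _ (by positivity : 0 < r / 4)))
    have hΔ : Continuous fun p : ℝ × ℝ => F p.1 (p.2 + η) - F p.1 p.2 :=
      Continuous.sub (f := fun p : ℝ × ℝ => F p.1 (p.2 + η)) (g := fun p => F p.1 p.2)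
        (Continuous.comp₂ (g := Function.uncurry F) hF (e := fun p : ℝ × ℝ => p.1)
          (f := fun p => p.2 + η) continuous_fst (by fun_prop)) hF
    obtain ⟨κ, hκ, hΔκ⟩ := Metric.continuousAt_iff.1 (hΔ.continuousAt (x := (x, γ x))) (r / 4)
      (by positivity)
    set κ' := min κ (r / (4 * (4 * L + 1))) with hκ'
    have hκ'0 : 0 < κ' := by positivity
    obtain ⟨ρ, hρ, hγρ⟩ := Metric.continuousAt_iff.1 (hγc.continuousAt (x := x)) κ' hκ'0
    -- a compact segment has a rectangular neighbourhood in `O`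
    have ev2 : ∀ᶠ z in 𝓝[>] x, Icc x z ×ˢ Icc (γ z) (γ z + η) ⊆ O := by
      have hseg : ({x} : Set ℝ) ×ˢ Icc (γ x) (γ x + η) ⊆ O := by
        rintro ⟨p, q⟩ ⟨hp, hq⟩
        rw [mem_singleton_iff] at hp
        simp only at hp hq
        rw [hp]
        exact hstrip x ⟨hx.1, hx.2.le⟩ q hq
      obtain ⟨A, B, hA, hB, hxA, hB', hAB⟩ :=
        generalized_tube_lemma isCompact_singleton isCompact_Icc hO hseg
      obtain ⟨α, hα, hAα⟩ := Metric.isOpen_iff.1 hA x (hxA rfl)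
      obtain ⟨β, hβ, hBβ⟩ := isCompact_Icc.exists_thickening_subset_open hB hB'
      have e1 : ∀ᶠ z in 𝓝[>] x, z < x + α :=
        nhdsWithin_le_nhds (gt_mem_nhds (by linarith))
      have e2 : ∀ᶠ z in 𝓝[>] x, dist (γ z) (γ x) < β :=
        nhdsWithin_le_nhds ((Metric.tendsto_nhds.1 hγc.continuousAt) β hβ)
      filter_upwards [e1, e2] with z hz1 hz2
      rintro ⟨p, q⟩ ⟨hp, hq⟩
      refine hAB ⟨hAα ?_, hBβ ?_⟩
      · rw [Real.ball_eq_Ioo]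
        exact ⟨by linarith [hp.1], by linarith [hp.2]⟩
      · rw [Metric.mem_thickening_iff]
        refine ⟨q - γ z + γ x, ⟨by linarith [hq.1], by linarith [hq.2]⟩, ?_⟩
        rw [Real.dist_eq] at hz2 ⊢
        convert hz2 using 2
        ring
    have ev3 : ∀ᶠ z in 𝓝[>] x, z < x + min ρ κ :=
      nhdsWithin_le_nhds (gt_mem_nhds (by linarith [lt_min hρ hκ]))
    have ev4 : ∀ᶠ z in 𝓝[>] x, z ≤ b :=
      nhdsWithin_le_nhds (Iic_mem_nhds hx.2)
    filter_upwards [ev1, ev2, ev3, ev4, self_mem_nhdsWithin] with z h1 h2 h3 h4 h5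
    have hxz : x < z := h5
    have hzρ := min_le_left ρ κ
    have hzκ := min_le_right ρ κ
    have hclose : ∀ σ ∈ Icc x z, |γ σ - γ x| < κ' := fun σ hσ => hγρ (by
      rw [Real.dist_eq, abs_lt]
      constructor <;> linarith [hσ.1, hσ.2])
    have hz := right_mem_Icc.2 hxz.le
    have hbal := hR x z (γ z) hx.1 hxz.le h2
    have hFi : ∀ t, IntervalIntegrable (fun σ => F σ (t + η) - F σ t) volume x z := fun t =>
      (hΔ.comp₂ continuous_id continuous_const).intervalIntegrable _ _
    rw [intervalIntegral.integral_sub (hgi (fun _ => γ z) measurable_const x z) (hFi (γ z))]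
      at hbal
    have hb1 : (∫ σ in x..z, vertIntegral w η σ (γ z)) -
        ∫ σ in x..z, vertIntegral w η σ (γ σ) ≤ r / 4 * (z - x) := by
      rw [← intervalIntegral.integral_sub (hgi (fun _ => γ z) measurable_const x z)
        (hgi γ hγc.measurable x z)]
      refine (le_abs_self _).trans ?_
      have := intervalIntegral.norm_integral_le_of_norm_le_const (a := x) (b := z) (C := r / 4)
        (f := fun σ => vertIntegral w η σ (γ z) - vertIntegral w η σ (γ σ)) (fun σ hσ => by
          rw [uIoc_of_le hxz.le] at hσ
          refine (abs_vertIntegral_sub_le hw hL η σ (γ z) (γ σ)).trans ?_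
          have e1 := hclose σ ⟨hσ.1.le, hσ.2⟩
          have e2 := hclose z hz
          have e3 : κ' ≤ r / (4 * (4 * L + 1)) := min_le_right _ _
          have e4 : |γ z - γ σ| ≤ 2 * κ' := by
            rw [abs_lt] at e1 e2
            exact abs_le.2 ⟨by linarith, by linarith⟩
          calc 2 * L * |γ z - γ σ| ≤ 2 * L * (2 * (r / (4 * (4 * L + 1)))) := by
                gcongr; linarith
            _ = r / 4 * (4 * L / (4 * L + 1)) := by field_simp; ring
            _ ≤ r / 4 * 1 := by
                gcongr
                rw [div_le_one (by positivity)]; linarith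
            _ = r / 4 := mul_one _)
      rwa [abs_of_pos (sub_pos.2 hxz)] at this
    have hb2 : (F x (γ x + η) - F x (γ x) - r / 4) * (z - x) ≤
        ∫ σ in x..z, (F σ (γ z + η) - F σ (γ z)) := by
      have := intervalIntegral.integral_mono_on hxz.le
        (intervalIntegrable_const (c := F x (γ x + η) - F x (γ x) - r / 4)) (hFi (γ z))
        (fun σ hσ => by
          have hd : dist (σ, γ z) (x, γ x) < κ := by
            rw [Prod.dist_eq]
            refine max_lt ?_ ((hclose z hz).trans_le (min_le_left _ _))
            simp only [Real.dist_eq, abs_lt]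
            constructor <;> linarith [hσ.1, hσ.2]
          have := hΔκ hd
          rw [Real.dist_eq, abs_lt] at this
          simp only at this
          linarith [this.1])
      rwa [intervalIntegral.integral_const, smul_eq_mul, mul_comm] at this
    have hsplit : (∫ σ in a..z, vertIntegral w η σ (γ σ)) -
        ∫ σ in a..x, vertIntegral w η σ (γ σ) = ∫ σ in x..z, vertIntegral w η σ (γ σ) :=
      intervalIntegral.integral_interval_sub_left (hgi γ hγc.measurable _ _)
        (hgi γ hγc.measurable _ _)
    rw [slope_def_field, div_lt_iff₀ (sub_pos.2 hxz)] at h1 ⊢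
    have hcv := hconv x (γ x) (γ x + η)
    have hcv' := mul_le_mul_of_nonneg_right hcv (sub_pos.2 hxz).le
    simp only [hf]
    nlinarith [sub_pos.2 hxz]
  have := image_le_of_liminf_slope_right_le_deriv_boundary (f := f) (B := fun _ => f a)
    (B' := fun _ => 0) hfc le_rfl continuousOn_const
    (fun x _ => hasDerivWithinAt_const _ _ _) key (right_mem_Icc.2 hab)
  simp only [hf, intervalIntegral.integral_same, sub_zero] at this
  linarith

/-- `RectangleBalance.strip_le` for a curve differentiable on a neighbourhood of `[a, b]`. -/
theorem RectangleBalance.strip_le_of_hasDerivAt {O : Set (ℝ × ℝ)} {γ : ℝ → ℝ} {a b : ℝ}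
    (hR : RectangleBalance u F w O η a) (hu : Continuous (Function.uncurry u))
    (hF : Continuous (Function.uncurry F))
    (hconv : ∀ s t t', V s t * (u s t' - u s t) ≤ F s t' - F s t)
    (hw : Measurable (Function.uncurry w)) (hL : ∀ s t, |w s t| ≤ L) (hL0 : 0 ≤ L)
    (hO : IsOpen O) (hη : 0 ≤ η) (hab : a ≤ b)
    (hγ : ∀ s ∈ Icc a b, HasDerivAt γ (V s (γ s)) s)
    (hstrip : ∀ s ∈ Icc a b, ∀ x ∈ Icc (γ s) (γ s + η), (s, x) ∈ O) :
    vertIntegral u η b (γ b) - vertIntegral u η a (γ a) ≤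
      ∫ s in a..b, vertIntegral w η s (γ s) := by
  set γ' : ℝ → ℝ := IccExtend hab ((Icc a b).domRestrict γ) with hγ'
  have he : ∀ s ∈ Icc a b, γ' s = γ s := fun s hs => by
    rw [hγ', IccExtend_of_mem _ _ hs]; rfl
  have hγc : Continuous γ' := continuous_IccExtend_iff.2
    (continuousOn_iff_continuous_domRestrict.1
      fun s hs => (hγ s hs).continuousAt.continuousWithinAt)
  have h := hR.strip_le (γ := γ') (a := a) (b := b) hu hF hconv hw hL hL0 hO hη hab hγc
    (fun s hs => by
      have hs' := Ico_subset_Icc_self hs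
      rw [he s hs']
      refine (hγ s hs').hasDerivWithinAt.congr_of_eventuallyEq ?_ (he s hs')
      filter_upwards [Icc_mem_nhdsGE hs.2] with x hx
      exact he x ⟨hs.1.trans hx.1, hx.2⟩)
    (fun s hs => by rw [he s hs]; exact hstrip s hs)
  rw [he b (right_mem_Icc.2 hab), he a (left_mem_Icc.2 hab)] at h
  refine h.trans_eq (intervalIntegral.integral_congr fun s hs => ?_)
  rw [uIcc_of_le hab] at hs
  simp only [he s hs]

theorem vertIntegral_reflect (w : ℝ → ℝ → ℝ) (η s t : ℝ) :
    vertIntegral (fun s t => -w s (-t)) η s t = -vertIntegral w η s (-t - η) := by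
  rw [vertIntegral_eq, vertIntegral_eq, intervalIntegral.integral_neg,
    intervalIntegral.integral_comp_neg (f := fun x => w s x)]
  congr 2 <;> ring

/-- The one-sided balance opposite to `RectangleBalance`. -/
def RectangleBalanceGE (u F w : ℝ → ℝ → ℝ) (O : Set (ℝ × ℝ)) (η a : ℝ) : Prop :=
  ∀ s₁ s₂ t, a ≤ s₁ → s₁ ≤ s₂ → Icc s₁ s₂ ×ˢ Icc t (t + η) ⊆ O →
    ∫ σ in s₁..s₂, (vertIntegral w η σ t - (F σ (t + η) - F σ t)) ≤
      vertIntegral u η s₂ t - vertIntegral u η s₁ t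

theorem RectangleBalanceGE.reflect {O : Set (ℝ × ℝ)} {a : ℝ} (hR : RectangleBalanceGE u F w O η a) :
    RectangleBalance (fun s t => -u s (-t)) (fun s t => F s (-t)) (fun s t => -w s (-t))
      {p | (p.1, -p.2) ∈ O} η a := by
  intro s₁ s₂ t ha hs hO
  have h := hR s₁ s₂ (-t - η) ha hs (by
    rintro ⟨p, q⟩ ⟨hp, hq⟩
    simp only at hp hq
    have := @hO (p, -q) ⟨hp, by linarith [hq.2], by linarith [hq.1]⟩
    simpa using this)
  simp only [vertIntegral_reflect]
  have e : (∫ σ in s₁..s₂, (-vertIntegral w η σ (-t - η) - (F σ (-(t + η)) - F σ (-t)))) =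
      -∫ σ in s₁..s₂, (vertIntegral w η σ (-t - η) - (F σ (-t - η + η) - F σ (-t - η))) := by
    rw [← intervalIntegral.integral_neg]
    refine intervalIntegral.integral_congr fun σ _ => ?_
    simp only [neg_add', sub_add_cancel]
    ring
  rw [e]
  linarith

/-- The counterpart of `RectangleBalance.strip_le` for a strip lying below a characteristic. -/
theorem RectangleBalanceGE.le_strip_of_hasDerivAt {O : Set (ℝ × ℝ)} {γ : ℝ → ℝ} {a b : ℝ}
    (hR : RectangleBalanceGE u F w O η a) (hu : Continuous (Function.uncurry u))
    (hF : Continuous (Function.uncurry F))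
    (hconv : ∀ s t t', V s t * (u s t' - u s t) ≤ F s t' - F s t)
    (hw : Measurable (Function.uncurry w)) (hL : ∀ s t, |w s t| ≤ L) (hL0 : 0 ≤ L)
    (hO : IsOpen O) (hη : 0 ≤ η) (hab : a ≤ b)
    (hγ : ∀ s ∈ Icc a b, HasDerivAt γ (V s (γ s)) s)
    (hstrip : ∀ s ∈ Icc a b, ∀ x ∈ Icc (γ s - η) (γ s), (s, x) ∈ O) :
    ∫ s in a..b, vertIntegral w η s (γ s - η) ≤
      vertIntegral u η b (γ b - η) - vertIntegral u η a (γ a - η) := by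
  have hm : Continuous fun p : ℝ × ℝ => (p.1, -p.2) := by fun_prop
  have h := hR.reflect.strip_le_of_hasDerivAt (V := fun s t => -V s (-t)) (γ := fun s => -γ s)
    (a := a) (b := b) (L := L) (hu.comp hm).neg (hF.comp hm)
    (fun s t t' => by have := hconv s (-t) (-t'); linarith) (hw.comp hm.measurable).neg
    (fun s t => by rw [abs_neg]; exact hL _ _) hL0 (hO.preimage hm) hη hab
    (fun s hs => by
      simp only [neg_neg]
      exact (hγ s hs).neg)
    (fun s hs x hx => hstrip s hs _ ⟨by linarith [hx.2], by linarith [hx.1]⟩)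
  simp only [vertIntegral_reflect, neg_neg, intervalIntegral.integral_neg] at h
  linarith

end Strip

/-! ### From the weak equation to the balance on rectangles -/

section Weak

set_option linter.unusedSectionVars false

theorem integral_add_add {X : Type*} [MeasurableSpace X] {ν : Measure X} {f g k : X → ℝ}
    (hf : Integrable f ν) (hg : Integrable g ν)
    (hk : Integrable k ν) :
    ∫ x, (f x + g x + k x) ∂ν = ∫ x, f x ∂ν + ∫ x, g x ∂ν + ∫ x, k x ∂ν := by
  have h : Integrable (fun x => f x + g x) ν := hf.add hg
  rw [integral_add h hk, integral_add hf hg]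

variable {P : Type*} [NormedAddCommGroup P] [NormedSpace ℝ P] [FiniteDimensional ℝ P]
  [MeasurableSpace P] [BorelSpace P] {μ : Measure P} [μ.IsAddHaarMeasure]
  {X : Type*} [MeasurableSpace X] {ν : Measure X} [IsFiniteMeasure ν] {C : ℝ}

theorem integrable_mul_snd {G : X × P → ℝ} {k : P → ℝ} (hG : Measurable G)
    (hC : ∀ x, |G x| ≤ C) (hk : Integrable k μ) :
    Integrable (fun q : X × P => G q * k q.2) (ν.prod μ) :=
  (hk.comp_snd ν).bdd_mul hG.aestronglyMeasurable (Eventually.of_forall hC)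

theorem integrable_mul_translate {G k : P → ℝ} (hG : Measurable G) (hC : ∀ x, |G x| ≤ C)
    (hk : Continuous k) (hki : Integrable k μ) {m : X → P} (hm : Measurable m) :
    Integrable (fun q : X × P => G q.2 * k (q.2 - m q.1)) (ν.prod μ) := by
  have h : Integrable (fun q : X × P => k (q.2 - m q.1)) (ν.prod μ) := by
    have hm' : Measurable fun q : X × P => k (q.2 - m q.1) :=
      hk.measurable.comp (measurable_snd.sub (hm.comp measurable_fst))
    rw [integrable_prod_iff hm'.aestronglyMeasurable]
    refine ⟨Eventually.of_forall fun x => hki.comp_sub_right (m x), ?_⟩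
    have : (fun x => ∫ y, ‖k (y - m x)‖ ∂μ) = fun _ => ∫ y, ‖k y‖ ∂μ := by
      ext x
      exact integral_sub_right_eq_self (fun y => ‖k y‖) (m x)
    simp only [this]
    exact integrable_const _
  exact h.bdd_mul (hG.comp measurable_snd).aestronglyMeasurable
    (Eventually.of_forall fun q => hC q.2)

theorem locallyIntegrable_integral {G : P × X → ℝ} (hG : Measurable G) (hC : ∀ x, |G x| ≤ C) :
    LocallyIntegrable (fun A => ∫ x, G (A, x) ∂ν) μ := by
  have hm : AEStronglyMeasurable (fun A => ∫ x, G (A, x) ∂ν) μ :=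
    (hG.stronglyMeasurable.integral_prod_right' (ν := ν)).aestronglyMeasurable
  refine (MemLp.locallyIntegrable (p := ∞) (memLp_top_of_bound hm (C * ν.real univ)
    (Eventually.of_forall fun A => ?_)) le_top)
  exact norm_integral_le_of_norm_le_const (Eventually.of_forall fun x => hC (A, x))

theorem continuous_fderiv_apply_const {θ : P → ℝ} (hθ : ContDiff ℝ ∞ θ) (v : P) :
    Continuous fun A => fderiv ℝ θ A v :=
  (hθ.continuous_fderiv (by simp)).clm_apply continuous_const

theorem integrable_fderiv_apply {θ : P → ℝ} (hθ : ContDiff ℝ ∞ θ) (hc : HasCompactSupport θ)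
    (v : P) : Integrable (fun A => fderiv ℝ θ A v) μ :=
  (continuous_fderiv_apply_const hθ v).integrable_of_hasCompactSupport (hc.fderiv_apply ℝ v)

theorem integral_mul_comp_sub {G θ : P → ℝ} (q : P) :
    ∫ B, G B * θ (B - q) ∂μ = ∫ A, G (A + q) * θ A ∂μ := by
  rw [← integral_add_right_eq_self (fun B => G B * θ (B - q)) q]
  simp

/-- Integration of a directional derivative of a test function along translations. -/
theorem integral_translate_fderiv {G θ : P → ℝ} (hG : Measurable G) (hC : ∀ x, |G x| ≤ C)
    (hθ : ContDiff ℝ ∞ θ) (hc : HasCompactSupport θ) (q v : P) {h : ℝ} (hh : 0 ≤ h) :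
    ∫ σ in Ioc 0 h, ∫ B, G B * fderiv ℝ θ (B - (q + σ • v)) v ∂μ =
      ∫ A, (G (A + q) - G (A + (q + h • v))) * θ A ∂μ := by
  have hθi : Integrable θ μ := hθ.continuous.integrable_of_hasCompactSupport hc
  have hi : ∀ p : P, Integrable (fun B => G B * θ (B - p)) μ := fun p =>
    (hθi.comp_sub_right p).bdd_mul hG.aestronglyMeasurable (Eventually.of_forall hC)
  rw [integral_integral_swap (integrable_mul_translate hG hC
    (continuous_fderiv_apply_const hθ v) (integrable_fderiv_apply hθ hc v)
    (m := fun σ : ℝ => q + σ • v) (by fun_prop))]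
  have hftc : ∀ B, ∫ σ in Ioc 0 h, G B * fderiv ℝ θ (B - (q + σ • v)) v =
      G B * θ (B - q) - G B * θ (B - (q + h • v)) := by
    intro B
    rw [integral_const_mul, ← mul_sub, ← intervalIntegral.integral_of_le hh]
    have hd : ∀ σ ∈ uIcc 0 h, HasDerivAt (fun σ : ℝ => -θ (B - (q + σ • v)))
        (fderiv ℝ θ (B - (q + σ • v)) v) σ := by
      intro σ _
      have h1 : HasDerivAt (fun σ : ℝ => B - (q + σ • v)) (-v) σ := by
        have := (((hasDerivAt_id σ).smul_const v).const_add q).const_sub B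
        simpa using this
      have h2 := ((hθ.differentiable (by simp)).differentiableAt
        (x := B - (q + σ • v))).hasFDerivAt.comp_hasDerivAt σ h1
      have h3 := h2.neg
      rw [map_neg, neg_neg] at h3
      exact h3
    rw [intervalIntegral.integral_eq_sub_of_hasDerivAt hd (Continuous.intervalIntegrable
      ((continuous_fderiv_apply_const hθ v).comp (by fun_prop)) _ _)]
    simp only [zero_smul, add_zero]
    ring
  simp only [hftc]
  rw [integral_sub (hi _) (hi _), integral_mul_comp_sub, integral_mul_comp_sub, ← integral_sub]
  · simp only [sub_mul]
  · exact hθi.bdd_mul (hG.comp (measurable_add_const _)).aestronglyMeasurable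
      (Eventually.of_forall fun _ => hC _)
  · exact hθi.bdd_mul (hG.comp (measurable_add_const _)).aestronglyMeasurable
      (Eventually.of_forall fun _ => hC _)

/-- `f` and `F` solve `∂_e f + ∂_v F = w` on `W` in the sense of distributions. -/
def IsWeakSolution (μ : Measure P) (f F w : P → ℝ) (e v : P) (W : Set P) : Prop :=
  ∀ ψ : P → ℝ, ContDiff ℝ ∞ ψ → HasCompactSupport ψ → tsupport ψ ⊆ W →
    ∫ A, (f A * fderiv ℝ ψ A e + F A * fderiv ℝ ψ A v) ∂μ = -∫ A, w A * ψ A ∂μ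

theorem isOpen_setOf_parallelogram_subset {W : Set P} (hW : IsOpen W) (e v : P) (h η : ℝ) :
    IsOpen {A : P | ∀ q ∈ Icc 0 h ×ˢ Icc 0 η, A + (q.1 • e + q.2 • v) ∈ W} := by
  have hK : IsCompact (Icc 0 h ×ˢ Icc 0 η : Set (ℝ × ℝ)) := isCompact_Icc.prod isCompact_Icc
  have hO : IsOpen {p : P × (ℝ × ℝ) | p.1 + (p.2.1 • e + p.2.2 • v) ∈ W} :=
    hW.preimage (by fun_prop)
  rw [isOpen_iff_mem_nhds]
  intro A hA
  have := hK.eventually_forall_of_forall_eventually (x₀ := A)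
    (P := fun A q => A + (q.1 • e + q.2 • v) ∈ W) (fun q hq => hO.mem_nhds (hA q hq))
  exact this

theorem IsWeakSolution.ae_balance {f F w : P → ℝ} {e v : P} {W : Set P}
    (hs : IsWeakSolution μ f F w e v W) (hW : IsOpen W) (hf : Measurable f) (hF : Measurable F)
    (hw : Measurable w) (hfC : ∀ A, |f A| ≤ C) (hFC : ∀ A, |F A| ≤ C) (hwC : ∀ A, |w A| ≤ C)
    {h η : ℝ} (hh : 0 ≤ h) (hη : 0 ≤ η) :
    ∀ᵐ A ∂μ, (∀ q ∈ Icc 0 h ×ˢ Icc 0 η, A + (q.1 • e + q.2 • v) ∈ W) →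
      (∫ τ in Ioc 0 η, (f (A + τ • v) - f (A + (τ • v + h • e)))) +
        (∫ σ in Ioc 0 h, (F (A + σ • e) - F (A + (σ • e + η • v)))) +
        ∫ q, w (A + (q.1 • e + q.2 • v))
          ∂((volume.restrict (Ioc 0 h)).prod (volume.restrict (Ioc 0 η))) = 0 := by
  set ρ := ((volume : Measure ℝ).restrict (Ioc 0 h)).prod
    ((volume : Measure ℝ).restrict (Ioc 0 η)) with hρ
  have hm1 : Measurable fun p : P × ℝ => f (p.1 + p.2 • v) - f (p.1 + (p.2 • v + h • e)) :=
    (hf.comp (by fun_prop)).sub (hf.comp (by fun_prop))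
  have hb1 : ∀ p : P × ℝ, |f (p.1 + p.2 • v) - f (p.1 + (p.2 • v + h • e))| ≤ C + C :=
    fun p => (abs_sub _ _).trans (add_le_add (hfC _) (hfC _))
  have hm2 : Measurable fun p : P × ℝ => F (p.1 + p.2 • e) - F (p.1 + (p.2 • e + η • v)) :=
    (hF.comp (by fun_prop)).sub (hF.comp (by fun_prop))
  have hb2 : ∀ p : P × ℝ, |F (p.1 + p.2 • e) - F (p.1 + (p.2 • e + η • v))| ≤ C + C :=
    fun p => (abs_sub _ _).trans (add_le_add (hFC _) (hFC _))
  have hm3 : Measurable fun p : P × (ℝ × ℝ) => w (p.1 + (p.2.1 • e + p.2.2 • v)) :=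
    hw.comp (by fun_prop)
  have hl1 := locallyIntegrable_integral (μ := μ) (ν := volume.restrict (Ioc 0 η)) hm1 hb1
  have hl2 := locallyIntegrable_integral (μ := μ) (ν := volume.restrict (Ioc 0 h)) hm2 hb2
  have hl3 := locallyIntegrable_integral (μ := μ) (ν := ρ) hm3 (fun p => hwC _)
  refine (isOpen_setOf_parallelogram_subset hW e v h η).ae_eq_zero_of_integral_contDiff_smul_eq_zero
    (((hl1.add hl2).add hl3).locallyIntegrableOn _) ?_
  intro θ hθ hc hsupp
  have hθi : Integrable θ μ := hθ.continuous.integrable_of_hasCompactSupport hc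
  have hmq : Measurable fun q : ℝ × ℝ => q.1 • e + q.2 • v := by fun_prop
  have hI1 := integrable_mul_translate (ν := ρ) hf hfC (continuous_fderiv_apply_const hθ e)
    (integrable_fderiv_apply (μ := μ) hθ hc e) hmq
  have hI2 := integrable_mul_translate (ν := ρ) hF hFC (continuous_fderiv_apply_const hθ v)
    (integrable_fderiv_apply (μ := μ) hθ hc v) hmq
  have hI3 := integrable_mul_translate (ν := ρ) hw hwC hθ.continuous hθi hmq
  have hE : ∀ q ∈ Ioc 0 h ×ˢ Ioc 0 η,
      (∫ B, f B * fderiv ℝ θ (B - (q.1 • e + q.2 • v)) e ∂μ) +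
        (∫ B, F B * fderiv ℝ θ (B - (q.1 • e + q.2 • v)) v ∂μ) +
        ∫ B, w B * θ (B - (q.1 • e + q.2 • v)) ∂μ = 0 := by
    intro q hq
    set p := q.1 • e + q.2 • v with hp
    have h1 := hs (fun B => θ (B - p)) (hθ.comp (contDiff_id.sub contDiff_const))
      (hc.comp_homeomorph (Homeomorph.subRight p)) (by
        have : tsupport (fun B => θ (B - p)) = (Homeomorph.subRight p) ⁻¹' tsupport θ :=
          tsupport_comp_eq_preimage θ (Homeomorph.subRight p)
        rw [this]
        intro B hB
        have := hsupp hB q ⟨⟨hq.1.1.le, hq.1.2⟩, hq.2.1.le, hq.2.2⟩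
        simpa [← hp] using this)
    simp only [fderiv_comp_sub] at h1
    rw [integral_add] at h1
    · linarith
    · exact ((integrable_fderiv_apply hθ hc e).comp_sub_right p).bdd_mul
        hf.aestronglyMeasurable (Eventually.of_forall hfC)
    · exact ((integrable_fderiv_apply hθ hc v).comp_sub_right p).bdd_mul
        hF.aestronglyMeasurable (Eventually.of_forall hFC)
  have hsum : (∫ q, ∫ B, f B * fderiv ℝ θ (B - (q.1 • e + q.2 • v)) e ∂μ ∂ρ) +
      (∫ q, ∫ B, F B * fderiv ℝ θ (B - (q.1 • e + q.2 • v)) v ∂μ ∂ρ) +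
      ∫ q, ∫ B, w B * θ (B - (q.1 • e + q.2 • v)) ∂μ ∂ρ = 0 := by
    rw [← integral_add_add hI1.integral_prod_left hI2.integral_prod_left hI3.integral_prod_left]
    have hae : ∀ᵐ q ∂ρ, q ∈ Ioc 0 h ×ˢ Ioc 0 η := by
      rw [hρ, Measure.prod_restrict]
      exact ae_restrict_mem (measurableSet_Ioc.prod measurableSet_Ioc)
    rw [integral_congr_ae (hae.mono fun q hq => hE q hq), integral_zero]
  have e1 : (∫ q, ∫ B, f B * fderiv ℝ θ (B - (q.1 • e + q.2 • v)) e ∂μ ∂ρ) =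
      ∫ A, (∫ τ in Ioc 0 η, (f (A + τ • v) - f (A + (τ • v + h • e)))) * θ A ∂μ := by
    rw [hρ, integral_prod_symm _ hI1.integral_prod_left]
    have : ∀ τ : ℝ, ∫ σ in Ioc 0 h, ∫ B, f B * fderiv ℝ θ (B - (σ • e + τ • v)) e ∂μ =
        ∫ A, (f (A + τ • v) - f (A + (τ • v + h • e))) * θ A ∂μ := by
      intro τ
      rw [← integral_translate_fderiv hf hfC hθ hc (τ • v) e hh]
      simp only [add_comm]
    simp only [this]
    rw [integral_integral_swap]
    · simp only [integral_mul_const]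
    · exact integrable_mul_snd (hm1.comp measurable_swap) (fun p => hb1 p.swap) hθi
  have e2 : (∫ q, ∫ B, F B * fderiv ℝ θ (B - (q.1 • e + q.2 • v)) v ∂μ ∂ρ) =
      ∫ A, (∫ σ in Ioc 0 h, (F (A + σ • e) - F (A + (σ • e + η • v)))) * θ A ∂μ := by
    rw [hρ, integral_prod _ hI2.integral_prod_left]
    simp only [integral_translate_fderiv hF hFC hθ hc (_ • e) v hη]
    rw [integral_integral_swap]
    · simp only [integral_mul_const]
    · exact integrable_mul_snd (hm2.comp measurable_swap) (fun p => hb2 p.swap) hθi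
  have e3 : (∫ q, ∫ B, w B * θ (B - (q.1 • e + q.2 • v)) ∂μ ∂ρ) =
      ∫ A, (∫ q, w (A + (q.1 • e + q.2 • v)) ∂ρ) * θ A ∂μ := by
    simp only [integral_mul_comp_sub]
    rw [integral_integral_swap]
    · simp only [integral_mul_const]
    · exact integrable_mul_snd (hm3.comp measurable_swap) (fun p => hwC _) hθi
  rw [e1, e2, e3] at hsum
  have hli : ∀ {g : P → ℝ}, LocallyIntegrable g μ → Integrable (fun A => g A * θ A) μ := by
    intro g hg
    simpa [mul_comm] using hg.integrable_smul_left_of_hasCompactSupport hθ.continuous hc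
  rw [← integral_add_add (hli hl1) (hli hl2) (hli hl3)] at hsum
  refine Eq.trans ?_ hsum
  refine integral_congr_ae (Eventually.of_forall fun A => ?_)
  simp only [smul_eq_mul]
  ring

end Weak

/-! ### Balance on rectangles in two-dimensional slices -/

section Slice

set_option linter.unusedSectionVars false

variable {ι : Type*} [Fintype ι] {f F w : (ι → ℝ) × ℝ → ℝ} {e z : ι → ℝ}
  {W : Set ((ι → ℝ) × ℝ)} {C L : ℝ}

/-- Restriction of `f` to the plane through `(z, 0)` spanned by `e` and the vertical direction. -/
def lineSlice {Y : Type*} (f : (ι → ℝ) × ℝ → Y) (e z : ι → ℝ) (s t : ℝ) : Y := f (z + s • e, t)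

theorem continuous_lineSlice (hf : Continuous f) (e z : ι → ℝ) :
    Continuous (Function.uncurry (lineSlice f e z)) :=
  hf.comp (by fun_prop : Continuous fun p : ℝ × ℝ => (z + p.1 • e, p.2))

theorem measurable_lineSlice (hf : Measurable f) (e z : ι → ℝ) :
    Measurable (Function.uncurry (lineSlice f e z)) :=
  hf.comp (by fun_prop : Measurable fun p : ℝ × ℝ => (z + p.1 • e, p.2))

theorem lineSlice_add_smul (f : (ι → ℝ) × ℝ → ℝ) (e z : ι → ℝ) (c s t : ℝ) :
    lineSlice f e (z + c • e) s t = lineSlice f e z (c + s) t := by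
  simp only [lineSlice, add_smul, add_assoc]

theorem IsWeakSolution.ae_balance_slice
    (hs : IsWeakSolution volume f F w (e, 0) (0, 1) W) (hW : IsOpen W) (hf : Continuous f)
    (hF : Continuous F) (hw : Measurable w) (hfC : ∀ A, |f A| ≤ C) (hFC : ∀ A, |F A| ≤ C)
    (hwC : ∀ A, |w A| ≤ C) {h η : ℝ} (hh : 0 ≤ h) (hη : 0 ≤ η) :
    ∀ᵐ A : (ι → ℝ) × ℝ, (∀ p ∈ Icc 0 h ×ˢ Icc A.2 (A.2 + η), lineSlice (· ∈ W) e A.1 p.1 p.2) →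
      vertIntegral (lineSlice f e A.1) η h A.2 - vertIntegral (lineSlice f e A.1) η 0 A.2 =
        ∫ σ in (0 : ℝ)..h, (vertIntegral (lineSlice w e A.1) η σ A.2 -
          (lineSlice F e A.1 σ (A.2 + η) - lineSlice F e A.1 σ A.2)) := by
  have : (volume : Measure ((ι → ℝ) × ℝ)).IsAddHaarMeasure :=
    inferInstanceAs ((volume : Measure (ι → ℝ)).prod (volume : Measure ℝ)).IsAddHaarMeasure
  filter_upwards [hs.ae_balance hW hf.measurable hF.measurable hw hfC hFC hwC hh hη]
    with A hA hrect
  have key := hA fun q hq => by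
    have := hrect (q.1, A.2 + q.2) ⟨hq.1, by linarith [hq.2.1], by linarith [hq.2.2]⟩
    have e1 : A + (q.1 • (e, (0 : ℝ)) + q.2 • ((0 : ι → ℝ), (1 : ℝ))) =
        (A.1 + q.1 • e, A.2 + q.2) := by ext <;> simp
    rw [e1]
    exact this
  have hfs := continuous_lineSlice hf e A.1
  have hFs := continuous_lineSlice hF e A.1
  have hws := measurable_lineSlice hw e A.1
  have hwi : Integrable (fun q : ℝ × ℝ => lineSlice w e A.1 q.1 (A.2 + q.2))
      ((volume.restrict (Ioc 0 h)).prod (volume.restrict (Ioc 0 η))) :=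
    (integrable_const C).mono' (hws.comp (by fun_prop :
      Measurable fun q : ℝ × ℝ => (q.1, A.2 + q.2))).aestronglyMeasurable
      (Eventually.of_forall fun q => hwC _)
  have e1 : ∀ τ : ℝ, A + τ • ((0 : ι → ℝ), (1 : ℝ)) = (A.1 + (0 : ℝ) • e, A.2 + τ) := by
    intro τ; ext <;> simp
  have e2 : ∀ τ : ℝ, A + (τ • ((0 : ι → ℝ), (1 : ℝ)) + h • (e, (0 : ℝ))) =
      (A.1 + h • e, A.2 + τ) := by
    intro τ; ext <;> simp
  have e3 : ∀ σ : ℝ, A + σ • (e, (0 : ℝ)) = (A.1 + σ • e, A.2) := by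
    intro τ; ext <;> simp
  have e4 : ∀ σ : ℝ, A + (σ • (e, (0 : ℝ)) + η • ((0 : ι → ℝ), (1 : ℝ))) =
      (A.1 + σ • e, A.2 + η) := by
    intro τ; ext <;> simp
  have e5 : ∀ q : ℝ × ℝ, A + (q.1 • (e, (0 : ℝ)) + q.2 • ((0 : ι → ℝ), (1 : ℝ))) =
      (A.1 + q.1 • e, A.2 + q.2) := by
    intro τ; ext <;> simp
  simp only [e1, e2, e3, e4, e5] at key
  have k1 : ∀ s, IntervalIntegrable (fun τ => lineSlice f e A.1 s (A.2 + τ)) volume 0 η :=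
    fun s => (Continuous.comp₂ (g := Function.uncurry (lineSlice f e A.1)) hfs
      (continuous_const (y := s)) (by fun_prop : Continuous fun τ => A.2 + τ)).intervalIntegrable
        _ _
  have k2 : ∀ t, IntervalIntegrable (fun σ => lineSlice F e A.1 σ t) volume 0 h := fun t =>
    (Continuous.comp₂ (g := Function.uncurry (lineSlice F e A.1)) hFs continuous_id
      (continuous_const (y := t))).intervalIntegrable _ _
  have k3 : IntervalIntegrable (fun σ => vertIntegral (lineSlice w e A.1) η σ A.2) volume 0 h :=
    intervalIntegrable_vertIntegral hws (fun s t => hwC _) hη measurable_const _ _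
  have k6 := integral_prod _ hwi
  simp only [lineSlice] at k6
  rw [k6] at key
  rw [intervalIntegral.integral_sub k3 ((k2 _).sub (k2 _)),
    intervalIntegral.integral_sub (k2 _) (k2 _)]
  rw [← intervalIntegral.integral_of_le hη, ← intervalIntegral.integral_of_le hh,
    ← intervalIntegral.integral_of_le hh] at key
  simp only [← intervalIntegral.integral_of_le hη] at key
  have k4 := intervalIntegral.integral_sub (k1 0) (k1 h)
  have k5 := intervalIntegral.integral_sub (k2 A.2) (k2 (A.2 + η))
  simp only [lineSlice] at k4 k5
  simp only [vertIntegral, lineSlice]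
  linarith

theorem continuous_horizontalIntegral (hF : Continuous F) (e : ι → ℝ) (h η : ℝ) :
    Continuous fun A : (ι → ℝ) × ℝ => ∫ σ in (0 : ℝ)..h,
      (lineSlice F e A.1 σ (A.2 + η) - lineSlice F e A.1 σ A.2) := by
  refine intervalIntegral.continuous_parametric_intervalIntegral_of_continuous'
    (f := fun (A : (ι → ℝ) × ℝ) σ => lineSlice F e A.1 σ (A.2 + η) - lineSlice F e A.1 σ A.2)
    ?_ 0 h
  simp only [lineSlice]
  fun_prop

theorem continuous_vertIntegral_lineSlice (hf : Continuous f) (e : ι → ℝ) (h η : ℝ) :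
    Continuous fun A : (ι → ℝ) × ℝ => vertIntegral (lineSlice f e A.1) η h A.2 := by
  refine intervalIntegral.continuous_parametric_intervalIntegral_of_continuous'
    (f := fun (A : (ι → ℝ) × ℝ) τ => lineSlice f e A.1 h (A.2 + τ)) ?_ 0 η
  simp only [lineSlice]
  fun_prop

theorem isOpen_setOf_rectangle_subset (hW : IsOpen W) (e : ι → ℝ) (h η : ℝ) :
    IsOpen {A : (ι → ℝ) × ℝ |
      ∀ p ∈ Icc 0 h ×ˢ Icc A.2 (A.2 + η), lineSlice (· ∈ W) e A.1 p.1 p.2} := by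
  have h1 := isOpen_setOf_parallelogram_subset hW (e, (0 : ℝ)) ((0 : ι → ℝ), (1 : ℝ)) h η
  refine (congrArg IsOpen (Set.ext fun A => ?_)).mpr h1
  have e5 : ∀ q : ℝ × ℝ, A + (q.1 • (e, (0 : ℝ)) + q.2 • ((0 : ι → ℝ), (1 : ℝ))) =
      (A.1 + q.1 • e, A.2 + q.2) := by
    intro τ; ext <;> simp
  simp only [mem_ofPred_eq, e5, lineSlice]
  constructor
  · intro hA q hq
    exact hA (q.1, A.2 + q.2) ⟨hq.1, by linarith [hq.2.1], by linarith [hq.2.2]⟩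
  · intro hA p hp
    have := hA (p.1, p.2 - A.2) ⟨hp.1, by linarith [hp.2.1], by linarith [hp.2.2]⟩
    simpa using this

/-- For every `z`, the slices of a weak solution satisfy the balance inequalities given by a bound
of the source. -/
theorem IsWeakSolution.abs_balance_le
    (hs : IsWeakSolution volume f F w (e, 0) (0, 1) W) (hW : IsOpen W) (hf : Continuous f)
    (hF : Continuous F) (hw : Measurable w) (hfC : ∀ A, |f A| ≤ C) (hFC : ∀ A, |F A| ≤ C)
    (hwL : ∀ A, |w A| ≤ L) {h η : ℝ} (hh : 0 ≤ h) (hη : 0 ≤ η) (A : (ι → ℝ) × ℝ)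
    (hA : ∀ p ∈ Icc 0 h ×ˢ Icc A.2 (A.2 + η), lineSlice (· ∈ W) e A.1 p.1 p.2) :
    |vertIntegral (lineSlice f e A.1) η h A.2 - vertIntegral (lineSlice f e A.1) η 0 A.2 +
      ∫ σ in (0 : ℝ)..h, (lineSlice F e A.1 σ (A.2 + η) - lineSlice F e A.1 σ A.2)| ≤
      L * η * h := by
  set Ψ : (ι → ℝ) × ℝ → ℝ := fun A =>
    vertIntegral (lineSlice f e A.1) η h A.2 - vertIntegral (lineSlice f e A.1) η 0 A.2 +
      ∫ σ in (0 : ℝ)..h, (lineSlice F e A.1 σ (A.2 + η) - lineSlice F e A.1 σ A.2) with hΨ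
  have hΨc : Continuous Ψ := ((continuous_vertIntegral_lineSlice hf e h η).sub
    (continuous_vertIntegral_lineSlice hf e 0 η)).add (continuous_horizontalIntegral hF e h η)
  set U := {A : (ι → ℝ) × ℝ |
    ∀ p ∈ Icc 0 h ×ˢ Icc A.2 (A.2 + η), lineSlice (· ∈ W) e A.1 p.1 p.2} with hU
  have hUo : IsOpen U := isOpen_setOf_rectangle_subset hW e h η
  have hae : ∀ᵐ A : (ι → ℝ) × ℝ, A ∈ U → |Ψ A| ≤ L * η * h := by
    filter_upwards [hs.ae_balance_slice hW hf hF hw (C := max C L)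
      (fun A => (hfC A).trans (le_max_left _ _)) (fun A => (hFC A).trans (le_max_left _ _))
      (fun A => (hwL A).trans (le_max_right _ _)) hh hη] with B hB hBU
    have hB := hB hBU
    have hFs := continuous_lineSlice hF e B.1
    have k2 : ∀ t, IntervalIntegrable (fun σ => lineSlice F e B.1 σ t) volume 0 h := fun t =>
      (Continuous.comp₂ (g := Function.uncurry (lineSlice F e B.1)) hFs continuous_id
        (continuous_const (y := t))).intervalIntegrable _ _
    rw [intervalIntegral.integral_sub (intervalIntegrable_vertIntegral
      (measurable_lineSlice hw e B.1) (fun s t => hwL _) hη measurable_const _ _)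
      ((k2 _).sub (k2 _))] at hB
    have : Ψ B = ∫ σ in (0 : ℝ)..h, vertIntegral (lineSlice w e B.1) η σ B.2 := by
      simp only [hΨ, hB]; ring
    rw [this]
    have h2 := intervalIntegral.norm_integral_le_of_norm_le_const (a := (0 : ℝ)) (b := h)
      (C := L * η) (f := fun σ => vertIntegral (lineSlice w e B.1) η σ B.2)
      (fun σ _ => abs_vertIntegral_le (fun s t => hwL _) hη _ _)
    rwa [sub_zero, abs_of_nonneg hh] at h2
  have hmem : A ∈ closure {B | B ∈ U → |Ψ B| ≤ L * η * h} := by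
    have hd : Dense {B | B ∈ U → |Ψ B| ≤ L * η * h} := Measure.dense_of_ae hae
    exact hd A
  have h3 : A ∈ closure (U ∩ {B | B ∈ U → |Ψ B| ≤ L * η * h}) :=
    mem_closure_iff_nhdsWithin_neBot.2 (by
      rw [mem_closure_iff_nhdsWithin_neBot] at hmem
      rwa [nhdsWithin_inter_of_mem (nhdsWithin_le_nhds (hUo.mem_nhds hA))])
  have h4 : IsClosed {B | |Ψ B| ≤ L * η * h} := isClosed_le hΨc.abs continuous_const
  exact h4.closure_subset_iff.2 (fun B hB => hB.2 hB.1) h3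

/-- For almost every `z`, the slice of a weak solution satisfies the exact balance. -/
theorem IsWeakSolution.ae_forall_balance
    (hs : IsWeakSolution volume f F w (e, 0) (0, 1) W) (hW : IsOpen W) (hf : Continuous f)
    (hF : Continuous F) (hw : Measurable w) (hfC : ∀ A, |f A| ≤ C) (hFC : ∀ A, |F A| ≤ C)
    (hwC : ∀ A, |w A| ≤ C) {η : ℝ} (hη : 0 ≤ η) :
    ∀ᵐ z : ι → ℝ, ∀ h t : ℝ, 0 ≤ h →
      (∀ p ∈ Icc 0 h ×ˢ Icc t (t + η), lineSlice (· ∈ W) e z p.1 p.2) →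
      vertIntegral (lineSlice f e z) η h t - vertIntegral (lineSlice f e z) η 0 t =
        ∫ σ in (0 : ℝ)..h, (vertIntegral (lineSlice w e z) η σ t -
          (lineSlice F e z σ (t + η) - lineSlice F e z σ t)) := by
  have h1 : ∀ᵐ z : ι → ℝ, ∀ q : ℚ, 0 ≤ (q : ℝ) → ∀ᵐ t : ℝ,
      (∀ p ∈ Icc 0 (q : ℝ) ×ˢ Icc t (t + η), lineSlice (· ∈ W) e z p.1 p.2) →
      vertIntegral (lineSlice f e z) η q t - vertIntegral (lineSlice f e z) η 0 t =
        ∫ σ in (0 : ℝ)..q, (vertIntegral (lineSlice w e z) η σ t -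
          (lineSlice F e z σ (t + η) - lineSlice F e z σ t)) := by
    rw [ae_all_iff]
    intro q
    by_cases hq : 0 ≤ (q : ℝ)
    · have := Measure.ae_ae_of_ae_prod (hs.ae_balance_slice hW hf hF hw hfC hFC hwC hq hη)
      exact this.mono fun z hz _ => hz
    · exact Eventually.of_forall fun z h => absurd h hq
  filter_upwards [h1] with z hz
  have hfs := continuous_lineSlice hf e z
  have hFs := continuous_lineSlice hF e z
  have hws := measurable_lineSlice hw e z
  have hwi : ∀ t x y, IntervalIntegrable (fun σ => vertIntegral (lineSlice w e z) η σ t)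
      volume x y := fun t x y =>
    intervalIntegrable_vertIntegral hws (fun s t => hwC _) hη measurable_const _ _
  have hFi : ∀ t x y, IntervalIntegrable
      (fun σ => lineSlice F e z σ (t + η) - lineSlice F e z σ t) volume x y := fun t x y =>
    Continuous.intervalIntegrable (by
      simp only [lineSlice]
      fun_prop) _ _
  set Ψ : ℝ → ℝ → ℝ := fun h t =>
    vertIntegral (lineSlice f e z) η h t - vertIntegral (lineSlice f e z) η 0 t -
        ((∫ σ in (0 : ℝ)..h, vertIntegral (lineSlice w e z) η σ t) -
          ∫ σ in (0 : ℝ)..h, (lineSlice F e z σ (t + η) - lineSlice F e z σ t)) with hΨ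
  have hiff : ∀ h t, vertIntegral (lineSlice f e z) η h t -
      vertIntegral (lineSlice f e z) η 0 t =
        (∫ σ in (0 : ℝ)..h, (vertIntegral (lineSlice w e z) η σ t -
          (lineSlice F e z σ (t + η) - lineSlice F e z σ t))) ↔ Ψ h t = 0 := by
    intro h t
    rw [intervalIntegral.integral_sub (hwi _ _ _) (hFi _ _ _), hΨ, sub_eq_zero]
  simp only [hiff] at hz ⊢
  have hUc := continuous_vertIntegral hfs η
  -- rational times
  have hrat : ∀ (q : ℚ) (t : ℝ), 0 ≤ (q : ℝ) →
      (∀ p ∈ Icc 0 (q : ℝ) ×ˢ Icc t (t + η), lineSlice (· ∈ W) e z p.1 p.2) → Ψ q t = 0 := by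
    intro q t hq ht
    have hc : Continuous (Ψ q) := by
      refine ((hUc.comp₂ continuous_const continuous_id).sub
        (hUc.comp₂ continuous_const continuous_id)).sub (Continuous.sub ?_ ?_)
      · have hl : ∀ x y, |(∫ σ in (0 : ℝ)..q, vertIntegral (lineSlice w e z) η σ x) -
            ∫ σ in (0 : ℝ)..q, vertIntegral (lineSlice w e z) η σ y| ≤
            (2 * C * q) * |x - y| := by
          intro x y
          rw [← intervalIntegral.integral_sub (hwi _ _ _) (hwi _ _ _)]
          have := intervalIntegral.norm_integral_le_of_norm_le_const (a := (0 : ℝ)) (b := q)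
            (C := 2 * C * |x - y|) (f := fun σ => vertIntegral (lineSlice w e z) η σ x -
              vertIntegral (lineSlice w e z) η σ y)
            (fun σ _ => abs_vertIntegral_sub_le hws (fun s t => hwC _) η σ x y)
          rw [sub_zero, abs_of_nonneg hq] at this
          exact this.trans_eq (by ring)
        have hC0 : 0 ≤ C := (abs_nonneg _).trans (hwC 0)
        exact (LipschitzWith.of_dist_le_mul (K := ⟨2 * C * q, by positivity⟩) hl).continuous
      · exact (continuous_horizontalIntegral hF e q η).comp
          (by fun_prop : Continuous fun t : ℝ => (z, t))
    have hUo : IsOpen {t : ℝ |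
        ∀ p ∈ Icc 0 (q : ℝ) ×ˢ Icc t (t + η), lineSlice (· ∈ W) e z p.1 p.2} :=
      (isOpen_setOf_rectangle_subset hW e q η).preimage
        (by fun_prop : Continuous fun t : ℝ => (z, t))
    refine Measure.eqOn_open_of_ae_eq (μ := volume) (g := fun _ => 0) ?_ hUo hc.continuousOn
      continuousOn_const ht
    exact (ae_restrict_iff' hUo.measurableSet).2 (hz q hq)
  intro h t hh ht
  rcases hh.eq_or_lt with rfl | hh
  · have := hrat 0 t (by simp) (by simpa using ht)
    simpa using this
  · have hc : Continuous fun h => Ψ h t := by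
      refine ((hUc.comp₂ continuous_id continuous_const).sub continuous_const).sub
        ((intervalIntegral.continuous_primitive (fun x y => hwi t x y) 0).sub
          (intervalIntegral.continuous_primitive (fun x y => hFi t x y) 0))
    have hcl : IsClosed {h | Ψ h t = 0} := isClosed_eq hc continuous_const
    have hmem : h ∈ closure {h | Ψ h t = 0} := by
      rw [Metric.mem_closure_iff]
      intro ε hε
      obtain ⟨q, hq1, hq2⟩ := exists_rat_btwn (show max 0 (h - ε) < h from
        max_lt hh (by linarith))
      have hq0 := (le_max_left _ _).trans hq1.le
      have hq3 := (le_max_right _ _).trans_lt hq1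
      refine ⟨q, hrat q t hq0 fun p hp => ht p ⟨⟨hp.1.1, hp.1.2.trans hq2.le⟩, hp.2⟩, ?_⟩
      rw [Real.dist_eq, abs_lt]
      constructor <;> linarith
    exact hcl.closure_subset hmem

end Slice

/-! ### Distributional solutions are Lipschitz along characteristics -/

section Lipschitz

set_option linter.unusedSectionVars false

variable {n : ℕ} {φ : HPlane n → ℝ} {Ω : Set (HPlane n)} {w : HPlane n → Fin (2 * n - 1) → ℝ}
  {j : Fin (2 * n - 1)} {L : ℝ}

/-- The flux `F` such that the `j`-th equation is `∂_{z_j} φ + ∂_t F = w_j`. -/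
noncomputable def flux (φ : HPlane n → ℝ) (j : Fin (2 * n - 1)) (A : HPlane n) : ℝ :=
  if j.val + 1 = n then 1 / 2 * φ A ^ 2 else vertComponent φ j A * φ A

theorem continuous_vertComponent (hφ : Continuous φ) (j : Fin (2 * n - 1)) :
    Continuous (vertComponent φ j) :=
  continuousOn_univ.1 (continuousOn_vertComponent hφ.continuousOn j)

theorem continuous_flux (hφ : Continuous φ) (j : Fin (2 * n - 1)) : Continuous (flux φ j) := by
  unfold flux
  split_ifs
  · fun_prop
  · exact (continuous_vertComponent hφ j).mul hφ

theorem exists_abs_le_flux (hφ : Continuous φ) (hc : HasCompactSupport φ)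
    (j : Fin (2 * n - 1)) : ∃ C, ∀ A, |flux φ j A| ≤ C := by
  refine HasCompactSupport.exists_bound_of_continuous ?_ (continuous_flux hφ j)
  refine hc.mono' (fun A hA => subset_tsupport _ ?_)
  intro h0
  refine hA ?_
  simp [flux, h0]

theorem flux_convex (φ : HPlane n → ℝ) (j : Fin (2 * n - 1)) (z : Fin (2 * n - 1) → ℝ)
    (t t' : ℝ) :
    vertComponent φ j (z, t) * (φ (z, t') - φ (z, t)) ≤ flux φ j (z, t') - flux φ j (z, t) := by
  unfold flux
  split_ifs with hj
  · rw [vertComponent_of_eq hj]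
    nlinarith [sq_nonneg (φ (z, t') - φ (z, t))]
  · rw [vertComponent_congr (φ' := φ) hj (A := (z, t')) (B := (z, t)) (fun _ _ => rfl)]
    linarith

/-- A continuous function on an open set agrees on a compact subset with a continuous function of
compact support. -/
theorem exists_continuous_hasCompactSupport_eqOn (hΩ : IsOpen Ω) (hφ : ContinuousOn φ Ω)
    {K : Set (HPlane n)} (hK : IsCompact K) (hKΩ : K ⊆ Ω) :
    ∃ f : HPlane n → ℝ, Continuous f ∧ HasCompactSupport f ∧ EqOn f φ K := by
  obtain ⟨ρ, hρ, hsub⟩ := hK.exists_cthickening_subset_open hΩ hKΩ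
  obtain ⟨χ, hχ1, hχ0, -⟩ := exists_continuous_one_zero_of_isCompact hK
    (Metric.isOpen_thickening (δ := ρ) (E := K)).isClosed_compl
    (disjoint_compl_right_iff_subset.2 (Metric.self_subset_thickening hρ K))
  have hts : tsupport χ ⊆ Metric.cthickening ρ K := by
    refine (closure_mono fun A hA => ?_).trans (Metric.closure_thickening_subset_cthickening ρ K)
    by_contra hn
    exact hA (hχ0 hn)
  refine ⟨fun A => χ A * φ A, ?_, ?_, fun A hA => by simp [hχ1 hA]⟩
  · refine continuous_of_tsupport fun A hA => ?_
    have hA' : A ∈ Ω := hsub (hts (closure_mono (fun B hB => left_ne_zero_of_mul hB) hA))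
    exact χ.continuous.continuousAt.mul (hφ.continuousAt (hΩ.mem_nhds hA'))
  · exact HasCompactSupport.of_support_subset_isCompact hK.cthickening
      fun A hA => hts (subset_tsupport _ (left_ne_zero_of_mul hA))

/-- A distributional solution is a weak solution near each compact set, for cut-off data. -/
theorem IsDistributionalSolution.isWeakSolution (hs : IsDistributionalSolution φ Ω w)
    {K : Set (HPlane n)} (hKΩ : K ⊆ Ω) {f : HPlane n → ℝ}
    (hf : EqOn f φ K) (j : Fin (2 * n - 1)) :
    IsWeakSolution volume f (flux f j) (fun A => w A j) (Pi.single j 1, 0) (0, 1)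
      (interior K) := by
  intro ψ hψ hc hsupp
  have hsK : tsupport ψ ⊆ K := hsupp.trans interior_subset
  have hsΩ : tsupport ψ ⊆ Ω := hsK.trans hKΩ
  have h0 : ∀ A, A ∉ K → ψ A = 0 := fun A hA => image_eq_zero_of_notMem_tsupport
    (fun h => hA (hsK h))
  have hd0 : ∀ A, A ∉ K → fderiv ℝ ψ A = 0 := fun A hA =>
    image_eq_zero_of_notMem_tsupport (f := fderiv ℝ ψ)
      (fun h => hA (hsK (tsupport_fderiv_subset ℝ h)))
  have hw : ∫ A in Ω, w A j * ψ A = ∫ A, w A j * ψ A :=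
    setIntegral_eq_integral_of_forall_compl_eq_zero fun A hA => by
      rw [h0 A (fun h => hA (hKΩ h)), mul_zero]
  obtain ⟨h1, h2⟩ := hs.2 ψ hψ hc hsΩ j
  rw [hw] at h1 h2
  by_cases hj : j.val + 1 = n
  · rw [← h2 hj, setIntegral_eq_integral_of_forall_compl_eq_zero fun A hA => by
      rw [hd0 A (fun h => hA (hKΩ h))]; simp]
    refine integral_congr_ae (Eventually.of_forall fun A => ?_)
    by_cases hA : A ∈ K
    · simp only [flux, if_pos hj, hf hA]
    · simp [hd0 A hA]
  · rw [← h1 hj, setIntegral_eq_integral_of_forall_compl_eq_zero fun A hA => by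
      rw [hd0 A (fun h => hA (hKΩ h))]; simp]
    refine integral_congr_ae (Eventually.of_forall fun A => ?_)
    by_cases hA : A ∈ K
    · have e : gradField φ j A = (Pi.single j 1, 0) + vertComponent φ j A • (0, 1) := by
        ext <;> simp [gradField]
      simp only [flux, if_neg hj, e, map_add, map_smul, smul_eq_mul, hf hA]
      rw [vertComponent_congr_of_eq (hf hA)]
      ring
    · simp [hd0 A hA]

theorem vertIntegral_const (L η s t : ℝ) : vertIntegral (fun _ _ => L) η s t = L * η := by
  simp [vertIntegral, mul_comm]

section Slice

variable {ι : Type*} [Fintype ι] {f F v : (ι → ℝ) × ℝ → ℝ} {e z : ι → ℝ}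
  {W : Set ((ι → ℝ) × ℝ)} {C : ℝ}

theorem isOpen_setOf_lineSlice (hW : IsOpen W) (e z : ι → ℝ) :
    IsOpen {p : ℝ × ℝ | lineSlice (· ∈ W) e z p.1 p.2} :=
  hW.preimage (by fun_prop : Continuous fun p : ℝ × ℝ => (z + p.1 • e, p.2))

theorem vertIntegral_lineSlice_add (f : (ι → ℝ) × ℝ → ℝ) (e z : ι → ℝ) (η c s t : ℝ) :
    vertIntegral (lineSlice f e (z + c • e)) η s t =
      vertIntegral (lineSlice f e z) η (c + s) t := by
  simp only [vertIntegral, lineSlice_add_smul]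

theorem IsWeakSolution.rectangleBalance_const
    (hs : IsWeakSolution volume f F v (e, 0) (0, 1) W) (hW : IsOpen W) (hf : Continuous f)
    (hF : Continuous F) (hv : Measurable v) (hfC : ∀ A, |f A| ≤ C) (hFC : ∀ A, |F A| ≤ C)
    (hvL : ∀ A, |v A| ≤ L) {η : ℝ} (hη : 0 ≤ η) (z : ι → ℝ) (a : ℝ) :
    RectangleBalance (lineSlice f e z) (lineSlice F e z) (fun _ _ => L)
      {p : ℝ × ℝ | lineSlice (· ∈ W) e z p.1 p.2} η a ∧
    RectangleBalanceGE (lineSlice f e z) (lineSlice F e z) (fun _ _ => -L)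
      {p : ℝ × ℝ | lineSlice (· ∈ W) e z p.1 p.2} η a := by
  have key : ∀ s₁ s₂ t, s₁ ≤ s₂ →
      Icc s₁ s₂ ×ˢ Icc t (t + η) ⊆ {p : ℝ × ℝ | lineSlice (· ∈ W) e z p.1 p.2} →
      |vertIntegral (lineSlice f e z) η s₂ t - vertIntegral (lineSlice f e z) η s₁ t +
        ∫ σ in s₁..s₂, (lineSlice F e z σ (t + η) - lineSlice F e z σ t)| ≤
        L * η * (s₂ - s₁) := by
    intro s₁ s₂ t h12 hO
    have h := hs.abs_balance_le hW hf hF hv hfC hFC hvL (sub_nonneg.2 h12) hη (z + s₁ • e, t)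
      (fun p hp => by
        have := @hO (s₁ + p.1, p.2) ⟨⟨by linarith [hp.1.1], by linarith [hp.1.2]⟩, hp.2⟩
        simpa only [mem_ofPred_eq, lineSlice, add_smul, add_assoc] using this)
    simp only [vertIntegral_lineSlice_add, lineSlice_add_smul, add_zero, add_sub_cancel] at h
    rwa [intervalIntegral.integral_comp_add_left
      (fun σ => lineSlice F e z σ (t + η) - lineSlice F e z σ t), add_zero, add_sub_cancel] at h
  have hFi : ∀ t x y, IntervalIntegrable
      (fun σ => lineSlice F e z σ (t + η) - lineSlice F e z σ t) volume x y := fun t x y =>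
    Continuous.intervalIntegrable (by
      simp only [lineSlice]
      fun_prop) _ _
  constructor <;> intro s₁ s₂ t _ h12 hO <;> have h := abs_le.1 (key s₁ s₂ t h12 hO) <;>
    simp only [vertIntegral_const] <;>
    rw [intervalIntegral.integral_sub (by simp) (hFi _ _ _), intervalIntegral.integral_const,
      smul_eq_mul] <;>
    linarith [h.1, h.2]

end Slice

/-- The part of a characteristic over `[0, h]`, thickened vertically, is compactly contained
in `Ω`. -/
theorem IsCharacteristic.exists_compact_strip (hΩ : IsOpen Ω) {Γ : ℝ → HPlane n} {a b h : ℝ}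
    (hΓ : IsCharacteristic φ Ω j Γ a b) (ha : a < 0) (hb : h < b) :
    ∃ ρ > 0, ∃ K ⊆ Ω, IsCompact K ∧ ∀ s ∈ Icc 0 h, ∀ x, |x - (Γ s).2| ≤ ρ →
      ((Γ s).1, x) ∈ interior K := by
  have hsub : Icc 0 h ⊆ Ioo a b := fun s hs => ⟨by linarith [hs.1], by linarith [hs.2]⟩
  have hcomp : IsCompact (Γ '' Icc 0 h) :=
    isCompact_Icc.image_of_continuousOn (hΓ.continuousOn.mono hsub)
  have hΓΩ : Γ '' Icc 0 h ⊆ Ω := by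
    rintro _ ⟨s, hs, rfl⟩
    exact (hΓ s (hsub hs)).1
  obtain ⟨ρ, hρ, hρΩ⟩ := hcomp.exists_cthickening_subset_open hΩ hΓΩ
  refine ⟨ρ / 2, by positivity, _, hρΩ, hcomp.cthickening, fun s hs x hx => ?_⟩
  refine interior_mono (Metric.thickening_subset_cthickening ρ _) ?_
  rw [Metric.isOpen_thickening.interior_eq, Metric.mem_thickening_iff]
  refine ⟨Γ s, ⟨s, hs, rfl⟩, ?_⟩
  rw [Prod.dist_eq]
  simp only [dist_self, Real.dist_eq]
  exact max_lt hρ (by linarith)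

theorem HasDerivAt.nonpos_of_forall_le {D : ℝ → ℝ} {d ρ : ℝ} (hD : HasDerivAt D d 0)
    (h0 : D 0 = 0) (hρ : 0 < ρ) (h : ∀ η, 0 < η → η < ρ → D η ≤ 0) : d ≤ 0 := by
  by_contra! hd
  obtain ⟨δ, hδ, h1, -⟩ := hD.eventually_slope hd
  have hm : 0 < min δ ρ := lt_min hδ hρ
  have h2 := h1 (min δ ρ / 2) ⟨by positivity, by linarith [min_le_left δ ρ]⟩
  have h3 := h (min δ ρ / 2) (by positivity) (by linarith [min_le_right δ ρ])
  simp only [h0, zero_mul, add_zero] at h2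
  linarith

theorem hasDerivAt_vertIntegral_height {u : ℝ → ℝ → ℝ} (hu : Continuous (Function.uncurry u))
    (s t : ℝ) : HasDerivAt (fun η => vertIntegral u η s t) (u s t) 0 := by
  have hus : Continuous fun τ => u s (t + τ) :=
    hu.comp₂ continuous_const (by fun_prop)
  have := intervalIntegral.integral_hasDerivAt_right (a := 0) (b := 0)
    (hus.intervalIntegrable _ _) hus.aestronglyMeasurable.stronglyMeasurableAtFilter
    hus.continuousAt
  rwa [add_zero] at this

theorem hasDerivAt_vertIntegral_height_sub {u : ℝ → ℝ → ℝ}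
    (hu : Continuous (Function.uncurry u)) (s t : ℝ) :
    HasDerivAt (fun η => vertIntegral u η s (t - η)) (u s t) 0 := by
  have hm : Continuous fun p : ℝ × ℝ => (p.1, -p.2) := by fun_prop
  have h := (hasDerivAt_vertIntegral_height (u := fun s t => -u s (-t)) (hu.comp hm).neg s
    (-t)).neg
  simp only [neg_neg] at h
  refine h.congr_of_eventuallyEq (Eventually.of_forall fun η => ?_)
  simp only [Pi.neg_apply, vertIntegral_reflect, neg_neg]

theorem IsDistributionalSolution.abs_sub_le_of_zero (hs : IsDistributionalSolution φ Ω w)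
    (hΩ : IsOpen Ω) (hw : Measurable w) (hwL : ∀ A j, |w A j| ≤ L) {Γ : ℝ → HPlane n}
    {a b h : ℝ} (hΓ : IsCharacteristic φ Ω j Γ a b) (ha : a < 0) (hh : 0 ≤ h) (hb : h < b) :
    |φ (Γ h) - φ (Γ 0)| ≤ L * h := by
  obtain ⟨ρ, hρ, K, hKΩ, hK, hstrip⟩ := hΓ.exists_compact_strip hΩ ha hb
  obtain ⟨f, hf, hfc, hfφ⟩ := exists_continuous_hasCompactSupport_eqOn hΩ hs.1 hK hKΩ
  have hweak := hs.isWeakSolution hKΩ hfφ j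
  obtain ⟨C₁, hC₁⟩ := hfc.exists_bound_of_continuous hf
  obtain ⟨C₂, hC₂⟩ := exists_abs_le_flux hf hfc j
  have hL0 : 0 ≤ L := (abs_nonneg _).trans (hwL 0 j)
  set e : Fin (2 * n - 1) → ℝ := Pi.single j 1 with he
  set z := (Γ 0).1 with hz
  have hsub : ∀ s ∈ Icc 0 h, s ∈ Ioo a b := fun s hs => ⟨by linarith [hs.1], by linarith [hs.2]⟩
  have h0 : (0 : ℝ) ∈ Ioo a b := hsub 0 ⟨le_rfl, hh⟩
  have hfst : ∀ s ∈ Icc 0 h, (Γ s).1 = z + s • e := fun s hs => by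
    rw [hΓ.fst_eq h0 (hsub s hs), sub_zero]
  have hpt : ∀ s ∈ Icc 0 h, (z + s • e, (Γ s).2) = Γ s := fun s hs => by rw [← hfst s hs]
  have hu := continuous_lineSlice hf e z
  have hF := continuous_lineSlice (continuous_flux hf j) e z
  have hγ : ∀ s ∈ Icc 0 h, HasDerivAt (fun s => (Γ s).2)
      (lineSlice (vertComponent f j) e z s (Γ s).2) s := by
    intro s hs
    have h1 := hΓ.hasDerivAt_snd (hsub s hs)
    have h2 : Γ s ∈ K := interior_subset (hstrip s hs _ (by simp [hρ.le]))
    rwa [vertComponent_congr_of_eq (hfφ h2).symm, ← hpt s hs] at h1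
  have hval : ∀ s ∈ Icc 0 h, lineSlice f e z s (Γ s).2 = φ (Γ s) := by
    intro s hs
    have h2 : Γ s ∈ K := interior_subset (hstrip s hs _ (by simp [hρ.le]))
    rw [lineSlice, hpt s hs, hfφ h2]
  have hbal := fun (η : ℝ) (hη : 0 ≤ η) => hweak.rectangleBalance_const isOpen_interior hf
    (continuous_flux hf j) ((measurable_pi_apply j).comp hw)
    (fun A => (hC₁ A).trans (le_max_left C₁ C₂))
    (fun A => (hC₂ A).trans (le_max_right C₁ C₂)) (fun A => hwL A j) hη z 0
  have hconv : ∀ s t t', lineSlice (vertComponent f j) e z s t *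
      (lineSlice f e z s t' - lineSlice f e z s t) ≤
      lineSlice (flux f j) e z s t' - lineSlice (flux f j) e z s t :=
    fun s t t' => flux_convex f j _ t t'
  rw [abs_le]
  constructor
  · have hD := ((hasDerivAt_vertIntegral_height_sub hu 0 (Γ 0).2).sub
      (hasDerivAt_vertIntegral_height_sub hu h (Γ h).2)).sub
      (((hasDerivAt_id (0 : ℝ)).const_mul L).mul_const h)
    have := hD.nonpos_of_forall_le (by simp [vertIntegral]) hρ (fun η hη hηρ => by
      have := (hbal η hη.le).2.le_strip_of_hasDerivAt hu hF hconv
        (measurable_const (a := -L)) (fun _ _ => (abs_neg L).trans_le (abs_of_nonneg hL0).le) hL0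
        (isOpen_setOf_lineSlice isOpen_interior e z) hη.le hh hγ (fun s hs x hx => by
          have := hstrip s hs x (abs_le.2 ⟨by linarith [hx.1], by linarith [hx.2]⟩)
          rwa [hfst s hs] at this)
      simp only [vertIntegral_const, intervalIntegral.integral_const, sub_zero, smul_eq_mul]
        at this
      simp only [Pi.sub_apply, id]
      linarith)
    rw [hval 0 ⟨le_rfl, hh⟩, hval h ⟨hh, le_rfl⟩] at this
    linarith
  · have hD := ((hasDerivAt_vertIntegral_height hu h (Γ h).2).sub
      (hasDerivAt_vertIntegral_height hu 0 (Γ 0).2)).sub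
      (((hasDerivAt_id (0 : ℝ)).const_mul L).mul_const h)
    have := hD.nonpos_of_forall_le (by simp [vertIntegral]) hρ (fun η hη hηρ => by
      have := (hbal η hη.le).1.strip_le_of_hasDerivAt hu hF hconv
        (measurable_const (a := L)) (fun _ _ => (abs_of_nonneg hL0).le) hL0
        (isOpen_setOf_lineSlice isOpen_interior e z) hη.le hh hγ (fun s hs x hx => by
          have := hstrip s hs x (abs_le.2 ⟨by linarith [hx.1], by linarith [hx.2]⟩)
          rwa [hfst s hs] at this)
      simp only [vertIntegral_const, intervalIntegral.integral_const, sub_zero, smul_eq_mul]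
        at this
      simp only [Pi.sub_apply, id]
      linarith)
    rw [hval 0 ⟨le_rfl, hh⟩, hval h ⟨hh, le_rfl⟩] at this
    linarith

/-- **Dafermos' theorem**: continuous distributional solutions with bounded source are Lipschitz
along all characteristics. -/
theorem IsDistributionalSolution.lipschitzOnWith (hs : IsDistributionalSolution φ Ω w)
    (hΩ : IsOpen Ω) (hw : Measurable w) {L : ℝ≥0} (hwL : ∀ A j, |w A j| ≤ L)
    {Γ : ℝ → HPlane n} {a b : ℝ} (hΓ : IsCharacteristic φ Ω j Γ a b) :
    LipschitzOnWith L (fun s => φ (Γ s)) (Ioo a b) := by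
  have key : ∀ s ∈ Ioo a b, ∀ r ∈ Ioo a b, s ≤ r → |φ (Γ r) - φ (Γ s)| ≤ L * (r - s) := by
    intro s hsm r hr hsr
    have := hs.abs_sub_le_of_zero hΩ hw hwL (hΓ.comp_add_const s) (h := r - s)
      (by linarith [hsm.1]) (by linarith) (by linarith [hr.2])
    simpa using this
  refine LipschitzOnWith.of_dist_le_mul fun s hsm r hr => ?_
  rw [Real.dist_eq, Real.dist_eq]
  rcases le_total s r with h | h
  · rw [abs_sub_comm, abs_sub_comm s r, abs_of_nonneg (sub_nonneg.2 h)]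
    exact key s hsm r hr h
  · rw [abs_of_nonneg (sub_nonneg.2 h)]
    exact key r hr s hsm h

end Lipschitz

/-! ### Vertical Hölder continuity -/

section Holder

theorem sq_le_of_not_crossing_of_neg {d p : ℝ → ℝ} {δ L : ℝ}
    (hd : ∀ s ∈ Ioo (-δ) δ, HasDerivAt d (p s) s)
    (hp : ∀ s ∈ Ioo (-δ) δ, |p s - p 0| ≤ 2 * L * |s|)
    (hz : ∀ s ∈ Ioo (-δ) δ, d s = 0 → p s = 0) (h0 : 0 < d 0) (hL : 0 < L)
    (hsmall : |p 0| < 2 * L * δ) (hneg : p 0 < 0) : p 0 ^ 2 ≤ 4 * L * d 0 := by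
  by_contra! hlt
  set s₀ := -p 0 / (2 * L) with hs₀
  have hs₀pos : 0 < s₀ := div_pos (by linarith) (by positivity)
  have hs₀δ : s₀ < δ := by
    rw [hs₀, div_lt_iff₀ (by positivity)]
    rw [abs_of_neg hneg] at hsmall
    linarith
  have hs₀L : 2 * L * s₀ = -p 0 := by rw [hs₀]; field_simp
  have hsub : Icc 0 s₀ ⊆ Ioo (-δ) δ := fun s hs => ⟨by linarith [hs.1], by linarith [hs.2]⟩
  have hpub : ∀ s ∈ Icc 0 s₀, p s ≤ p 0 + 2 * L * s := by
    intro s hs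
    have := (abs_le.1 (hp s (hsub hs))).2
    rw [abs_of_nonneg hs.1] at this
    linarith
  have hD : ∀ s ∈ Icc 0 s₀, HasDerivAt (fun s => d s - p 0 * s - L * s ^ 2)
      (p s - p 0 - L * (2 * s)) s := by
    intro s hs
    have h1 := ((hd s (hsub hs)).sub ((hasDerivAt_id s).const_mul (p 0))).sub
      (((hasDerivAt_id s).pow 2).const_mul L)
    refine (h1.congr_deriv ?_)
    simp
  have hanti : AntitoneOn (fun s => d s - p 0 * s - L * s ^ 2) (Icc 0 s₀) := by
    refine antitoneOn_of_deriv_nonpos (convex_Icc _ _)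
      (fun s hs => (hD s hs).continuousAt.continuousWithinAt) ?_ ?_
    · intro s hs
      rw [interior_Icc] at hs
      exact (hD s (Ioo_subset_Icc_self hs)).differentiableAt.differentiableWithinAt
    · intro s hs
      rw [interior_Icc] at hs
      rw [(hD s (Ioo_subset_Icc_self hs)).deriv]
      linarith [hpub s (Ioo_subset_Icc_self hs)]
  have h1 := hanti (left_mem_Icc.2 hs₀pos.le) (right_mem_Icc.2 hs₀pos.le) hs₀pos.le
  simp only [mul_zero, sub_zero, ne_eq, OfNat.ofNat_ne_zero, not_false_eq_true, zero_pow] at h1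
  have hneg' : d s₀ < 0 := by
    have e : 4 * L * (p 0 * s₀ + L * s₀ ^ 2) = -p 0 ^ 2 := by
      have : p 0 = -(2 * L * s₀) := by linarith
      rw [this]; ring
    nlinarith
  obtain ⟨s, hs, hs0⟩ := intermediate_value_Ioo' hs₀pos.le
    (fun s hs => (hd s (hsub hs)).continuousAt.continuousWithinAt) ⟨hneg', h0⟩
  have hs' := Ioo_subset_Icc_self hs
  have h2 := hz s (hsub hs') hs0
  have h3 := hpub s hs'
  nlinarith [hs.2]

theorem sq_le_of_not_crossing {d p : ℝ → ℝ} {δ L : ℝ}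
    (hd : ∀ s ∈ Ioo (-δ) δ, HasDerivAt d (p s) s)
    (hp : ∀ s ∈ Ioo (-δ) δ, |p s - p 0| ≤ 2 * L * |s|)
    (hz : ∀ s ∈ Ioo (-δ) δ, d s = 0 → p s = 0) (h0 : 0 < d 0) (hL : 0 < L)
    (hsmall : |p 0| < 2 * L * δ) : p 0 ^ 2 ≤ 4 * L * d 0 := by
  rcases lt_trichotomy (p 0) 0 with h | h | h
  · exact sq_le_of_not_crossing_of_neg hd hp hz h0 hL hsmall h
  · rw [h, zero_pow two_ne_zero]; positivity
  · have hm : ∀ s ∈ Ioo (-δ) δ, -s ∈ Ioo (-δ) δ := fun s hs =>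
      ⟨by linarith [hs.2], by linarith [hs.1]⟩
    have := sq_le_of_not_crossing_of_neg (d := fun s => d (-s)) (p := fun s => -p (-s)) (δ := δ)
      (L := L) (fun s hs => by
        have h1 := (hd (-s) (hm s hs)).comp s (hasDerivAt_neg s)
        exact h1.congr_deriv (by simp))
      (fun s hs => by
        have h1 := hp (-s) (hm s hs)
        rw [abs_neg] at h1
        rw [neg_zero, neg_sub_neg, abs_sub_comm]
        exact h1)
      (fun s hs h => by rw [hz (-s) (hm s hs) h, neg_zero]) (by simpa using h0) hL
      (by simpa using hsmall) (by simpa using h)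
    simpa using this

variable {n : ℕ} {φ : HPlane n → ℝ} {Ω : Set (HPlane n)} {j : Fin (2 * n - 1)}

/-- A function which is uniformly Lipschitz along the characteristics of the nonlinear field is
`1/2`-Hölder continuous in the vertical direction, on compact sets. -/
theorem exists_vertical_holder (hΩ : IsOpen Ω) (hφ : ContinuousOn φ Ω) (hj : j.val + 1 = n)
    (hL : UniformlyLipschitzAlong φ Ω j) {K : Set (HPlane n)} (hK : IsCompact K) (hKΩ : K ⊆ Ω) :
    ∃ C : ℝ, 0 ≤ C ∧ ∀ z t t', (z, t) ∈ K → (z, t') ∈ K →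
      |φ (z, t) - φ (z, t')| ≤ C * √|t - t'| := by
  obtain ⟨L, hL⟩ := hL
  obtain ⟨δ, hδ, hex⟩ := exists_isCharacteristic hΩ hφ hK hKΩ j
  obtain ⟨M, hM⟩ := hK.exists_bound_of_continuousOn (hφ.mono hKΩ)
  set N : ℝ := L + |M| / δ + 1 with hN
  have hN0 : 0 < N := by positivity
  have hLN : (L : ℝ) ≤ N := by
    have : 0 ≤ |M| / δ := by positivity
    linarith
  have hMN : |M| < N * δ := by
    have e : |M| = |M| / δ * δ := by field_simp
    rw [e]
    gcongr
    have : (0 : ℝ) ≤ L := L.2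
    linarith
  have key : ∀ z t t', (z, t) ∈ K → (z, t') ∈ K → t < t' →
      |φ (z, t) - φ (z, t')| ≤ 2 * √N * √|t - t'| := by
    intro z t t' h1 h2 hlt
    obtain ⟨Γ₁, hΓ₁, h₁⟩ := hex _ h1
    obtain ⟨Γ₂, hΓ₂, h₂⟩ := hex _ h2
    have h0 : (0 : ℝ) ∈ Ioo (-δ) δ := ⟨by linarith, hδ⟩
    have hlip : ∀ Γ : ℝ → HPlane n, IsCharacteristic φ Ω j Γ (-δ) δ → ∀ s ∈ Ioo (-δ) δ,
        |φ (Γ s) - φ (Γ 0)| ≤ N * |s| := by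
      intro Γ hΓ s hs
      have := (hL Γ _ _ hΓ).dist_le_mul s hs 0 h0
      rw [Real.dist_eq, Real.dist_eq, sub_zero] at this
      exact this.trans (by gcongr)
    have := sq_le_of_not_crossing (d := fun s => (Γ₂ s).2 - (Γ₁ s).2)
      (p := fun s => φ (Γ₂ s) - φ (Γ₁ s)) (δ := δ) (L := N)
      (fun s hs => by
        have := (hΓ₂.hasDerivAt_snd hs).sub (hΓ₁.hasDerivAt_snd hs)
        rwa [vertComponent_of_eq hj, vertComponent_of_eq hj] at this)
      (fun s hs => by
        have e1 := abs_le.1 (hlip Γ₁ hΓ₁ s hs)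
        have e2 := abs_le.1 (hlip Γ₂ hΓ₂ s hs)
        exact abs_le.2 ⟨by linarith, by linarith⟩)
      (fun s hs he => by
        have : Γ₂ s = Γ₁ s := by
          refine Prod.ext ?_ (sub_eq_zero.1 he)
          rw [hΓ₁.fst_eq_zero hs, hΓ₂.fst_eq_zero hs, h₁, h₂]
        rw [this, sub_self])
      (by simp only [h₁, h₂]; linarith) hN0
      (by
        simp only [h₁, h₂]
        have e1 := hM _ h1
        have e2 := hM _ h2
        rw [Real.norm_eq_abs] at e1 e2
        have e3 := abs_sub (φ (z, t')) (φ (z, t))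
        have e4 := le_abs_self M
        linarith)
    simp only [h₁, h₂] at this
    rw [abs_sub_comm, abs_sub_comm t, abs_of_pos (sub_pos.2 hlt), mul_assoc,
      ← Real.sqrt_mul hN0.le]
    refine abs_le_of_sq_le_sq ?_ (by positivity)
    rw [mul_pow, Real.sq_sqrt (by nlinarith)]
    linarith
  refine ⟨2 * √N, by positivity, fun z t t' h1 h2 => ?_⟩
  rcases lt_trichotomy t t' with h | h | h
  · exact key z t t' h1 h2 h
  · rw [h]; simp
  · rw [abs_sub_comm, abs_sub_comm t]
    exact key z t' t h2 h1 h

end Holder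

/-! ### Differentiation of integrals over the intrinsic boxes -/

section Boxes

set_option linter.unusedSectionVars false

variable {ι : Type*} [Fintype ι] {e : ι → ℝ} {V : (ι → ℝ) × ℝ → ℝ} {K : Set ((ι → ℝ) × ℝ)}
  {M C : ℝ}

/-- The point reached from `A` after time `q.1` along the field `e + V A ∂_t`, moved vertically
by `q.2`. -/
def boxPoint (e : ι → ℝ) (V : (ι → ℝ) × ℝ → ℝ) (A : (ι → ℝ) × ℝ) (q : ℝ × ℝ) : (ι → ℝ) × ℝ :=
  (A.1 + q.1 • e, A.2 + V A * q.1 + q.2)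

/-- Parameters of the intrinsic box of radius `r`. -/
def boxParam (M r : ℝ) : Set (ℝ × ℝ) := Ioo (-r) r ×ˢ Ioo (-(M * r ^ 2)) (M * r ^ 2)

theorem volume_boxParam {r : ℝ} (hr : 0 ≤ r) :
    volume (boxParam M r) = ENNReal.ofReal (4 * M * r ^ 3) := by
  rw [boxParam, Measure.volume_eq_prod, Measure.prod_prod, Real.volume_Ioo, Real.volume_Ioo,
    ← ENNReal.ofReal_mul (by linarith)]
  congr 1
  ring

theorem measurableSet_boxParam (M r : ℝ) : MeasurableSet (boxParam M r) :=
  measurableSet_Ioo.prod measurableSet_Ioo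

theorem measurable_boxPoint (hV : Measurable V) (e : ι → ℝ) :
    Measurable fun p : ((ι → ℝ) × ℝ) × (ℝ × ℝ) => boxPoint e V p.1 p.2 := by
  unfold boxPoint
  have : Measurable fun p : ((ι → ℝ) × ℝ) × (ℝ × ℝ) => V p.1 := hV.comp measurable_fst
  fun_prop

/-- The times `t` such that the point `(z, t)` of `K` sees a given point in its box fill a set of
measure `O(r²)`. -/
theorem volume_setOf_mem_box_le (hC : 0 ≤ C)
    (hV : ∀ z t t', (z, t) ∈ K → (z, t') ∈ K → |V (z, t) - V (z, t')| ≤ C * √|t - t'|)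
    {r σ : ℝ} (hσ : |σ| ≤ r) (z : ι → ℝ) (x : ℝ) :
    volume {t : ℝ | (z, t) ∈ K ∧ x - t - V (z, t) * σ ∈ Ioo (-(M * r ^ 2)) (M * r ^ 2)} ≤
      ENNReal.ofReal (2 * (4 * M + C ^ 2) * r ^ 2) := by
  set S := {t : ℝ | (z, t) ∈ K ∧ x - t - V (z, t) * σ ∈ Ioo (-(M * r ^ 2)) (M * r ^ 2)} with hS
  rcases S.eq_empty_or_nonempty with h | ⟨t₀, ht₀, hx₀⟩
  · rw [h]; simp
  · have hr : 0 ≤ r := (abs_nonneg σ).trans hσ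
    have hsub : S ⊆ Metric.closedBall t₀ ((4 * M + C ^ 2) * r ^ 2) := by
      rintro t ⟨ht, hx⟩
      rw [Metric.mem_closedBall, Real.dist_eq]
      set y := √|t - t₀| with hy
      have hy0 : 0 ≤ y := Real.sqrt_nonneg _
      have hy2 : y ^ 2 = |t - t₀| := Real.sq_sqrt (abs_nonneg _)
      have h1 : |t - t₀ + (V (z, t) - V (z, t₀)) * σ| ≤ 2 * (M * r ^ 2) := by
        rw [abs_le]
        constructor <;> linarith [hx.1, hx.2, hx₀.1, hx₀.2]
      have h2 : |(V (z, t) - V (z, t₀)) * σ| ≤ C * y * r := by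
        rw [abs_mul]
        exact mul_le_mul (hV z t t₀ ht ht₀) hσ (abs_nonneg _) (by positivity)
      have h3 : |t - t₀| ≤ 2 * (M * r ^ 2) + C * y * r := by
        have := abs_sub (t - t₀ + (V (z, t) - V (z, t₀)) * σ) ((V (z, t) - V (z, t₀)) * σ)
        rw [add_sub_cancel_right] at this
        linarith
      nlinarith [sq_nonneg (C * r - y)]
    refine (measure_mono hsub).trans ?_
    rw [Real.volume_closedBall, ← mul_assoc]

theorem indicator_indicator_apply {α β Y : Type*} [Zero Y] (K : Set α) (I : Set β) (b : α → β)
    (c : α → Y) (a : α) : K.indicator (fun x => I.indicator (fun _ => c x) (b x)) a =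
      {x | x ∈ K ∧ b x ∈ I}.indicator c a := by
  by_cases h1 : a ∈ K <;> by_cases h2 : b a ∈ I <;> simp [h1, h2]

/-- The average over boxes is bounded on `L¹`. -/
theorem lintegral_lintegral_box_le (hVm : Measurable V) (hK : MeasurableSet K) (hC : 0 ≤ C)
    (hV : ∀ z t t', (z, t) ∈ K → (z, t') ∈ K → |V (z, t) - V (z, t')| ≤ C * √|t - t'|)
    (hM : 0 ≤ M) {r : ℝ} {f : (ι → ℝ) × ℝ → ℝ≥0∞} (hf : Measurable f) :
    ∫⁻ A in K, ∫⁻ q in boxParam M r, f (boxPoint e V A q) ≤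
      ENNReal.ofReal (4 * (4 * M + C ^ 2) * r ^ 3) * ∫⁻ A, f A := by
  have hfb : Measurable fun p : ((ι → ℝ) × ℝ) × (ℝ × ℝ) => f (boxPoint e V p.1 p.2) :=
    hf.comp (measurable_boxPoint hVm e)
  rw [lintegral_lintegral_swap hfb.aemeasurable]
  have hswap : ∫⁻ q in boxParam M r, ∫⁻ A in K, f (boxPoint e V A q) =
      ∫⁻ σ in Ioo (-r) r, ∫⁻ τ in Ioo (-(M * r ^ 2)) (M * r ^ 2),
        ∫⁻ A in K, f (boxPoint e V A (σ, τ)) := by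
    rw [boxParam, Measure.volume_eq_prod, ← Measure.prod_restrict]
    refine lintegral_prod _ (Measurable.aemeasurable ?_)
    exact (hfb.comp measurable_swap).lintegral_prod_right'
  rw [hswap]
  have hσ : ∀ σ ∈ Ioo (-r) r, ∫⁻ τ in Ioo (-(M * r ^ 2)) (M * r ^ 2),
      ∫⁻ A in K, f (boxPoint e V A (σ, τ)) ≤
        ENNReal.ofReal (2 * (4 * M + C ^ 2) * r ^ 2) * ∫⁻ A, f A := by
    intro σ hσ
    obtain ⟨I, hI⟩ : ∃ I, I = Ioo (-(M * r ^ 2)) (M * r ^ 2) := ⟨_, rfl⟩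
    have hIm : MeasurableSet I := hI ▸ measurableSet_Ioo
    rw [← hI]
    have hVσ : Measurable fun p : ((ι → ℝ) × ℝ) × ℝ => V p.1 := hVm.comp measurable_fst
    rw [lintegral_lintegral_swap (by
      refine Measurable.aemeasurable (hf.comp ?_)
      simp only [boxPoint]
      have : Measurable fun p : ℝ × ((ι → ℝ) × ℝ) => V p.2 := hVm.comp measurable_snd
      fun_prop)]
    -- change of variables in the vertical direction
    have h1 : ∀ A : (ι → ℝ) × ℝ, ∫⁻ τ in I, f (boxPoint e V A (σ, τ)) =
        ∫⁻ x, I.indicator (fun _ => f (A.1 + σ • e, x)) (x - A.2 - V A * σ) := by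
      intro A
      rw [← lintegral_indicator hIm,
        ← lintegral_add_left_eq_self (fun x => I.indicator (fun _ => f (A.1 + σ • e, x))
          (x - A.2 - V A * σ)) (A.2 + V A * σ)]
      refine lintegral_congr fun τ => ?_
      have : A.2 + V A * σ + τ - A.2 - V A * σ = τ := by ring
      rw [this]
      by_cases hτ : τ ∈ I <;> simp [hτ, boxPoint]
    simp only [h1]
    rw [← lintegral_indicator hK]
    have hm3 : Measurable fun p : ((ι → ℝ) × ℝ) × ℝ =>
        K.indicator (fun A => I.indicator (fun _ => f (A.1 + σ • e, p.2))
          (p.2 - A.2 - V A * σ)) p.1 := by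
      have hS : MeasurableSet {p : ((ι → ℝ) × ℝ) × ℝ | p.1 ∈ K ∧
          p.2 - p.1.2 - V p.1 * σ ∈ I} :=
        (hK.preimage measurable_fst).inter (hIm.preimage (by fun_prop))
      have := (hf.comp (by fun_prop : Measurable fun p : ((ι → ℝ) × ℝ) × ℝ =>
        (p.1.1 + σ • e, p.2))).indicator hS
      convert this using 1
      ext p
      rw [indicator_indicator_apply]
      rfl
    have h2 : (fun A => K.indicator (fun A => ∫⁻ x, I.indicator
        (fun _ => f (A.1 + σ • e, x)) (x - A.2 - V A * σ)) A) =
        fun A => ∫⁻ x, K.indicator (fun A => I.indicator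
          (fun _ => f (A.1 + σ • e, x)) (x - A.2 - V A * σ)) A := by
      ext A
      by_cases hA : A ∈ K <;> simp [hA]
    rw [h2, Measure.volume_eq_prod, lintegral_prod _ (by
      exact (hm3.lintegral_prod_right').aemeasurable)]
    have h3 : ∀ z : ι → ℝ, ∫⁻ t, ∫⁻ x, K.indicator (fun A => I.indicator
          (fun _ => f (A.1 + σ • e, x)) (x - A.2 - V A * σ)) (z, t) ≤
        ENNReal.ofReal (2 * (4 * M + C ^ 2) * r ^ 2) * ∫⁻ x, f (z + σ • e, x) := by
      intro z
      rw [lintegral_lintegral_swap (by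
        exact (hm3.comp (by fun_prop : Measurable fun p : ℝ × ℝ =>
          (((z, p.1), p.2) : ((ι → ℝ) × ℝ) × ℝ))).aemeasurable)]
      have hfz : Measurable fun x : ℝ => f (z + σ • e, x) := hf.comp (by fun_prop)
      rw [← lintegral_const_mul _ hfz]
      refine lintegral_mono fun x => ?_
      have hS : MeasurableSet {t : ℝ | (z, t) ∈ K ∧ x - t - V (z, t) * σ ∈ I} := by
        have hVz : Measurable fun t : ℝ => V (z, t) := hVm.comp (by fun_prop)
        exact (hK.preimage (by fun_prop)).inter (hIm.preimage (by fun_prop))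
      have e1 : ∀ t, K.indicator (fun A => I.indicator
          (fun _ => f (A.1 + σ • e, x)) (x - A.2 - V A * σ)) (z, t) =
          {t : ℝ | (z, t) ∈ K ∧ x - t - V (z, t) * σ ∈ I}.indicator
            (fun _ => f (z + σ • e, x)) t := by
        intro t
        rw [indicator_indicator_apply]
        rfl
      simp only [e1]
      rw [lintegral_indicator_const hS, mul_comm]
      gcongr
      rw [hI]
      exact volume_setOf_mem_box_le hC hV (abs_lt.2 hσ).le z x
    refine (lintegral_mono h3).trans_eq ?_
    have hm4 : Measurable fun z : ι → ℝ => ∫⁻ x, f (z, x) := hf.lintegral_prod_right'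
    have hm5 : Measurable fun z : ι → ℝ => ∫⁻ x, f (z + σ • e, x) :=
      hm4.comp (measurable_add_const _)
    rw [lintegral_const_mul _ hm5,
      lintegral_add_right_eq_self (fun z => ∫⁻ x, f (z, x)), lintegral_prod _ hf.aemeasurable]
  refine (setLIntegral_mono' measurableSet_Ioo hσ).trans_eq ?_
  rw [lintegral_const, Measure.restrict_apply_univ, Real.volume_Ioo, mul_right_comm,
    ← ENNReal.ofReal_mul (by positivity)]
  congr 2
  ring

end Boxes

section Lebesgue

set_option linter.unusedSectionVars false

variable {ι : Type*} [Fintype ι] {e : ι → ℝ} {V : (ι → ℝ) × ℝ → ℝ} {K : Set ((ι → ℝ) × ℝ)}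
  {M C : ℝ} {w : (ι → ℝ) × ℝ → ℝ}

/-- The integrated oscillation of `w` over the box of radius `r` at `A`. -/
noncomputable def boxOsc (e : ι → ℝ) (V w : (ι → ℝ) × ℝ → ℝ) (M r : ℝ) (A : (ι → ℝ) × ℝ) :
    ℝ≥0∞ :=
  ∫⁻ q in boxParam M r, ‖w (boxPoint e V A q) - w A‖ₑ

theorem measurable_boxOsc (hV : Measurable V) (hw : Measurable w) (r : ℝ) :
    Measurable (boxOsc e V w M r) := by
  have : Measurable fun p : ((ι → ℝ) × ℝ) × (ℝ × ℝ) =>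
      ‖w (boxPoint e V p.1 p.2) - w p.1‖ₑ :=
    ((hw.comp (measurable_boxPoint hV e)).sub (hw.comp measurable_fst)).enorm
  exact this.lintegral_prod_right'

theorem dist_boxPoint_le {A : (ι → ℝ) × ℝ} {N r : ℝ} (hN : |V A| ≤ N) (hM : 0 ≤ M)
    (hr : 0 ≤ r) (hr1 : r ≤ 1) {q : ℝ × ℝ} (hq : q ∈ boxParam M r) :
    dist (boxPoint e V A q) A ≤ (‖e‖ + N + M) * r := by
  have hN0 : 0 ≤ N := (abs_nonneg _).trans hN
  have h1 : |q.1| ≤ r := (abs_lt.2 hq.1).le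
  have h2 : |q.2| ≤ M * r ^ 2 := (abs_lt.2 hq.2).le
  have h3 : M * r ^ 2 ≤ M * r := by
    gcongr
    nlinarith
  rw [dist_eq_norm]
  refine max_le ?_ ?_
  · simp only [boxPoint, Prod.fst_sub, add_sub_cancel_left, norm_smul, Real.norm_eq_abs]
    have := mul_le_mul_of_nonneg_right h1 (norm_nonneg e)
    nlinarith [mul_nonneg hN0 hr, mul_nonneg hM hr]
  · have e1 : (boxPoint e V A q - A).2 = V A * q.1 + q.2 := by
      simp only [boxPoint, Prod.snd_sub]; ring
    rw [e1, Real.norm_eq_abs]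
    have h4 := abs_add_le (V A * q.1) q.2
    rw [abs_mul] at h4
    have h5 : |V A| * |q.1| ≤ N * r := mul_le_mul hN h1 (abs_nonneg _) hN0
    nlinarith [mul_nonneg (norm_nonneg e) hr]

theorem exists_lintegral_boxOsc_le (hVc : Continuous V) (hK : IsCompact K) (hC : 0 ≤ C)
    (hV : ∀ z t t', (z, t) ∈ K → (z, t') ∈ K → |V (z, t) - V (z, t')| ≤ C * √|t - t'|)
    (hM : 0 ≤ M) (hw : Measurable w) (hwi : Integrable w) :
    ∃ B : ℝ, 0 ≤ B ∧ ∀ ε > 0, ∃ r₀ > 0, ∀ r, 0 < r → r < r₀ →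
      ∫⁻ A in K, boxOsc e V w M r A ≤ ENNReal.ofReal (B * ε * r ^ 3) := by
  refine ⟨4 * (4 * M + C ^ 2) + 4 * M * volume.real K + 4 * M, by positivity, fun ε hε => ?_⟩
  have : (volume : Measure ((ι → ℝ) × ℝ)).IsAddHaarMeasure :=
    inferInstanceAs ((volume : Measure (ι → ℝ)).prod (volume : Measure ℝ)).IsAddHaarMeasure
  obtain ⟨g, hgc, hgε, hg, -⟩ := hwi.exists_hasCompactSupport_lintegral_sub_le
    (ENNReal.ofReal_pos.2 hε).ne'
  obtain ⟨ρ, hρ, hgu⟩ := Metric.uniformContinuous_iff.1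
    (hgc.uniformContinuous_of_continuous hg) ε hε
  obtain ⟨N, hN⟩ := hK.exists_bound_of_continuousOn hVc.continuousOn
  set D := ‖e‖ + |N| + M + 1 with hD
  have hD0 : 0 < D := by positivity
  refine ⟨min 1 (ρ / D), by positivity, fun r hr hrr => ?_⟩
  have hr1 : r ≤ 1 := hrr.le.trans (min_le_left _ _)
  have hrρ : D * r < ρ := by
    have := hrr.trans_le (min_le_right _ _)
    rwa [lt_div_iff₀ hD0, mul_comm] at this
  set h : (ι → ℝ) × ℝ → ℝ≥0∞ := fun A => ‖w A - g A‖ₑ with hh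
  have hm : Measurable h := (hw.sub hg.measurable).enorm
  have hbm := measurable_boxPoint (V := V) hVc.measurable e
  have hvol : volume (boxParam M r) = ENNReal.ofReal (4 * M * r ^ 3) :=
    volume_boxParam hr.le
  have hpt : ∀ A ∈ K, boxOsc e V w M r A ≤
      ((∫⁻ q in boxParam M r, h (boxPoint e V A q)) +
        ENNReal.ofReal ε * ENNReal.ofReal (4 * M * r ^ 3)) +
        h A * ENNReal.ofReal (4 * M * r ^ 3) := by
    intro A hA
    have e1 : ∀ c : ℝ≥0∞, ∫⁻ _ in boxParam M r, c = c * ENNReal.ofReal (4 * M * r ^ 3) := by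
      intro c
      rw [lintegral_const, Measure.restrict_apply_univ, hvol]
    rw [← e1, ← e1, ← lintegral_add_right _ measurable_const,
      ← lintegral_add_right _ measurable_const]
    refine setLIntegral_mono' (measurableSet_boxParam M r) fun q hq => ?_
    have h1 : w (boxPoint e V A q) - w A = (w (boxPoint e V A q) - g (boxPoint e V A q)) +
        (g (boxPoint e V A q) - g A) + -(w A - g A) := by ring
    rw [h1]
    refine (enorm_add_le _ _).trans (add_le_add ((enorm_add_le _ _).trans
      (add_le_add le_rfl ?_)) (by rw [enorm_neg]))
    rw [Real.enorm_eq_ofReal_abs]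
    refine ENNReal.ofReal_le_ofReal ?_
    refine (hgu (lt_of_le_of_lt (dist_boxPoint_le ((hN A hA).trans (le_abs_self N)) hM hr.le hr1
      hq) ?_)).le
    nlinarith
  refine (setLIntegral_mono' hK.measurableSet hpt).trans ?_
  rw [lintegral_add_right _ (hm.mul_const _), lintegral_add_right _ measurable_const,
    lintegral_const, Measure.restrict_apply_univ, lintegral_mul_const _ hm]
  have k1 := lintegral_lintegral_box_le (e := e) (M := M) (r := r) hVc.measurable
    hK.measurableSet hC hV hM hm
  have k2 : ∫⁻ A in K, h A ≤ ENNReal.ofReal ε := (setLIntegral_le_lintegral _ _).trans hgε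
  have k3 : volume K = ENNReal.ofReal (volume.real K) :=
    (ENNReal.ofReal_toReal hK.measure_lt_top.ne).symm
  calc _ ≤ ENNReal.ofReal (4 * (4 * M + C ^ 2) * r ^ 3) * ENNReal.ofReal ε +
        ENNReal.ofReal ε * ENNReal.ofReal (4 * M * r ^ 3) * ENNReal.ofReal (volume.real K) +
        ENNReal.ofReal ε * ENNReal.ofReal (4 * M * r ^ 3) := by
        rw [← k3]
        refine add_le_add (add_le_add (k1.trans ?_) le_rfl) ?_
        · gcongr
        · gcongr
    _ = _ := by
        have hK0 : 0 ≤ volume.real K := measureReal_nonneg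
        rw [← ENNReal.ofReal_mul (by positivity), ← ENNReal.ofReal_mul (by positivity),
          ← ENNReal.ofReal_mul (by positivity), ← ENNReal.ofReal_add (by positivity)
          (by positivity), ← ENNReal.ofReal_add (by positivity) (by positivity)]
        congr 1
        ring

/-- At almost every point, the mean oscillation over the intrinsic boxes is small at arbitrarily
small scales. -/
theorem ae_frequently_boxOsc_le (hVc : Continuous V) (hK : IsCompact K) (hC : 0 ≤ C)
    (hV : ∀ z t t', (z, t) ∈ K → (z, t') ∈ K → |V (z, t) - V (z, t')| ≤ C * √|t - t'|)
    (hM : 0 ≤ M) (hw : Measurable w) (hwi : Integrable w) :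
    ∀ᵐ A ∂(volume.restrict K), ∀ κ > 0, ∃ᶠ k : ℕ in atTop,
      boxOsc e V w M (1 / ((k : ℝ) + 1)) A ≤ ENNReal.ofReal (κ * (1 / ((k : ℝ) + 1)) ^ 3) := by
  obtain ⟨B, hB, hosc⟩ := exists_lintegral_boxOsc_le (e := e) hVc hK hC hV hM hw hwi
  set r : ℕ → ℝ := fun k => 1 / ((k : ℝ) + 1) with hr
  have hr0 : ∀ k, 0 < r k := fun k => by positivity
  have hrt : Tendsto r atTop (𝓝 0) := tendsto_one_div_add_atTop_nhds_zero_nat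
  set F : ℕ → (ι → ℝ) × ℝ → ℝ≥0∞ := fun k A =>
    ENNReal.ofReal ((r k ^ 3)⁻¹) * boxOsc e V w M (r k) A with hF
  have hFm : ∀ k, Measurable (F k) := fun k =>
    (measurable_boxOsc hVc.measurable hw (r k)).const_mul _
  have hlim : Tendsto (fun k => ∫⁻ A in K, F k A) atTop (𝓝 0) := by
    rw [ENNReal.tendsto_nhds_zero]
    intro ε hε
    obtain ⟨ε', hε', hεε⟩ : ∃ ε' : ℝ, 0 < ε' ∧ ENNReal.ofReal ε' ≤ ε := by
      rcases eq_or_ne ε ∞ with h | h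
      · exact ⟨1, one_pos, h ▸ le_top⟩
      · exact ⟨ε.toReal, ENNReal.toReal_pos hε.ne' h, ENNReal.ofReal_toReal_le⟩
    obtain ⟨r₀, hr₀, h⟩ := hosc (ε' / (B + 1)) (by positivity)
    filter_upwards [hrt.eventually (gt_mem_nhds hr₀)] with k hk
    simp only [hF]
    rw [lintegral_const_mul _ (measurable_boxOsc hVc.measurable hw (r k))]
    refine le_trans (mul_le_mul_right (h (r k) (hr0 k) hk) _) (le_trans ?_ hεε)
    rw [← ENNReal.ofReal_mul (by have := hr0 k; positivity)]
    refine ENNReal.ofReal_le_ofReal ?_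
    have h3 := pow_pos (hr0 k) 3
    have e1 : (r k ^ 3)⁻¹ * (B * (ε' / (B + 1)) * r k ^ 3) = ε' * (B / (B + 1)) := by
      have hx := h3.ne'
      generalize r k ^ 3 = x at hx ⊢
      field_simp
    rw [e1]
    have : B / (B + 1) ≤ 1 := by rw [div_le_one (by positivity)]; linarith
    nlinarith
  have hfatou : ∫⁻ A in K, liminf (fun k => F k A) atTop = 0 :=
    le_antisymm ((lintegral_liminf_le hFm).trans_eq hlim.liminf_eq) bot_le
  rw [lintegral_eq_zero_iff (.liminf hFm)] at hfatou
  filter_upwards [hfatou] with A hA κ hκ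
  have h1 : liminf (fun k => F k A) atTop < ENNReal.ofReal κ := by
    simp only [Pi.zero_apply] at hA
    rw [hA]
    exact ENNReal.ofReal_pos.2 hκ
  refine (frequently_lt_of_liminf_lt (by isBoundedDefault) h1).mono fun k hk => ?_
  have h3 := pow_pos (hr0 k) 3
  simp only [hF] at hk
  have h4 : boxOsc e V w M (r k) A =
      ENNReal.ofReal (r k ^ 3) * (ENNReal.ofReal ((r k ^ 3)⁻¹) * boxOsc e V w M (r k) A) := by
    rw [← mul_assoc, ← ENNReal.ofReal_mul h3.le, mul_inv_cancel₀ h3.ne', ENNReal.ofReal_one,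
      one_mul]
  rw [h4, mul_comm κ, ENNReal.ofReal_mul h3.le]
  exact mul_le_mul_right hk.le _

end Lebesgue

/-! ### The source term at Lebesgue points of the intrinsic boxes -/

section StripSlope

variable {u F V w : ℝ → ℝ → ℝ} {L η r β t V₀ : ℝ}

theorem intervalIntegrable_vertIntegral_of_continuousOn (hw : Measurable (Function.uncurry w))
    (hL : ∀ s t, |w s t| ≤ L) (hη : 0 ≤ η) (hr : 0 ≤ r) {c : ℝ → ℝ}
    (hc : ContinuousOn c (Icc 0 r)) :
    IntervalIntegrable (fun s => vertIntegral w η s (c s)) volume 0 r := by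
  have hc' : Continuous (IccExtend hr ((Icc 0 r).domRestrict c)) :=
    continuous_IccExtend_iff.2 (continuousOn_iff_continuous_domRestrict.1 hc)
  refine (intervalIntegrable_vertIntegral hw hL hη hc'.measurable 0 r).congr fun s hs => ?_
  rw [uIoc_of_le hr] at hs
  simp only [IccExtend_of_mem hr _ (Ioc_subset_Icc_self hs)]
  rfl

/-- The mean of `w` over a thin strip inside a box is close to `w₀` if the integrated
oscillation over the box is small. -/
theorem ofReal_abs_integral_vertIntegral_sub_le (hw : Measurable (Function.uncurry w))
    (hL : ∀ s t, |w s t| ≤ L) (hη : 0 ≤ η) (hr : 0 ≤ r) {c : ℝ → ℝ}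
    (hc : ContinuousOn c (Icc 0 r)) (w₀ : ℝ)
    (hcβ : ∀ s ∈ Icc 0 r, ∀ x ∈ Icc (c s) (c s + η), |x - (t + V₀ * s)| < β) :
    ENNReal.ofReal |(∫ s in (0 : ℝ)..r, vertIntegral w η s (c s)) - r * (η * w₀)| ≤
      ∫⁻ q in Ioo (-r) r ×ˢ Ioo (-β) β, ‖w q.1 (t + V₀ * q.1 + q.2) - w₀‖ₑ := by
  have hi := intervalIntegrable_vertIntegral_of_continuousOn hw hL hη hr hc
  have e1 : (∫ s in (0 : ℝ)..r, vertIntegral w η s (c s)) - r * (η * w₀) =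
      ∫ s in Ioo 0 r, (vertIntegral w η s (c s) - η * w₀) := by
    rw [← integral_Ioc_eq_integral_Ioo, ← intervalIntegral.integral_of_le hr,
      intervalIntegral.integral_sub hi (by simp), intervalIntegral.integral_const, sub_zero,
      smul_eq_mul]
  have hm : Measurable fun q : ℝ × ℝ => ‖w q.1 (t + V₀ * q.1 + q.2) - w₀‖ₑ := by
    refine Measurable.enorm (Measurable.sub ?_ measurable_const)
    exact hw.comp (by fun_prop : Measurable fun q : ℝ × ℝ => (q.1, t + V₀ * q.1 + q.2))
  rw [← Real.enorm_eq_ofReal_abs, e1, Measure.volume_eq_prod, ← Measure.prod_restrict,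
    lintegral_prod _ hm.aemeasurable]
  refine (enorm_integral_le_lintegral_enorm _).trans ?_
  refine (setLIntegral_mono' measurableSet_Ioo (g := fun s => ∫⁻ y in Ioo (-β) β,
    ‖w s (t + V₀ * s + y) - w₀‖ₑ) fun s hs => ?_).trans
    (lintegral_mono_set (Ioo_subset_Ioo_left (by linarith)))
  have hws : Measurable (w s) := hw.comp measurable_prodMk_left
  have e2 : vertIntegral w η s (c s) - η * w₀ =
      ∫ τ in Ioc 0 η, (w s (c s + τ) - w₀) := by
    rw [← intervalIntegral.integral_of_le hη, intervalIntegral.integral_sub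
      (f := fun τ => w s (c s + τ))
      (intervalIntegrable_of_measurable_of_bound (hws.comp (measurable_const_add (c s)))
        (fun _ => hL _ _) _ _) intervalIntegrable_const, intervalIntegral.integral_const, sub_zero,
      smul_eq_mul, vertIntegral]
  rw [e2]
  refine (enorm_integral_le_lintegral_enorm _).trans ?_
  rw [← lintegral_indicator measurableSet_Ioc, ← lintegral_indicator measurableSet_Ioo,
    ← lintegral_add_left_eq_self _ (t + V₀ * s - c s)]
  refine lintegral_mono fun y => ?_
  by_cases hy : t + V₀ * s - c s + y ∈ Ioc 0 η
  · have hyβ : y ∈ Ioo (-β) β := by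
      have := hcβ s (Ioo_subset_Icc_self hs) (t + V₀ * s + y)
        ⟨by linarith [hy.1], by linarith [hy.2]⟩
      rw [add_sub_cancel_left] at this
      exact abs_lt.1 this
    rw [indicator_of_mem hy, indicator_of_mem hyβ,
      show c s + (t + V₀ * s - c s + y) = t + V₀ * s + y by ring]
  · rw [indicator_of_notMem hy]
    exact zero_le

theorem abs_vertIntegral_sub_mul_le {h : ℝ} {s : ℝ} (hu : Continuous (Function.uncurry u))
    (hη : 0 ≤ η) {x y : ℝ} (hh : ∀ x' ∈ Icc x (x + η), |u s x' - u s y| ≤ h) :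
    |vertIntegral u η s x - η * u s y| ≤ h * η := by
  have hus : Continuous fun τ => u s (x + τ) := hu.comp₂ continuous_const (by fun_prop)
  have e : vertIntegral u η s x - η * u s y = ∫ τ in (0 : ℝ)..η, (u s (x + τ) - u s y) := by
    rw [intervalIntegral.integral_sub (hus.intervalIntegrable _ _) (by simp),
      intervalIntegral.integral_const, sub_zero, smul_eq_mul, vertIntegral]
  rw [e]
  have := intervalIntegral.norm_integral_le_of_norm_le_const (a := (0 : ℝ)) (b := η) (C := h)
    (f := fun τ => u s (x + τ) - u s y) (fun τ hτ => by
      rw [uIoc_of_le hη] at hτ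
      exact hh _ ⟨by linarith [hτ.1], by linarith [hτ.2]⟩)
  rwa [sub_zero, abs_of_nonneg hη] at this

/-- The increment of `u` along a characteristic, compared with a constant source `w₀`. -/
theorem abs_increment_sub_le {O : Set (ℝ × ℝ)} {γ : ℝ → ℝ} {h E w₀ : ℝ}
    (hR : RectangleBalance u F w O η 0) (hR' : RectangleBalanceGE u F w O η 0)
    (hu : Continuous (Function.uncurry u)) (hF : Continuous (Function.uncurry F))
    (hconv : ∀ s t t', V s t * (u s t' - u s t) ≤ F s t' - F s t)
    (hw : Measurable (Function.uncurry w)) (hL : ∀ s t, |w s t| ≤ L) (hL0 : 0 ≤ L)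
    (hO : IsOpen O) (hη : 0 ≤ η) (hr : 0 ≤ r)
    (hγ : ∀ s ∈ Icc 0 r, HasDerivAt γ (V s (γ s)) s)
    (hstrip : ∀ s ∈ Icc 0 r, ∀ x, |x - γ s| ≤ η → (s, x) ∈ O)
    (hh : ∀ s, s = 0 ∨ s = r → ∀ x, |x - γ s| ≤ η → |u s x - u s (γ s)| ≤ h)
    (hβ : ∀ s ∈ Icc 0 r, |γ s - (t + V₀ * s)| + η < β) (hE : 0 ≤ E)
    (hosc : ∫⁻ q in Ioo (-r) r ×ˢ Ioo (-β) β, ‖w q.1 (t + V₀ * q.1 + q.2) - w₀‖ₑ ≤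
      ENNReal.ofReal E) :
    |u r (γ r) - u 0 (γ 0) - r * w₀| * η ≤ E + 2 * h * η := by
  have hγc : ContinuousOn γ (Icc 0 r) := fun s hs => (hγ s hs).continuousAt.continuousWithinAt
  have hup := hR.strip_le_of_hasDerivAt hu hF hconv hw hL hL0 hO hη hr hγ
    fun s hs x hx => hstrip s hs x (abs_le.2 ⟨by linarith [hx.1], by linarith [hx.2]⟩)
  have hlo := hR'.le_strip_of_hasDerivAt hu hF hconv hw hL hL0 hO hη hr hγ
    fun s hs x hx => hstrip s hs x (abs_le.2 ⟨by linarith [hx.1], by linarith [hx.2]⟩)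
  have o1 := (ENNReal.ofReal_le_ofReal_iff hE).1
    ((ofReal_abs_integral_vertIntegral_sub_le (t := t) (V₀ := V₀) (β := β) hw hL hη hr hγc w₀
      fun s hs x hx => by
        have h1 := abs_lt.1 (lt_sub_iff_add_lt.2 (hβ s hs))
        exact abs_lt.2 ⟨by linarith [hx.1], by linarith [hx.2]⟩).trans hosc)
  have o2 := (ENNReal.ofReal_le_ofReal_iff hE).1
    ((ofReal_abs_integral_vertIntegral_sub_le (t := t) (V₀ := V₀) (β := β) hw hL hη hr
      (c := fun s => γ s - η) (hγc.sub continuousOn_const) w₀ fun s hs x hx => by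
        have h1 := abs_lt.1 (lt_sub_iff_add_lt.2 (hβ s hs))
        exact abs_lt.2 ⟨by linarith [hx.1], by linarith [hx.2]⟩).trans hosc)
  have b : ∀ s, s = 0 ∨ s = r → |vertIntegral u η s (γ s) - η * u s (γ s)| ≤ h * η ∧
      |vertIntegral u η s (γ s - η) - η * u s (γ s)| ≤ h * η := fun s hs =>
    ⟨abs_vertIntegral_sub_mul_le hu hη fun x hx => hh s hs x
        (abs_le.2 ⟨by linarith [hx.1], by linarith [hx.2]⟩),
      abs_vertIntegral_sub_mul_le hu hη fun x hx => hh s hs x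
        (abs_le.2 ⟨by linarith [hx.1], by linarith [hx.2]⟩)⟩
  obtain ⟨b1, b2⟩ := b 0 (.inl rfl)
  obtain ⟨b3, b4⟩ := b r (.inr rfl)
  rw [abs_le] at b1 b2 b3 b4 o1 o2
  rw [← abs_of_nonneg hη, ← abs_mul, abs_of_nonneg hη, abs_le]
  constructor <;> linarith

end StripSlope

section Rectangles

variable {ι : Type*} [Fintype ι] {f F v : (ι → ℝ) × ℝ → ℝ} {e z : ι → ℝ}
  {W : Set ((ι → ℝ) × ℝ)} {L η ρ t₀ : ℝ}

/-- The balances over rectangles with a side at time `0` give those over all rectangles. -/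
theorem rectangleBalance_of_forall_balance (hF : Continuous F) (hv : Measurable v)
    (hvL : ∀ A, |v A| ≤ L) (hη : 0 ≤ η)
    (hbal : ∀ h t, 0 ≤ h →
      (∀ p ∈ Icc 0 h ×ˢ Icc t (t + η), lineSlice (· ∈ W) e z p.1 p.2) →
      vertIntegral (lineSlice f e z) η h t - vertIntegral (lineSlice f e z) η 0 t =
        ∫ σ in (0 : ℝ)..h, (vertIntegral (lineSlice v e z) η σ t -
          (lineSlice F e z σ (t + η) - lineSlice F e z σ t)))
    (hW : ∀ p ∈ Ico 0 ρ ×ˢ Ioo (t₀ - ρ) (t₀ + ρ), lineSlice (· ∈ W) e z p.1 p.2) :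
    RectangleBalance (lineSlice f e z) (lineSlice F e z) (lineSlice v e z)
      (Iio ρ ×ˢ Ioo (t₀ - ρ) (t₀ + ρ)) η 0 ∧
    RectangleBalanceGE (lineSlice f e z) (lineSlice F e z) (lineSlice v e z)
      (Iio ρ ×ˢ Ioo (t₀ - ρ) (t₀ + ρ)) η 0 := by
  have key : ∀ s₁ s₂ t, 0 ≤ s₁ → s₁ ≤ s₂ →
      Icc s₁ s₂ ×ˢ Icc t (t + η) ⊆ Iio ρ ×ˢ Ioo (t₀ - ρ) (t₀ + ρ) →
      vertIntegral (lineSlice f e z) η s₂ t - vertIntegral (lineSlice f e z) η s₁ t =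
        ∫ σ in s₁..s₂, (vertIntegral (lineSlice v e z) η σ t -
          (lineSlice F e z σ (t + η) - lineSlice F e z σ t)) := by
    intro s₁ s₂ t h0 h12 hO
    have hrect : ∀ h, 0 ≤ h → h ≤ s₂ →
        ∀ p ∈ Icc 0 h ×ˢ Icc t (t + η), lineSlice (· ∈ W) e z p.1 p.2 := by
      intro h _ hh p hp
      have := @hO (s₂, p.2) ⟨⟨h12, le_rfl⟩, hp.2⟩
      exact hW p ⟨⟨hp.1.1, (hp.1.2.trans hh).trans_lt this.1⟩, this.2⟩
    have b1 := hbal s₁ t h0 (hrect s₁ h0 h12)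
    have b2 := hbal s₂ t (h0.trans h12) (hrect s₂ (h0.trans h12) le_rfl)
    have hi : ∀ x y, IntervalIntegrable (fun σ => vertIntegral (lineSlice v e z) η σ t -
        (lineSlice F e z σ (t + η) - lineSlice F e z σ t)) volume x y := fun x y =>
      (intervalIntegrable_vertIntegral (measurable_lineSlice hv e z) (fun s t => hvL _) hη
        measurable_const x y).sub (Continuous.intervalIntegrable (by
          simp only [lineSlice]
          fun_prop) _ _)
    rw [← intervalIntegral.integral_interval_sub_left (hi 0 s₂) (hi 0 s₁), ← b1, ← b2]
    ring
  exact ⟨fun s₁ s₂ t h0 h12 hO => (key s₁ s₂ t h0 h12 hO).le,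
    fun s₁ s₂ t h0 h12 hO => (key s₁ s₂ t h0 h12 hO).ge⟩

end Rectangles

section Representative

variable {n : ℕ} {φ : HPlane n → ℝ} {Ω : Set (HPlane n)} {w : HPlane n → Fin (2 * n - 1) → ℝ}
  {j : Fin (2 * n - 1)} {L : ℝ≥0}

theorem IsCharacteristic.abs_vertComponent_sub_le {Γ : ℝ → HPlane n} {a b s r : ℝ}
    (hΓ : IsCharacteristic φ Ω j Γ a b)
    (hL : LipschitzOnWith L (fun s => φ (Γ s)) (Ioo a b)) (hs : s ∈ Ioo a b) (hr : r ∈ Ioo a b) :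
    |vertComponent φ j (Γ r) - vertComponent φ j (Γ s)| ≤ L * |r - s| := by
  by_cases hj : j.val + 1 = n
  · rw [vertComponent_of_eq hj, vertComponent_of_eq hj]
    exact hL.dist_le_mul r hr s hs
  · rw [vertComponent_congr (φ' := φ) hj (A := Γ r) (B := Γ s) fun i hi => by
      rw [hΓ.fst_eq hs hr]; simp [hi], sub_self, abs_zero]
    positivity

theorem IsCharacteristic.abs_snd_sub_le {Γ : ℝ → HPlane n} {δ s : ℝ}
    (hΓ : IsCharacteristic φ Ω j Γ (-δ) δ)
    (hL : LipschitzOnWith L (fun s => φ (Γ s)) (Ioo (-δ) δ)) (h0 : 0 ≤ s) (hs : s < δ) :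
    |(Γ s).2 - ((Γ 0).2 + vertComponent φ j (Γ 0) * s)| ≤ L * s ^ 2 := by
  have hsub : Icc 0 s ⊆ Ioo (-δ) δ := fun x hx => ⟨by linarith [hx.1], by linarith [hx.2]⟩
  have hz : (0 : ℝ) ∈ Ioo (-δ) δ := hsub ⟨le_rfl, h0⟩
  have h := (convex_Icc 0 s).norm_image_sub_le_of_norm_hasDerivWithin_le
    (f := fun x => (Γ x).2 - vertComponent φ j (Γ 0) * x)
    (f' := fun x => vertComponent φ j (Γ x) - vertComponent φ j (Γ 0)) (C := L * s)
    (fun x hx => by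
      have := ((hΓ.hasDerivAt_snd (hsub hx)).sub
        ((hasDerivAt_id x).const_mul (vertComponent φ j (Γ 0)))).hasDerivWithinAt (s := Icc 0 s)
      exact this.congr_deriv (by simp))
    (fun x hx => by
      refine (hΓ.abs_vertComponent_sub_le hL hz (hsub hx)).trans ?_
      rw [sub_zero, abs_of_nonneg hx.1]
      exact mul_le_mul_of_nonneg_left hx.2 L.coe_nonneg)
    (left_mem_Icc.2 h0) (right_mem_Icc.2 h0)
  rw [Real.norm_eq_abs, Real.norm_eq_abs, sub_zero, abs_of_nonneg h0] at h
  convert h using 1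
  · congr 1; ring
  · ring

theorem IsWeakSolution.congr_source {P : Type*} [NormedAddCommGroup P] [NormedSpace ℝ P]
    [MeasurableSpace P] {μ : Measure P} {f F v v' : P → ℝ} {e u : P} {W : Set P}
    (h : IsWeakSolution μ f F v e u W) (hv : EqOn v v' W) : IsWeakSolution μ f F v' e u W := by
  intro ψ hψ hc hsupp
  rw [h ψ hψ hc hsupp]
  congr 1
  refine integral_congr_ae (Eventually.of_forall fun A => ?_)
  by_cases hA : A ∈ tsupport ψ
  · simp only [hv (hsupp hA)]
  · simp [image_eq_zero_of_notMem_tsupport hA]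

/-- The vertical component is Hölder continuous of exponent `1/2` on vertical lines. -/
theorem exists_vertComponent_holder {K : Set (HPlane n)} {C : ℝ} {f : HPlane n → ℝ}
    (hf : ∀ z t t', (z, t) ∈ K → (z, t') ∈ K → |f (z, t) - f (z, t')| ≤ C * √|t - t'|)
    (hC : 0 ≤ C) (j : Fin (2 * n - 1)) (z : Fin (2 * n - 1) → ℝ) (t t' : ℝ) (ht : (z, t) ∈ K)
    (ht' : (z, t') ∈ K) :
    |vertComponent f j (z, t) - vertComponent f j (z, t')| ≤ C * √|t - t'| := by
  by_cases hj : j.val + 1 = n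
  · rw [vertComponent_of_eq hj, vertComponent_of_eq hj]
    exact hf z t t' ht ht'
  · rw [vertComponent_congr (φ' := f) hj (A := (z, t)) (B := (z, t')) fun _ _ => rfl, sub_self,
      abs_zero]
    positivity

/-- At almost every point, the only possible derivative of a distributional solution along a
characteristic is the source term. -/
theorem IsDistributionalSolution.ae_eq_of_hasDerivAt_of_isCompact
    (hs : IsDistributionalSolution φ Ω w) (hΩ : IsOpen Ω) (hw : Measurable w)
    (hwL : ∀ A j, |w A j| ≤ L) {K : Set (HPlane n)} (hK : IsCompact K) (hKΩ : K ⊆ Ω)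
    (j : Fin (2 * n - 1)) :
    ∀ᵐ A ∂(volume.restrict (interior K)), ∀ δ > 0, ∀ Γ : ℝ → HPlane n,
      IsCharacteristic φ Ω j Γ (-δ) δ → Γ 0 = A → ∀ d, HasDerivAt (fun s => φ (Γ s)) d 0 →
        d = w A j := by
  have hn : n - 1 < 2 * n - 1 := by have := j.isLt; omega
  obtain ⟨C, hC, hhol⟩ := exists_vertical_holder hΩ hs.1 (j := ⟨n - 1, hn⟩)
    (by have := j.isLt; simp only; omega)
    ⟨L, fun Γ a b hΓ => hs.lipschitzOnWith hΩ hw hwL hΓ⟩ hK hKΩ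
  obtain ⟨f, hf, hfc, hfφ⟩ := exists_continuous_hasCompactSupport_eqOn hΩ hs.1 hK hKΩ
  obtain ⟨C₁, hC₁⟩ := hfc.exists_bound_of_continuous hf
  obtain ⟨C₂, hC₂⟩ := exists_abs_le_flux hf hfc j
  set e : Fin (2 * n - 1) → ℝ := Pi.single j 1 with he
  set v : HPlane n → ℝ := K.indicator fun A => w A j with hv
  have hvm : Measurable v := ((measurable_pi_apply j).comp hw).indicator hK.measurableSet
  have hvL : ∀ A, |v A| ≤ L := fun A => by
    by_cases hA : A ∈ K
    · rw [hv, indicator_of_mem hA]; exact hwL A j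
    · rw [hv, indicator_of_notMem hA, abs_zero]; exact L.coe_nonneg
  have hvi : Integrable v := by
    rw [hv, integrable_indicator_iff hK.measurableSet]
    exact IntegrableOn.of_bound hK.measure_lt_top
      ((measurable_pi_apply j).comp hw).aestronglyMeasurable L
      (Eventually.of_forall fun A => hwL A j)
  have hweak : IsWeakSolution volume f (flux f j) v (e, 0) (0, 1) (interior K) :=
    (hs.isWeakSolution hKΩ hfφ j).congr_source fun A hA => by
      rw [hv, indicator_of_mem (interior_subset hA)]
  have hfhol : ∀ z t t', (z, t) ∈ K → (z, t') ∈ K → |f (z, t) - f (z, t')| ≤ C * √|t - t'| :=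
    fun z t t' h h' => by rw [hfφ h, hfφ h']; exact hhol z t t' h h'
  set ε : ℕ → ℝ := fun m => 1 / ((m : ℝ) + 1) with hε
  have hε0 : ∀ m, 0 < ε m := fun m => by positivity
  have hε1 : ∀ m, ε m ≤ 1 := fun m => by
    rw [hε]; simp only; rw [div_le_one (by positivity)]; linarith [m.cast_nonneg (α := ℝ)]
  have hεt : Tendsto ε atTop (𝓝 0) := tendsto_one_div_add_atTop_nhds_zero_nat
  have hosc := ae_frequently_boxOsc_le (e := e) (continuous_vertComponent hf j) hK hC
    (exists_vertComponent_holder hfhol hC j) (M := L + 2) (by positivity) hvm hvi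
  have hbal := ae_all_iff.2 fun m : ℕ => ae_all_iff.2 fun k : ℕ =>
    hweak.ae_forall_balance isOpen_interior hf (continuous_flux hf j) hvm
      (C := max (max C₁ C₂) L) (fun A => (hC₁ A).trans (by simp))
      (fun A => (hC₂ A).trans (by simp)) (fun A => (hvL A).trans (by simp))
      (sq_nonneg (ε m * ε k))
  have hbal' := (Measure.quasiMeasurePreserving_fst (μ := (volume : Measure (Fin (2 * n - 1) → ℝ)))
    (ν := (volume : Measure ℝ))).ae hbal
  filter_upwards [ae_mono (Measure.restrict_mono interior_subset le_rfl) hosc,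
    ae_restrict_of_ae hbal', ae_restrict_mem isOpen_interior.measurableSet] with A hA1 hA2 hAK
    δ hδ Γ hΓ hΓ0 d hd
  have hAK' : A ∈ K := interior_subset hAK
  have hLip := hs.lipschitzOnWith hΩ hw hwL hΓ
  obtain ⟨ρ, hρ, hρK⟩ := Metric.isOpen_iff.1 isOpen_interior A hAK
  have hin : ∀ p ∈ Ico 0 ρ ×ˢ Ioo (A.2 - ρ) (A.2 + ρ),
      lineSlice (· ∈ interior K) e A.1 p.1 p.2 := by
    intro p hp
    refine hρK ?_
    rw [mem_ball_iff_norm]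
    refine max_lt ?_ ?_
    · simp only [Prod.fst_sub, add_sub_cancel_left]
      refine (norm_smul_single_le j p.1).trans_lt ?_
      rw [abs_of_nonneg hp.1.1]
      exact hp.1.2
    · simp only [Prod.snd_sub, Real.norm_eq_abs, abs_lt]
      constructor <;> linarith [hp.2.1, hp.2.2]
  have hz : (0 : ℝ) ∈ Ioo (-δ) δ := ⟨by linarith, hδ⟩
  obtain ⟨r₁, hr₁, hγρ⟩ := Metric.continuousAt_iff.1
    (hΓ.hasDerivAt_snd hz).continuousAt (ρ / 2) (by positivity)
  have hpt : ∀ s ∈ Ioo (-δ) δ, (A.1 + s • e, (Γ s).2) = Γ s := fun s hsm => by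
    rw [← hΓ0, ← sub_zero s, ← hΓ.fst_eq hz (by simpa using hsm), sub_zero]
  have hVA : vertComponent f j A = vertComponent φ j A := vertComponent_congr_of_eq (hfφ hAK')
  have key : ∀ m, |d - w A j| ≤ (2 + 2 * C) * ε m := by
    intro m
    have hsl : ∀ᶠ s in 𝓝 (0 : ℝ), |φ (Γ s) - φ A - s * d| ≤ ε m * |s| := by
      have := (hasDerivAt_iff_isLittleO.1 hd).def (hε0 m)
      simpa [hΓ0] using this
    have hev : ∀ᶠ k in atTop, ε k < δ ∧ ε k < r₁ ∧ ε k < ρ ∧ ε k < ρ / 2 ∧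
        |φ (Γ (ε k)) - φ A - ε k * d| ≤ ε m * |ε k| :=
      (hεt.eventually (gt_mem_nhds hδ)).and ((hεt.eventually (gt_mem_nhds hr₁)).and
        ((hεt.eventually (gt_mem_nhds hρ)).and ((hεt.eventually (gt_mem_nhds (half_pos hρ))).and
          (hεt.eventually hsl))))
    obtain ⟨k, hk, hkδ, hkr, hkρ, hkρ', hkd⟩ :=
      ((hA1 (ε m ^ 3) (pow_pos (hε0 m) 3)).and_eventually hev).exists
    set r := ε k with hr
    have hr0 : 0 < r := hε0 k
    set η := (ε m * r) ^ 2 with hη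
    have hmr : 0 < ε m * r := mul_pos (hε0 m) hr0
    have hη0 : 0 < η := by positivity
    have hmr1 : ε m * r ≤ r := mul_le_of_le_one_left hr0.le (hε1 m)
    have hηr : η ≤ r ^ 2 := pow_le_pow_left₀ hmr.le hmr1 2
    have hηρ : η < ρ / 2 := by nlinarith [hε1 k]
    have hsm : ∀ s ∈ Icc 0 r, s ∈ Ioo (-δ) δ := fun s hs =>
      ⟨by linarith [hs.1], by linarith [hs.2]⟩
    have hsO : ∀ s ∈ Icc 0 r, ∀ x, |x - (Γ s).2| ≤ η →
        (s, x) ∈ Iio ρ ×ˢ Ioo (A.2 - ρ) (A.2 + ρ) := by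
      intro s hs x hx
      have h1 := @hγρ s (by
        rw [Real.dist_eq, sub_zero, abs_of_nonneg hs.1]; linarith [hs.2])
      rw [hΓ0, Real.dist_eq, abs_lt] at h1
      rw [abs_le] at hx
      exact ⟨hs.2.trans_lt hkρ, by linarith [h1.1], by linarith [h1.2]⟩
    have hsK : ∀ s ∈ Icc 0 r, ∀ x, |x - (Γ s).2| ≤ η → (A.1 + s • e, x) ∈ K := fun s hs x hx =>
      have h := hsO s hs x hx
      interior_subset (hin (s, x) ⟨⟨hs.1, h.1⟩, h.2⟩)
    have hΓK : ∀ s ∈ Icc 0 r, Γ s ∈ K := fun s hs => by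
      have := hsK s hs (Γ s).2 (by simp [hη0.le])
      rwa [hpt s (hsm s hs)] at this
    have hval : ∀ s ∈ Icc 0 r, lineSlice f e A.1 s (Γ s).2 = φ (Γ s) := fun s hs => by
      rw [lineSlice, hpt s (hsm s hs), hfφ (hΓK s hs)]
    obtain ⟨hR, hR'⟩ := rectangleBalance_of_forall_balance (continuous_flux hf j) hvm hvL hη0.le
      (hA2 m k) hin
    have hmain := abs_increment_sub_le (V := lineSlice (vertComponent f j) e A.1)
      (γ := fun s => (Γ s).2) (h := C * (ε m * r)) (t := A.2) (V₀ := vertComponent f j A)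
      (β := (L + 2) * r ^ 2) (w₀ := v A) (E := ε m ^ 3 * r ^ 3) hR hR'
      (continuous_lineSlice hf e A.1) (continuous_lineSlice (continuous_flux hf j) e A.1)
      (fun s t t' => flux_convex f j _ t t') (measurable_lineSlice hvm e A.1) (fun s t => hvL _)
      L.coe_nonneg (isOpen_Iio.prod isOpen_Ioo) hη0.le hr0.le
      (fun s hs => by
        have h1 := hΓ.hasDerivAt_snd (hsm s hs)
        rwa [vertComponent_congr_of_eq (hfφ (hΓK s hs)).symm, ← hpt s (hsm s hs)] at h1)
      hsO
      (fun s hs x hx => by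
        have hs' : s ∈ Icc 0 r := by
          rcases hs with rfl | rfl
          · exact ⟨le_rfl, hr0.le⟩
          · exact ⟨hr0.le, le_rfl⟩
        refine (hfhol _ _ _ (hsK s hs' x hx) (by
          rw [hpt s (hsm s hs')]; exact hΓK s hs')).trans ?_
        gcongr
        exact (Real.sqrt_le_sqrt hx).trans_eq (Real.sqrt_sq hmr.le))
      (fun s hs => by
        have h1 := hΓ.abs_snd_sub_le hLip hs.1 (hsm s hs).2
        rw [hΓ0] at h1
        rw [hVA]
        have h2 : (L : ℝ) * s ^ 2 ≤ L * r ^ 2 := by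
          have := hs.1
          have := hs.2
          gcongr
        nlinarith [pow_pos hr0 2])
      (by have := hε0 m; positivity) hk
    rw [hval r ⟨hr0.le, le_rfl⟩, hval 0 ⟨le_rfl, hr0.le⟩, hΓ0, hv, indicator_of_mem hAK'] at hmain
    have hmain' : |φ (Γ r) - φ A - r * w A j| ≤ (1 + 2 * C) * (ε m * r) := by
      refine le_of_mul_le_mul_right (hmain.trans_eq ?_) hη0
      rw [hη]; ring
    rw [abs_of_pos hr0] at hkd
    have : |d - w A j| * r ≤ (2 + 2 * C) * ε m * r := by
      rw [← abs_of_pos hr0, ← abs_mul, abs_of_pos hr0]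
      rw [abs_le] at hmain' hkd ⊢
      constructor <;> linarith [hmain'.1, hmain'.2, hkd.1, hkd.2]
    exact le_of_mul_le_mul_right this hr0
  have hlim : Tendsto (fun m => (2 + 2 * C) * ε m) atTop (𝓝 0) := by
    simpa using hεt.const_mul (2 + 2 * C)
  have := ge_of_tendsto' hlim key
  exact sub_eq_zero.1 (abs_nonpos_iff.1 this)

end Representative

section Main

variable {n : ℕ} {φ : HPlane n → ℝ} {Ω : Set (HPlane n)} {w : HPlane n → Fin (2 * n - 1) → ℝ}
  {j : Fin (2 * n - 1)} {L : ℝ≥0}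

/-- At almost every point, the only possible derivatives of a distributional solution along the
characteristics are given by the source term. -/
theorem IsDistributionalSolution.ae_eq_of_hasDerivAt (hs : IsDistributionalSolution φ Ω w)
    (hΩ : IsOpen Ω) (hw : Measurable w) (hwL : ∀ A j, |w A j| ≤ L) :
    ∀ᵐ A ∂(volume.restrict Ω), ∀ j, ∀ δ > 0, ∀ Γ : ℝ → HPlane n,
      IsCharacteristic φ Ω j Γ (-δ) δ → Γ 0 = A → ∀ d, HasDerivAt (fun s => φ (Γ s)) d 0 →
        d = w A j := by
  obtain ⟨K, hK, hKΩ, hex⟩ := hΩ.exists_compact_exhaustion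
  have h := ae_all_iff.2 fun m : ℕ => ae_all_iff.2 fun j =>
    (ae_restrict_iff' isOpen_interior.measurableSet).1
      (hs.ae_eq_of_hasDerivAt_of_isCompact hΩ hw hwL (hK m) (hKΩ m) j)
  filter_upwards [ae_restrict_of_ae h, ae_restrict_mem hΩ.measurableSet] with A hA hAΩ j
  obtain ⟨C, hC, hAC, hCΩ⟩ := exists_compact_subset hΩ hAΩ
  obtain ⟨m, hm⟩ := hex C hCΩ hC
  exact hA m j (interior_mono hm hAC)

/-- An essentially bounded function has a bounded Borel representative. -/
theorem MeasureTheory.MemLp.exists_measurable_abs_le {X ι : Type*} [MeasurableSpace X] [Fintype ι]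
    {μ : Measure X} {w : X → ι → ℝ} (hw : MemLp w ∞ μ) :
    ∃ (L : ℝ≥0) (v : X → ι → ℝ), Measurable v ∧ (∀ A i, |v A i| ≤ L) ∧ v =ᵐ[μ] w := by
  set L := (eLpNorm w ∞ μ).toNNReal with hL
  refine ⟨L, fun A i => max (-L) (min L (hw.1.mk w A i)), ?_, fun A i => ?_, ?_⟩
  · exact measurable_pi_iff.2 fun i => measurable_const.max (measurable_const.min
      ((measurable_pi_apply i).comp hw.1.stronglyMeasurable_mk.measurable))
  · have := L.coe_nonneg
    exact abs_le.2 ⟨le_max_left _ _, max_le (by linarith) (min_le_left _ _)⟩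
  · have hb : ∀ᵐ A ∂μ, ‖w A‖ₑ ≤ eLpNorm w ∞ μ := by
      rw [eLpNorm_exponent_top]
      exact enorm_ae_le_eLpNormEssSup w μ
    filter_upwards [hw.1.ae_eq_mk, hb] with A hA hbA
    have hle : ‖w A‖ ≤ L := by
      rw [← toReal_enorm]
      exact ENNReal.toReal_mono hw.2.ne hbA
    ext i
    have h1 := abs_le.1 ((norm_le_pi_norm (w A) i).trans hle)
    rw [← hA, min_eq_right h1.2, max_eq_right h1.1]

theorem IsDistributionalSolution.congr_ae {v : HPlane n → Fin (2 * n - 1) → ℝ}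
    (hs : IsDistributionalSolution φ Ω w) (h : v =ᵐ[volume.restrict Ω] w) :
    IsDistributionalSolution φ Ω v := by
  refine ⟨hs.1, fun ψ hψ hc hsupp j => ?_⟩
  have e : ∫ A in Ω, v A j * ψ A = ∫ A in Ω, w A j * ψ A :=
    integral_congr_ae (h.mono fun A hA => by simp only [hA])
  rw [e]
  exact hs.2 ψ hψ hc hsupp j

theorem LipschitzOnWith.absContOnOpenInterval {g : ℝ → ℝ} {a b : ℝ}
    (hg : LipschitzOnWith L g (Ioo a b)) : AbsContOnOpenInterval g a b := by
  obtain ⟨G, hG, hgG⟩ := hg.extend_real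
  exact ⟨G, hG.lipschitzOnWith.absolutelyContinuousOnInterval, hgG⟩

theorem IsCharacteristic.shift {Γ : ℝ → HPlane n} {a b s : ℝ}
    (hΓ : IsCharacteristic φ Ω j Γ a b) (hs : s ∈ Ioo a b) :
    ∃ ρ > 0, IsCharacteristic φ Ω j (fun r => Γ (r + s)) (-ρ) ρ :=
  ⟨min (s - a) (b - s), lt_min (by linarith [hs.1]) (by linarith [hs.2]),
    (hΓ.comp_add_const s).mono (by linarith [min_le_left (s - a) (b - s)]) (min_le_right _ _)⟩

/-- Continuous distributional solutions with bounded source are broad solutions. -/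
theorem IsDistributionalSolution.isBroadSolution (hs : IsDistributionalSolution φ Ω w)
    (hΩ : IsOpen Ω) (hw : MemLp w ∞ (volume.restrict Ω)) : IsBroadSolution φ Ω w := by
  classical
  obtain ⟨L, v, hv, hvL, hvw⟩ := hw.exists_measurable_abs_le
  have hsv := hs.congr_ae hvw
  have hLip := fun {j Γ a b} (hΓ : IsCharacteristic φ Ω j Γ a b) =>
    hsv.lipschitzOnWith hΩ hv hvL hΓ
  obtain ⟨G, hGae, hG, hGd⟩ := (hsv.ae_eq_of_hasDerivAt hΩ hv hvL).exists_measurable_mem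
  refine ⟨hs.1, fun A j => if A ∈ G then v A j else truncatedSlope φ Ω j L A,
    fun μ _ => (measurable_pi_iff.2 fun j => ?_ : Measurable _).nullMeasurable,
    ⟨L, fun A _ j => ?_⟩, ?_, fun j δ Γ hδ hΓ => ⟨(hLip hΓ).absContOnOpenInterval, ?_⟩,
    fun j A α hA hα => ?_⟩
  · exact Measurable.ite hG ((measurable_pi_apply j).comp hv) (measurable_truncatedSlope hΩ hs.1 L)
  · beta_reduce
    split_ifs
    · exact hvL A j
    · exact abs_truncatedSlope_le L.coe_nonneg A
  · filter_upwards [hGae, hvw] with A hA hvA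
    simp only [if_pos hA, hvA]
  · filter_upwards [(truncatedSlope_spec hΓ (hLip hΓ)).1, ae_restrict_mem measurableSet_Ioo]
      with s hd hsm
    split_ifs with h
    · obtain ⟨ρ, hρ, hΓs⟩ := hΓ.shift hsm
      rw [← zero_add s] at hd
      rw [← hGd _ h j ρ hρ _ hΓs (by rw [zero_add]) _ (hd.comp_add_const 0 s)]
      simpa only [zero_add] using hd
    · exact hd
  · obtain ⟨δ, hδ, hP⟩ := exists_isCharacteristic hΩ hs.1 (isCompact_singleton (x := A))
      (singleton_subset_iff.2 hA) j
    obtain ⟨Γ, hΓ, hΓ0⟩ := hP A rfl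
    have hd := hα δ hδ Γ hΓ hΓ0
    beta_reduce
    split_ifs with h
    · exact (hGd A h j δ hδ Γ hΓ hΓ0 α hd).symm
    · exact truncatedSlope_eq (abs_le_of_hasDerivAt_of_lipschitzOnWith (hLip hΓ)
        ⟨by linarith, hδ⟩ hd) (hα.upperSlope_eq ⟨δ, hδ, Γ, hΓ, hΓ0⟩)

end Main

theorem theorem5p3 (n : ℕ) (hn : 1 ≤ n) (Ω : Set (HPlane n)) (hΩ : IsOpen Ω)
    (φ : HPlane n → ℝ) (hφ : ContinuousOn φ Ω) :
    (∀ j : Fin (2 * n - 1), UniformlyLipschitzAlong φ Ω j →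
      ∃ what : HPlane n → ℝ, Measurable what ∧
        ∀ (Γ : ℝ → HPlane n) (a b : ℝ), IsCharacteristic φ Ω j Γ a b →
          (∀ᵐ s ∂(volume.restrict (Ioo a b)),
            HasDerivAt (fun r => φ (Γ r)) (what (Γ s)) s) ∧
          {s ∈ Ioo a b | ∃ d : ℝ, HasDerivAt (fun r => φ (Γ r)) d s ∧
            d ≠ what (Γ s)}.Countable) ∧
    (∀ w : HPlane n → Fin (2 * n - 1) → ℝ, MemLp w ∞ (volume.restrict Ω) →
      IsDistributionalSolution φ Ω w → IsBroadSolution φ Ω w) := by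
  refine ⟨fun j hj => ?_, fun w hw hs => hs.isBroadSolution hΩ hw⟩
  obtain ⟨L, hL⟩ := hj
  exact ⟨truncatedSlope φ Ω j L, measurable_truncatedSlope hΩ hφ L,
    fun Γ a b hΓ => truncatedSlope_spec hΓ (hL Γ a b hΓ)⟩
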